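/- Let $\mathcal M$ be the space of real symmetric $4\times 4$ matrices, $\mathcal N\subset\mathcal M$ the subspace of trace zero matrices, and $\mathcal F\subset\mathcal N$ the set of degenerate matrices in $\mathcal N$ (those having a multiple eigenvalue). Let $\mathbb R[\mathcal N]$ be the algebra of real polynomial functions on $\mathcal N$, let $\mathcal I(\mathcal F)\subset\mathbb R[\mathcal N]$ be the ideal of functions vanishing on $\mathcal F$, and let $\mathcal I(\mathcal F)_6$ be its homogeneous component of degree $6$. The group $SO_4$ acts on $\mathcal N$ by $g\cdot A=gAg^T$ and on functions by $(g\cdot f)(A)=f(g^{-1}\cdot A)$. For $A\in\mathcal N$ put $H_i(A)=A^i-\frac14\mathrm{Tr}(A^i)I\in\mathcal N$ and $$\mathcal T(A)=A\wedge H_2(A)\wedge H_3(A)\in\textstyle\bigwedge^3\mathcal N ,$$ and for $\xi\in(\bigwedge^3\mathcal N)^\star$ let $\mathcal T^\star(\xi)$ be the function $A\mapsto\xi(\mathcal T(A))$ on $\mathcal N$. For integers $a\ge|b|$ let $W_{(a,b)}$ denote the irreducible real $SO_4$-module with highest weight $(a,b)$, with respect to the maximal torus $SO_2\times SO_2$ and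 the positive roots $(1,-1)$ and $(1,1)$, and write $W_{(a)}=W_{(a,0)}$. Theorem 3. The image of $\mathcal T^\star$ is contained in $\mathcal I(\mathcal F)_6$, and it is an $SO_4$-submodule isomorphic to $$W_{(3,3)}\oplus W_{(3,-3)}\oplus W_{(4)} ,$$ where the summands have dimensions $7$, $7$ and $25$. Consequently, the discriminant of real symmetric $4\times4$ matrices (the discriminant of the characteristic polynomial, as a function on $\mathcal M$) is a sum of seven squares of elements of the algebra $\mathbb R[\mathcal M]$ of polynomial functions on $\mathcal M$. -/

import Mathlib

open scoped TensorProduct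

namespace SymDisc

noncomputable section

/-! ### Symmetric matrices, degenerate matrices -/

/-- The space `𝓜` of real symmetric `n × n` matrices. -/
def symMat (n : ℕ) : Submodule ℝ (Matrix (Fin n) (Fin n) ℝ) where
  carrier := {A | A.IsSymm}
  zero_mem' := Matrix.isSymm_zero
  add_mem' := fun ha hb => Matrix.IsSymm.add ha hb
  smul_mem' := fun c _ ha => Matrix.IsSymm.smul ha c

/-- The space `𝓝` of trace zero real symmetric `n × n` matrices. -/
def tracelessSymMat (n : ℕ) : Submodule ℝ (Matrix (Fin n) (Fin n) ℝ) :=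
  symMat n ⊓ LinearMap.ker (Matrix.traceLinearMap (Fin n) ℝ ℝ)

theorem mem_tracelessSymMat {n : ℕ} {A : Matrix (Fin n) (Fin n) ℝ} :
    A ∈ tracelessSymMat n ↔ A.IsSymm ∧ A.trace = 0 := Iff.rfl

/-- A real symmetric matrix is degenerate if it has a multiple eigenvalue. -/
def IsDegenerate {n : ℕ} (A : Matrix (Fin n) (Fin n) ℝ) : Prop :=
  ∃ μ : ℝ, 1 < A.charpoly.rootMultiplicity μ

/-- The set `𝓕` of degenerate trace zero symmetric matrices. -/
def degenerateSet (n : ℕ) : Set (tracelessSymMat n) :=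
  {A | IsDegenerate (A : Matrix (Fin n) (Fin n) ℝ)}

/-! ### Polynomial functions, vanishing ideals and their homogeneous components -/

section PolynomialFunctions

variable (V : Type*) [AddCommGroup V] [Module ℝ V]

/-- The algebra `ℝ[V]` of polynomial functions on `V`, generated by the linear forms. -/
def polyFun : Subalgebra ℝ (V → ℝ) :=
  Algebra.adjoin ℝ (Set.range fun (l : Module.Dual ℝ V) (v : V) => l v)

variable {V}

/-- The ideal of `ℝ[V]` of all polynomial functions vanishing on `S`. -/
def vanishingIdeal (S : Set V) : Ideal (polyFun V) where
  carrier := {f | ∀ v ∈ S, (f : V → ℝ) v = 0}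
  zero_mem' := fun _ _ => rfl
  add_mem' := fun {f g} hf hg v hv => by
    change (f : V → ℝ) v + (g : V → ℝ) v = 0
    rw [hf v hv, hg v hv, add_zero]
  smul_mem' := fun c f hf v hv => by
    change (c : V → ℝ) v * (f : V → ℝ) v = 0
    rw [hf v hv, mul_zero]

/-- The degree `d` homogeneous component of an ideal of `ℝ[V]`, as a space of functions on `V`:
the elements `f` of the ideal with `f (c v) = c ^ d f (v)`. -/
def idealComponent (I : Ideal (polyFun V)) (d : ℕ) : Submodule ℝ (V → ℝ) where
  carrier := {f | (∃ p ∈ I, (p : V → ℝ) = f) ∧ ∀ (c : ℝ) (v : V), f (c • v) = c ^ d * f v}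
  zero_mem' := ⟨⟨0, I.zero_mem, rfl⟩, fun _ _ => by simp⟩
  add_mem' := by
    rintro _ _ ⟨⟨p, hp, rfl⟩, hp'⟩ ⟨⟨q, hq, rfl⟩, hq'⟩
    refine ⟨⟨p + q, I.add_mem hp hq, rfl⟩, fun c v => ?_⟩
    rw [Pi.add_apply, Pi.add_apply, hp', hq', mul_add]
  smul_mem' := by
    rintro a _ ⟨⟨p, hp, rfl⟩, hp'⟩
    refine ⟨⟨a • p, ?_, rfl⟩, fun c v => ?_⟩
    · rw [Algebra.smul_def]
      exact I.mul_mem_left _ hp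
    · rw [Pi.smul_apply, Pi.smul_apply, hp', smul_eq_mul, smul_eq_mul, mul_left_comm]

end PolynomialFunctions

/-! ### The action of the special orthogonal group -/

/-- The special orthogonal group `SO_n`. -/
abbrev SO (n : ℕ) := Matrix.specialOrthogonalGroup (Fin n) ℝ

theorem trace_conj {n : ℕ} (g : SO n) (A : Matrix (Fin n) (Fin n) ℝ) :
    ((g : Matrix (Fin n) (Fin n) ℝ) * A * (g : Matrix (Fin n) (Fin n) ℝ).transpose).trace
      = A.trace := by
  have h : (g : Matrix (Fin n) (Fin n) ℝ).transpose * (g : Matrix (Fin n) (Fin n) ℝ) = 1 :=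
    (Matrix.mem_orthogonalGroup_iff' (Fin n) ℝ).1 (Matrix.mem_specialOrthogonalGroup_iff.1 g.2).1
  rw [Matrix.trace_mul_comm, ← mul_assoc, h, one_mul]

/-- The conjugation action of `SO_n` on `𝓝`, `g · A = g A gᵀ`. -/
def conjAction (n : ℕ) : Representation ℝ (SO n) (tracelessSymMat n) where
  toFun g :=
    { toFun := fun A =>
        ⟨(g : Matrix (Fin n) (Fin n) ℝ) * (A : Matrix (Fin n) (Fin n) ℝ) *
            (g : Matrix (Fin n) (Fin n) ℝ).transpose, by
          obtain ⟨h1, h2⟩ := mem_tracelessSymMat.1 A.2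
          refine mem_tracelessSymMat.2 ⟨?_, ?_⟩
          · rw [Matrix.IsSymm, Matrix.transpose_mul, Matrix.transpose_mul,
              Matrix.transpose_transpose, h1.eq, mul_assoc]
          · rw [trace_conj, h2]⟩
      map_add' := fun A B => Subtype.ext (by simp [mul_add, add_mul])
      map_smul' := fun c A => Subtype.ext (by simp) }
  map_one' := by
    ext1 A
    exact Subtype.ext (by simp)
  map_mul' g h := by
    ext1 A
    exact Subtype.ext (by simp [Matrix.transpose_mul, mul_assoc])

/-- The induced action on functions on `𝓝`, `(g · f)(A) = f (g⁻¹ · A)`. -/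
def funAction (n : ℕ) : Representation ℝ (SO n) (tracelessSymMat n → ℝ) where
  toFun g := LinearMap.funLeft ℝ ℝ (conjAction n g⁻¹)
  map_one' := by
    ext f A
    simp [LinearMap.funLeft_apply]
  map_mul' g h := by
    ext f A
    simp [LinearMap.funLeft_apply, mul_inv_rev]

/-! ### The map `𝓣` and its dual -/

/-- The map `H_i : 𝓝 → 𝓝`, `A ↦ A ^ i - (1 / n) Tr (A ^ i) I`. -/
def powMap (n i : ℕ) (A : tracelessSymMat n) : tracelessSymMat n :=
  ⟨(A : Matrix (Fin n) (Fin n) ℝ) ^ i -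
      ((1 / (n : ℝ)) * ((A : Matrix (Fin n) (Fin n) ℝ) ^ i).trace) • 1, by
    obtain ⟨h1, -⟩ := mem_tracelessSymMat.1 A.2
    refine mem_tracelessSymMat.2 ⟨(h1.pow i).sub (Matrix.isSymm_one.smul _), ?_⟩
    rcases Nat.eq_zero_or_pos n with rfl | hn
    · simp [Matrix.trace]
    · have : (n : ℝ) ≠ 0 := by positivity
      rw [Matrix.trace_sub, Matrix.trace_smul, Matrix.trace_one, Fintype.card_fin, smul_eq_mul]
      field_simp
      ring⟩

/-- The map `𝓣 : 𝓝 → ⋀^(n-1) 𝓝`, `A ↦ H_1 (A) ∧ H_2 (A) ∧ ⋯ ∧ H_{n-1} (A)`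
(note `H_1 (A) = A`). -/
def wedgeMap (n : ℕ) (A : tracelessSymMat n) : ⋀[ℝ]^(n - 1) (tracelessSymMat n) :=
  exteriorPower.ιMulti ℝ (n - 1) fun i : Fin (n - 1) => powMap n ((i : ℕ) + 1) A

/-- The linear map `𝓣⋆` on the dual of `⋀^(n-1) 𝓝`, `(𝓣⋆ ξ)(A) = ξ (𝓣 A)`. -/
def dualWedgeMap (n : ℕ) :
    Module.Dual ℝ (⋀[ℝ]^(n - 1) (tracelessSymMat n)) →ₗ[ℝ] (tracelessSymMat n → ℝ) where
  toFun ξ := fun A => ξ (wedgeMap n A)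
  map_add' := fun _ _ => rfl
  map_smul' := fun _ _ => rfl

/-! ### The irreducible `SO_4`-modules `W_(a,b)` -/

/-- The matrix of the rotation by the angle `s` in the first and `t` in the second coordinate
plane of `ℝ⁴ = ℝ² ⊕ ℝ²`. -/
def torusMatrix (s t : ℝ) : Matrix (Fin 4) (Fin 4) ℝ :=
  !![Real.cos s, -Real.sin s, 0, 0;
     Real.sin s, Real.cos s, 0, 0;
     0, 0, Real.cos t, -Real.sin t;
     0, 0, Real.sin t, Real.cos t]

theorem torusMatrix_mem (s t : ℝ) :
    torusMatrix s t ∈ Matrix.specialOrthogonalGroup (Fin 4) ℝ := by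
  have hs := Real.sin_sq_add_cos_sq s
  have ht := Real.sin_sq_add_cos_sq t
  rw [Matrix.mem_specialOrthogonalGroup_iff, Matrix.mem_orthogonalGroup_iff]
  constructor
  · ext i j
    fin_cases i <;> fin_cases j <;>
      simp [torusMatrix, Matrix.mul_apply, Fin.sum_univ_four] <;>
      linarith
  · simp [torusMatrix, Matrix.det_succ_row_zero, Fin.sum_univ_succ, Fin.succAbove]
    linear_combination (Real.sin t ^ 2 + Real.cos t ^ 2) * hs + ht

/-- The standard maximal torus of `SO_4`. -/
def torus (s t : ℝ) : SO 4 := ⟨torusMatrix s t, torusMatrix_mem s t⟩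

section HighestWeight

variable {V : Type*} [AddCommGroup V] [Module ℝ V]

/-- `(p, q)` is a weight of the real representation `ρ` of `SO_4`: in the complexification there
is a nonzero vector on which the torus acts through the character `exp (i (p s + q t))`. -/
def IsWeight (ρ : Representation ℝ (SO 4) V) (m : ℤ × ℤ) : Prop :=
  ∃ v : ℂ ⊗[ℝ] V, v ≠ 0 ∧ ∀ s t : ℝ,
    (ρ (torus s t)).baseChange ℂ v =
      Complex.exp (Complex.I * ((m.1 : ℂ) * (s : ℂ) + (m.2 : ℂ) * (t : ℂ))) • v

/-- `l` is the highest weight of `ρ`: it is a weight and every weight is obtained from it by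
subtracting a sum of the positive roots `(1, -1)` and `(1, 1)`. -/
def HasHighestWeight (ρ : Representation ℝ (SO 4) V) (l : ℤ × ℤ) : Prop :=
  IsWeight ρ l ∧ ∀ m : ℤ × ℤ, IsWeight ρ m →
    ∃ a b : ℕ, l - m = a • ((1, -1) : ℤ × ℤ) + b • ((1, 1) : ℤ × ℤ)

/-- `ρ` is (isomorphic to) the irreducible `SO_4`-module `W_l`: it is a finite dimensional,
continuous, irreducible real representation with highest weight `l`. -/
structure IsIrrepOfHighestWeight (ρ : Representation ℝ (SO 4) V) (l : ℤ × ℤ) : Prop where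
  finite : Module.Finite ℝ V
  continuous : ∀ (v : V) (f : Module.Dual ℝ V), Continuous fun g : SO 4 => f (ρ g v)
  irreducible : ρ.IsIrreducible
  highestWeight : HasHighestWeight ρ l

end HighestWeight

end

end SymDisc

open SymDisc

/-!
The proof rests on the two-fold covering `SU_2 × SU_2 → SO_4`. The left and right isoclinic matrices
`L_i`, `R_j` (`isoclinic`) span the two commuting copies of `𝔰𝔬_3` in `𝔰𝔬_4`, and conjugation gives
two homomorphisms `SO_4 → SO_3` (`rot`). The products `L_i R_j` form a basis of the trace zero
symmetric matrices, so `A` is encoded by the `3 × 3` matrix `M = (Tr (A L_i R_j))` (`moment`), on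
which `SO_4` acts by `M ↦ P M P'ᵀ` with `P, P'` the two rotations (`moment_conj`). The Gram matrices
`S = M Mᵀ` and `S' = Mᵀ M` (`gram`) then transform by `P S Pᵀ` and `P' S' P'ᵀ`, and both are `diag
(s)` with `s_i` the squares of `±d₀ ± d₁ ± d₂ ± d₃` when `A = diag (d)`.

**The summands.** For a symmetric `3 × 3` matrix `S` the symmetrization `cubicForm S u v w` of `det
(u, S v, S² w)` is a harmonic cubic tensor in `S`; on `diag (s)` it is the Vandermonde product of
`s` times the permanent of `(u, v, w)`. Applied to `S` and `S'` it gives the summands `W_(3,3)` and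
`W_(3,-3)`. The antisymmetrized product of the trace-free parts of `S, S²` with those of `S'², S'`
(`biquadraticTensor`) gives `W_(4)`. All three are coefficient spaces of covariant maps
(`IsCovariant`). Their dimensions are bounded above by the linear relations among the coordinates,
and below by weight vectors that do not vanish at one sample matrix. Irreducibility
(`IsCovariant.eq_range_of_invariant`) follows from diagonalization: the covariant takes its values
in the scaled orbit of one vector `e₀`, and an element of the group algebra maps all these values
into the line of `e₀`, so every nonzero invariant subspace contains the function attached to `e₀`.

**The image of `𝓣⋆`.** It is spanned by the minors `wedgeMinor u v`, the determinants of `(u_j ·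
M(A^{i+1}) v_j)`. For `A` diagonal such a minor is a multiple of the Vandermonde product of `s`
times `det (u_j ∘ v_j)` (entrywise products), and `hadamard_identity` expands that determinant along
the permutations of the columns into `det · perm`, `perm · det` and a part made of biquadratic
coefficients. As both sides are covariant, this holds for all `A` (`wedgeMinor_eq`), so the image
lies in the sum of the three modules. Suitable `u, v` isolate each part, and irreducibility gives
the reverse inclusion. The sum is direct because an isoclinic half-turn acts trivially on one of the
two cubic modules but not on the other, and the biquadratic module has another dimension.

**The discriminant.** The Vandermonde product of `s` is `-64` times that of the eigenvalues, so the
minors vanish on degenerate matrices and the squared norm of the cubic tensor of `S` is a multiple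
of the discriminant. In seven coordinates of a harmonic cubic this squared norm is a positive
definite quadratic form, which is then diagonalized explicitly.
-/

namespace SymDisc

open Matrix
open scoped Kronecker

noncomputable section

/-! ### Isoclinic matrices and the homomorphisms from `SO_4` to `SO_3` -/

/-- The isoclinic basis matrices: `isoclinic true i` is `L_i` and `isoclinic false i` is `R_i`. Each
triple multiplies like the imaginary quaternions up to sign, and the two triples commute. -/
def isoclinic : Bool → Fin 3 → Matrix (Fin 4) (Fin 4) ℝ
  | true => ![!![0, 1, 0, 0; -1, 0, 0, 0; 0, 0, 0, 1; 0, 0, -1, 0],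
      !![0, 0, 1, 0; 0, 0, 0, -1; -1, 0, 0, 0; 0, 1, 0, 0],
      !![0, 0, 0, 1; 0, 0, 1, 0; 0, -1, 0, 0; -1, 0, 0, 0]]
  | false => ![!![0, 1, 0, 0; -1, 0, 0, 0; 0, 0, 0, -1; 0, 0, 1, 0],
      !![0, 0, 1, 0; 0, 0, 0, 1; -1, 0, 0, 0; 0, -1, 0, 0],
      !![0, 0, 0, 1; 0, 0, -1, 0; 0, 1, 0, 0; -1, 0, 0, 0]]

theorem isoclinic_transpose (b : Bool) (i : Fin 3) : (isoclinic b i)ᵀ = -isoclinic b i := by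
  cases b <;> fin_cases i <;> ext j k <;> fin_cases j <;> fin_cases k <;> simp [isoclinic]

theorem isoclinic_mul_self (b : Bool) (i : Fin 3) : isoclinic b i * isoclinic b i = -1 := by
  cases b <;> fin_cases i <;> ext j k <;> fin_cases j <;> fin_cases k <;>
    simp [isoclinic, Matrix.mul_apply, Fin.sum_univ_four]

theorem trace_isoclinic_mul (b : Bool) (i j : Fin 3) :
    (isoclinic b i * isoclinic b j).trace = if i = j then -4 else 0 := by
  cases b <;> fin_cases i <;> fin_cases j <;>
    simp [isoclinic, Matrix.trace, Fin.sum_univ_four] <;> norm_num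

theorem trace_isoclinic_mul_skew {F : Matrix (Fin 4) (Fin 4) ℝ} (hF : Fᵀ = -F) (b : Bool)
    (i : Fin 3) : (isoclinic b i * F).trace =
      -2 * ![F 0 1 + (bif b then 1 else -1) * F 2 3, F 0 2 - (bif b then 1 else -1) * F 1 3,
        F 0 3 + (bif b then 1 else -1) * F 1 2] i := by
  have h : ∀ i j, F j i = -F i j := fun i j => congrFun (congrFun hF i) j
  simp only [Matrix.trace, Matrix.diag_apply, Matrix.mul_apply, Fin.sum_univ_four]
  cases b <;> fin_cases i <;>
    simp [isoclinic, h 0 1, h 0 2, h 0 3, h 1 2, h 1 3, h 2 3] <;> ring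

/-- A skew-symmetric matrix is the sum of its self-dual and anti-self-dual parts. -/
theorem skew_decomposition {F : Matrix (Fin 4) (Fin 4) ℝ} (hF : Fᵀ = -F) :
    F = (∑ k, (-(1 / 4) * (isoclinic true k * F).trace) • isoclinic true k) +
      ∑ k, (-(1 / 4) * (isoclinic false k * F).trace) • isoclinic false k := by
  have h : ∀ i j, F j i = -F i j := fun i j => congrFun (congrFun hF i) j
  have h0 : ∀ i, F i i = 0 := fun i => by linarith [h i i]
  simp only [trace_isoclinic_mul_skew hF, Fin.sum_univ_three]
  ext i j
  fin_cases i <;> fin_cases j <;>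
    simp [isoclinic, h 0 1, h 0 2, h 0 3, h 1 2, h 1 3, h 2 3, h0] <;> ring

/-- The polarization of twice the Pfaffian on skew-symmetric `4 × 4` matrices. It is preserved by
`SO_4` and, up to the sign of duality, agrees with the trace form on each isoclinic triple; this is
what makes the two triples invariant under conjugation. -/
def pfaffForm (F G : Matrix (Fin 4) (Fin 4) ℝ) : ℝ :=
  F 0 1 * G 2 3 + F 2 3 * G 0 1 - F 0 2 * G 1 3 - F 1 3 * G 0 2 + F 0 3 * G 1 2 + F 1 2 * G 0 3

theorem pfaffForm_conj (g F G : Matrix (Fin 4) (Fin 4) ℝ) (hF : Fᵀ = -F) (hG : Gᵀ = -G) :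
    pfaffForm (g * F * gᵀ) (g * G * gᵀ) = g.det * pfaffForm F G := by
  have h : ∀ i j, F j i = -F i j := fun i j => congrFun (congrFun hF i) j
  have h0 : ∀ i, F i i = 0 := fun i => by linarith [h i i]
  have k : ∀ i j, G j i = -G i j := fun i j => congrFun (congrFun hG i) j
  have k0 : ∀ i, G i i = 0 := fun i => by linarith [k i i]
  simp only [pfaffForm, Matrix.mul_apply, Fin.sum_univ_four, Matrix.transpose_apply,
    h 0 1, h 0 2, h 0 3, h 1 2, h 1 3, h 2 3, h0, k 0 1, k 0 2, k 0 3, k 1 2, k 1 3, k 2 3, k0]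
  simp [Matrix.det_succ_row_zero, Fin.sum_univ_succ, Fin.succAbove]
  ring

theorem pfaffForm_isoclinic (b : Bool) (i : Fin 3) {F : Matrix (Fin 4) (Fin 4) ℝ}
    (hF : Fᵀ = -F) :
    pfaffForm F (isoclinic b i) = (bif b then -1 else 1) * (1 / 2) * (isoclinic b i * F).trace := by
  rw [trace_isoclinic_mul_skew hF]
  cases b <;> fin_cases i <;> simp [isoclinic, pfaffForm] <;> ring

theorem SO_transpose_mul {n : ℕ} (g : SO n) :
    (g : Matrix (Fin n) (Fin n) ℝ)ᵀ * (g : Matrix (Fin n) (Fin n) ℝ) = 1 :=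
  (Matrix.mem_orthogonalGroup_iff' (Fin n) ℝ).1 (Matrix.mem_specialOrthogonalGroup_iff.1 g.2).1

theorem SO_mul_transpose {n : ℕ} (g : SO n) :
    (g : Matrix (Fin n) (Fin n) ℝ) * (g : Matrix (Fin n) (Fin n) ℝ)ᵀ = 1 :=
  (Matrix.mem_orthogonalGroup_iff (Fin n) ℝ).1 (Matrix.mem_specialOrthogonalGroup_iff.1 g.2).1

theorem SO_det {n : ℕ} (g : SO n) : (g : Matrix (Fin n) (Fin n) ℝ).det = 1 :=
  (Matrix.mem_specialOrthogonalGroup_iff.1 g.2).2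

theorem SO_coe_inv {n : ℕ} (g : SO n) :
    ((g⁻¹ : SO n) : Matrix (Fin n) (Fin n) ℝ) = (g : Matrix (Fin n) (Fin n) ℝ)ᵀ := by
  have h : ((g⁻¹ : SO n) : Matrix (Fin n) (Fin n) ℝ) * (g : Matrix (Fin n) (Fin n) ℝ) = 1 := by
    exact congrArg Subtype.val (inv_mul_cancel g)
  calc ((g⁻¹ : SO n) : Matrix (Fin n) (Fin n) ℝ)
      = (g⁻¹ : SO n) * ((g : Matrix (Fin n) (Fin n) ℝ) * (g : Matrix (Fin n) (Fin n) ℝ)ᵀ) := by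
        rw [SO_mul_transpose, mul_one]
    _ = _ := by rw [← mul_assoc, h, one_mul]

theorem conj_skew (g F : Matrix (Fin 4) (Fin 4) ℝ) (hF : Fᵀ = -F) :
    (g * F * gᵀ)ᵀ = -(g * F * gᵀ) := by
  simp [Matrix.transpose_mul, hF, mul_assoc]

/-- Conjugation by `SO_4` keeps each isoclinic triple orthogonal to the other one: the trace form
and the Pfaffian form are both invariant but compare with opposite signs on the two triples. -/
theorem trace_isoclinic_conj_not (b : Bool) (g : SO 4) (k i : Fin 3) :
    (isoclinic (!b) k * ((g : Matrix (Fin 4) (Fin 4) ℝ) * isoclinic b i *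
      (g : Matrix (Fin 4) (Fin 4) ℝ)ᵀ)).trace = 0 := by
  set m := (g : Matrix (Fin 4) (Fin 4) ℝ) with hm
  have hl : mᵀ * m = 1 := SO_transpose_mul g
  have hr : m * mᵀ = 1 := SO_mul_transpose g
  have hs := isoclinic_transpose b i
  have ht := isoclinic_transpose (!b) k
  have h1 := pfaffForm_isoclinic (!b) k (conj_skew m _ hs)
  have h2 := pfaffForm_isoclinic b i (conj_skew mᵀ _ ht)
  have h3 := pfaffForm_conj m (isoclinic b i) (mᵀ * isoclinic (!b) k * m) hs
    (by simpa using conj_skew mᵀ _ ht)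
  have h4 : m * (mᵀ * isoclinic (!b) k * m) * mᵀ = isoclinic (!b) k := by
    rw [mul_assoc, mul_assoc, mul_assoc, hr, mul_one, ← mul_assoc, hr, one_mul]
  have h5 : (isoclinic b i * (mᵀ * isoclinic (!b) k * m)).trace =
      (isoclinic (!b) k * (m * isoclinic b i * mᵀ)).trace := by
    rw [← mul_assoc, ← mul_assoc, Matrix.trace_mul_comm, Matrix.trace_mul_comm (isoclinic (!b) k)]
    simp only [mul_assoc]
  have h6 : pfaffForm (isoclinic b i) (mᵀ * isoclinic (!b) k * m) =
      pfaffForm (mᵀ * isoclinic (!b) k * m) (isoclinic b i) := by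
    simp only [pfaffForm]; ring
  rw [h4, SO_det, h1, h6] at h3
  rw [transpose_transpose] at h2
  rw [h2, h5] at h3
  cases b <;> simp at h3 <;> simp <;> linarith

/-- The homomorphism `SO_4 → SO_3` given by conjugation on the span of the isoclinic triple `b`. -/
def rot (b : Bool) (g : SO 4) : Matrix (Fin 3) (Fin 3) ℝ := fun i j =>
  -(1 / 4) * (isoclinic b i * ((g : Matrix (Fin 4) (Fin 4) ℝ) * isoclinic b j *
    (g : Matrix (Fin 4) (Fin 4) ℝ)ᵀ)).trace

theorem conj_isoclinic (b : Bool) (g : SO 4) (i : Fin 3) :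
    (g : Matrix (Fin 4) (Fin 4) ℝ) * isoclinic b i * (g : Matrix (Fin 4) (Fin 4) ℝ)ᵀ =
      ∑ k, rot b g k i • isoclinic b k := by
  have h := skew_decomposition (conj_skew (g : Matrix (Fin 4) (Fin 4) ℝ) _
    (isoclinic_transpose b i))
  have h0 := fun k => trace_isoclinic_conj_not b g k i
  rw [h]
  cases b
  · rw [Bool.not_false] at h0
    simp only [h0, mul_zero, zero_smul, Finset.sum_const_zero, zero_add, rot]
  · rw [Bool.not_true] at h0
    simp only [h0, mul_zero, zero_smul, Finset.sum_const_zero, add_zero, rot]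

theorem rot_inv (b : Bool) (g : SO 4) : rot b g⁻¹ = (rot b g)ᵀ := by
  ext i j
  rw [transpose_apply, rot, rot, SO_coe_inv, transpose_transpose, Matrix.trace_mul_comm]
  congr 1
  rw [mul_assoc, mul_assoc, Matrix.trace_mul_comm]
  simp only [mul_assoc]

theorem rot_transpose_mul (b : Bool) (g : SO 4) : (rot b g)ᵀ * rot b g = 1 := by
  ext i j
  have h : ((g : Matrix (Fin 4) (Fin 4) ℝ) * isoclinic b i * (g : Matrix (Fin 4) (Fin 4) ℝ)ᵀ *
      ((g : Matrix (Fin 4) (Fin 4) ℝ) * isoclinic b j * (g : Matrix (Fin 4) (Fin 4) ℝ)ᵀ)).trace =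
      (isoclinic b i * isoclinic b j).trace := by
    rw [← trace_conj g (isoclinic b i * isoclinic b j)]
    congr 1
    calc _ = (g : Matrix (Fin 4) (Fin 4) ℝ) * isoclinic b i *
          ((g : Matrix (Fin 4) (Fin 4) ℝ)ᵀ * (g : Matrix (Fin 4) (Fin 4) ℝ)) *
          isoclinic b j * (g : Matrix (Fin 4) (Fin 4) ℝ)ᵀ := by simp only [mul_assoc]
      _ = _ := by rw [SO_transpose_mul, mul_one]; simp only [mul_assoc]
  rw [conj_isoclinic, conj_isoclinic, trace_isoclinic_mul] at h
  simp only [Finset.sum_mul, Finset.mul_sum, Matrix.trace_sum, Matrix.smul_mul, Matrix.mul_smul,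
    Matrix.trace_smul, trace_isoclinic_mul, smul_eq_mul, mul_ite, mul_zero,
    Finset.sum_ite_eq', Finset.mem_univ, if_true] at h
  rw [Matrix.mul_apply, Matrix.one_apply]
  simp only [Fin.sum_univ_three, transpose_apply] at h ⊢
  split_ifs at h ⊢ <;> linarith

theorem rot_mul_transpose (b : Bool) (g : SO 4) : rot b g * (rot b g)ᵀ = 1 :=
  mul_eq_one_comm.1 (rot_transpose_mul b g)

/-- The triple product of the isoclinic basis is invariant under conjugation, so `rot b g` preserves
orientation. -/
theorem det_rot (b : Bool) (g : SO 4) : (rot b g).det = 1 := by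
  have key : ∀ P : Matrix (Fin 3) (Fin 3) ℝ,
      ((∑ k, P k 0 • isoclinic b k) * (∑ k, P k 1 • isoclinic b k) *
        (∑ k, P k 2 • isoclinic b k)).trace = (bif b then 4 else -4) * P.det := by
    intro P
    rw [det_fin_three]
    cases b <;>
      simp [isoclinic, Matrix.trace, Fin.sum_univ_four, Fin.sum_univ_three] <;>
      ring
  have h1 := key (rot b g)
  have h2 := key 1
  rw [← conj_isoclinic, ← conj_isoclinic, ← conj_isoclinic] at h1
  have h3 : (isoclinic b 0 * isoclinic b 1 * isoclinic b 2).trace = (bif b then 4 else -4) := by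
    simpa [Fin.sum_univ_three] using h2
  have h4 := trace_conj g (isoclinic b 0 * isoclinic b 1 * isoclinic b 2)
  have h5 : (g : Matrix (Fin 4) (Fin 4) ℝ) * isoclinic b 0 * (g : Matrix (Fin 4) (Fin 4) ℝ)ᵀ *
      ((g : Matrix (Fin 4) (Fin 4) ℝ) * isoclinic b 1 * (g : Matrix (Fin 4) (Fin 4) ℝ)ᵀ) *
      ((g : Matrix (Fin 4) (Fin 4) ℝ) * isoclinic b 2 * (g : Matrix (Fin 4) (Fin 4) ℝ)ᵀ) =
      (g : Matrix (Fin 4) (Fin 4) ℝ) * (isoclinic b 0 * isoclinic b 1 * isoclinic b 2) *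
        (g : Matrix (Fin 4) (Fin 4) ℝ)ᵀ := by
    calc _ = (g : Matrix (Fin 4) (Fin 4) ℝ) * isoclinic b 0 *
          ((g : Matrix (Fin 4) (Fin 4) ℝ)ᵀ * (g : Matrix (Fin 4) (Fin 4) ℝ)) *
          isoclinic b 1 * ((g : Matrix (Fin 4) (Fin 4) ℝ)ᵀ * (g : Matrix (Fin 4) (Fin 4) ℝ)) *
          isoclinic b 2 * (g : Matrix (Fin 4) (Fin 4) ℝ)ᵀ := by simp only [mul_assoc]
      _ = _ := by rw [SO_transpose_mul, mul_one, mul_one]; simp only [mul_assoc]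
  rw [h5, h4, h3] at h1
  cases b <;> simp at h1 <;> linarith

/-! ### Symmetric `4 × 4` matrices as `3 × 3` matrices -/

/-- The matrix of coordinates `Tr (A L_i R_j)` of `A`. It identifies the trace zero symmetric `4 ×
4` matrices with the `3 × 3` matrices and kills scalar matrices. -/
def moment : Matrix (Fin 4) (Fin 4) ℝ →ₗ[ℝ] Matrix (Fin 3) (Fin 3) ℝ where
  toFun A := Matrix.of fun i j => (A * (isoclinic true i * isoclinic false j)).trace
  map_add' A B := by ext i j; simp [add_mul]
  map_smul' c A := by ext i j; simp

theorem moment_apply (A : Matrix (Fin 4) (Fin 4) ℝ) (i j : Fin 3) :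
    moment A i j = (A * (isoclinic true i * isoclinic false j)).trace := rfl

theorem conj_transpose_isoclinic (b : Bool) (g : SO 4) (i : Fin 3) :
    (g : Matrix (Fin 4) (Fin 4) ℝ)ᵀ * isoclinic b i * (g : Matrix (Fin 4) (Fin 4) ℝ) =
      ∑ k, rot b g i k • isoclinic b k := by
  have h := conj_isoclinic b g⁻¹ i
  simpa only [SO_coe_inv, transpose_transpose, rot_inv, transpose_apply] using h

theorem moment_conj (g : SO 4) (A : Matrix (Fin 4) (Fin 4) ℝ) :
    moment ((g : Matrix (Fin 4) (Fin 4) ℝ) * A * (g : Matrix (Fin 4) (Fin 4) ℝ)ᵀ) =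
      rot true g * moment A * (rot false g)ᵀ := by
  ext i j
  set m := (g : Matrix (Fin 4) (Fin 4) ℝ) with hm
  have h1 : (m * A * mᵀ * (isoclinic true i * isoclinic false j)).trace =
      (A * ((mᵀ * isoclinic true i * m) * (mᵀ * isoclinic false j * m))).trace := by
    have e : (mᵀ * isoclinic true i * m) * (mᵀ * isoclinic false j * m) =
        mᵀ * (isoclinic true i * isoclinic false j) * m := by
      calc _ = mᵀ * isoclinic true i * (m * mᵀ) * isoclinic false j * m := by
            simp only [mul_assoc]
        _ = _ := by rw [hm, SO_mul_transpose, mul_one]; simp only [mul_assoc]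
    rw [e, mul_assoc, mul_assoc, Matrix.trace_mul_comm]
    simp only [mul_assoc]
  rw [moment_apply, h1, hm, conj_transpose_isoclinic, conj_transpose_isoclinic]
  simp only [Finset.sum_mul, Finset.mul_sum, Matrix.trace_sum, Matrix.smul_mul, Matrix.mul_smul,
    Matrix.trace_smul, smul_eq_mul, ← moment_apply, Matrix.mul_apply, transpose_apply]
  refine Finset.sum_congr rfl fun l _ => Finset.sum_congr rfl fun k _ => ?_
  ring

/-- The two Gram matrices `M Mᵀ` (for `true`) and `Mᵀ M` (for `false`) of `M = moment A`. -/
def gram : Bool → Matrix (Fin 4) (Fin 4) ℝ → Matrix (Fin 3) (Fin 3) ℝ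
  | true, A => moment A * (moment A)ᵀ
  | false, A => (moment A)ᵀ * moment A

theorem gram_transpose (b : Bool) (A : Matrix (Fin 4) (Fin 4) ℝ) : (gram b A)ᵀ = gram b A := by
  cases b <;> simp [gram]

theorem gram_conj (b : Bool) (g : SO 4) (A : Matrix (Fin 4) (Fin 4) ℝ) :
    gram b ((g : Matrix (Fin 4) (Fin 4) ℝ) * A * (g : Matrix (Fin 4) (Fin 4) ℝ)ᵀ) =
      rot b g * gram b A * (rot b g)ᵀ := by
  cases b
  · simp only [gram, moment_conj, transpose_mul, transpose_transpose]
    calc _ = rot false g * (moment A)ᵀ * ((rot true g)ᵀ * rot true g) * moment A *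
          (rot false g)ᵀ := by simp only [mul_assoc]
      _ = _ := by rw [rot_transpose_mul, mul_one]; simp only [mul_assoc]
  · simp only [gram, moment_conj, transpose_mul, transpose_transpose]
    calc _ = rot true g * moment A * ((rot false g)ᵀ * rot false g) * (moment A)ᵀ *
          (rot true g)ᵀ := by simp only [mul_assoc]
      _ = _ := by rw [rot_transpose_mul, mul_one]; simp only [mul_assoc]

/-- The diagonal of `moment (diagonal d)`. -/
def momentEntries (d : Fin 4 → ℝ) : Fin 3 → ℝ :=
  ![-d 0 - d 1 + d 2 + d 3, -d 0 + d 1 - d 2 + d 3, -d 0 + d 1 + d 2 - d 3]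

theorem moment_diagonal (d : Fin 4 → ℝ) :
    moment (diagonal d) = diagonal (momentEntries d) := by
  ext i j
  simp only [moment_apply, Matrix.trace, Matrix.diag_apply, Matrix.diagonal_mul,
    Matrix.mul_apply (M := isoclinic true i), Fin.sum_univ_four, momentEntries]
  fin_cases i <;> fin_cases j <;> simp [isoclinic] <;> ring

theorem gram_diagonal (b : Bool) (d : Fin 4 → ℝ) :
    gram b (diagonal d) = diagonal fun i => momentEntries d i ^ 2 := by
  cases b <;> simp [gram, moment_diagonal, pow_two]

theorem moment_of_isSymm {A : Matrix (Fin 4) (Fin 4) ℝ} (hA : A.IsSymm) :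
    moment A = !![-A 0 0 - A 1 1 + A 2 2 + A 3 3, 2 * A 0 3 - 2 * A 1 2,
      -2 * A 0 2 - 2 * A 1 3;
    -2 * A 0 3 - 2 * A 1 2, -A 0 0 + A 1 1 - A 2 2 + A 3 3, 2 * A 0 1 - 2 * A 2 3;
    2 * A 0 2 - 2 * A 1 3, -2 * A 0 1 - 2 * A 2 3, -A 0 0 + A 1 1 + A 2 2 - A 3 3] := by
  have h : ∀ i j, A j i = A i j := fun i j => congrFun (congrFun hA i) j
  ext i j
  simp only [moment_apply, Matrix.trace, Matrix.diag_apply,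
    Matrix.mul_apply, Fin.sum_univ_four]
  fin_cases i <;> fin_cases j <;>
   simp [isoclinic, h 0 1, h 0 2, h 0 3, h 1 2, h 1 3, h 2 3] <;> ring

theorem eq_sum_moment {A : Matrix (Fin 4) (Fin 4) ℝ} (hA : A.IsSymm) (h0 : A.trace = 0) :
    A = ∑ r : Fin 3 × Fin 3,
      moment A r.1 r.2 • ((1 / 4 : ℝ) • (isoclinic true r.1 * isoclinic false r.2)) := by
  have h : ∀ i j, A j i = A i j := fun i j => congrFun (congrFun hA i) j
  have h3 : A 3 3 = - A 0 0 - A 1 1 - A 2 2 := by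
    simp only [Matrix.trace, Matrix.diag_apply, Fin.sum_univ_four] at h0
    linarith
  rw [moment_of_isSymm hA, Fintype.sum_prod_type]
  simp only [Fin.sum_univ_three]
  ext i j
  fin_cases i <;> fin_cases j <;>
    simp [isoclinic, h 0 1, h 0 2, h 0 3, h 1 2, h 1 3, h 2 3, h3] <;> ring

/-- The spectral theorem with a diagonalizing matrix of determinant one: an eigenvector matrix of
determinant `-1` is corrected by changing the sign of its first column. -/
theorem exists_SO_diagonal {A : Matrix (Fin 4) (Fin 4) ℝ} (hA : A.IsSymm) :
    ∃ (g : SO 4) (d : Fin 4 → ℝ),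
      A = (g : Matrix (Fin 4) (Fin 4) ℝ) * diagonal d * (g : Matrix (Fin 4) (Fin 4) ℝ)ᵀ := by
  have hH : A.IsHermitian := by
    rw [Matrix.IsHermitian, Matrix.conjTranspose_eq_transpose_of_trivial]; exact hA
  obtain ⟨u, l, huu, hs⟩ : ∃ (u : Matrix (Fin 4) (Fin 4) ℝ) (l : Fin 4 → ℝ),
      u * uᵀ = 1 ∧ A = u * diagonal l * uᵀ := by
    refine ⟨hH.eigenvectorUnitary, hH.eigenvalues, ?_, ?_⟩
    · rw [← Matrix.conjTranspose_eq_transpose_of_trivial]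
      exact Unitary.coe_mul_star_self hH.eigenvectorUnitary
    · have := hH.spectral_theorem
      rw [Unitary.conjStarAlgAut_apply] at this
      rw [← Matrix.conjTranspose_eq_transpose_of_trivial]
      exact this
  have hdet : u.det * u.det = 1 := by
    have := congrArg Matrix.det huu
    rwa [det_mul, det_transpose, det_one] at this
  let e : Fin 4 → ℝ := ![u.det, 1, 1, 1]
  have he : ∀ i, e i * e i = 1 := by
    intro i
    fin_cases i
    · exact hdet
    all_goals exact one_mul 1
  refine ⟨⟨u * diagonal e, ?_⟩, l, ?_⟩
  · rw [Matrix.mem_specialOrthogonalGroup_iff, Matrix.mem_orthogonalGroup_iff]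
    constructor
    · rw [transpose_mul, diagonal_transpose, mul_assoc, ← mul_assoc (diagonal e),
        diagonal_mul_diagonal]
      simp only [he]
      rw [diagonal_one, one_mul, huu]
    · rw [det_mul, det_diagonal, Fin.prod_univ_four]
      simpa [e] using hdet
  · simp only [transpose_mul, diagonal_transpose]
    calc A = u * (diagonal e * diagonal l * diagonal e) * uᵀ := by
          rw [diagonal_mul_diagonal, diagonal_mul_diagonal, hs]
          congr 3
          ext i
          rw [mul_right_comm, he, one_mul]
      _ = _ := by simp only [mul_assoc]

/-! ### Rotations attached to special elements of `SO_4` -/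

/-- A matrix that expresses conjugation in the isoclinic basis is `rot b g`. -/
theorem rot_eq_of_conj (b : Bool) (g : SO 4) (P : Matrix (Fin 3) (Fin 3) ℝ)
    (h : ∀ i, (g : Matrix (Fin 4) (Fin 4) ℝ) * isoclinic b i * (g : Matrix (Fin 4) (Fin 4) ℝ)ᵀ =
      ∑ k, P k i • isoclinic b k) : rot b g = P := by
  ext i j
  rw [rot, h]
  simp only [Finset.mul_sum, Matrix.trace_sum, Matrix.mul_smul,
    Matrix.trace_smul, trace_isoclinic_mul, smul_eq_mul, mul_ite, mul_zero, Finset.sum_ite_eq,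
    Finset.mem_univ, if_true]
  ring

theorem rot_apply (b : Bool) (g : SO 4) (i j : Fin 3) {F : Matrix (Fin 4) (Fin 4) ℝ}
    (hF : (g : Matrix (Fin 4) (Fin 4) ℝ) * isoclinic b j * (g : Matrix (Fin 4) (Fin 4) ℝ)ᵀ = F) :
    rot b g i j = 1 / 2 *
      ![F 0 1 + (bif b then 1 else -1) * F 2 3, F 0 2 - (bif b then 1 else -1) * F 1 3,
        F 0 3 + (bif b then 1 else -1) * F 1 2] i := by
  subst hF
  rw [rot, trace_isoclinic_mul_skew (conj_skew _ _ (isoclinic_transpose b j))]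
  ring

/-- The torus element `(s, t)` rotates the isoclinic triple `b` about its first axis by this angle.
-/
def torusAngle (b : Bool) (s t : ℝ) : ℝ := bif b then s + t else t - s

theorem rot_torus (b : Bool) (s t : ℝ) :
    rot b (torus s t) = !![1, 0, 0;
      0, Real.cos (torusAngle b s t), -Real.sin (torusAngle b s t);
      0, Real.sin (torusAngle b s t), Real.cos (torusAngle b s t)] := by
  have hs := Real.sin_sq_add_cos_sq s
  have ht := Real.sin_sq_add_cos_sq t
  ext i j
  rw [rot_apply b _ i j rfl]
  simp only [torus, torusMatrix, torusAngle]
  cases b <;> fin_cases j <;> simp [isoclinic, Matrix.vecMul_transpose, Real.cos_add,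
      Real.sin_add, Real.cos_sub, Real.sin_sub] <;> fin_cases i <;>
    simp <;> first | ring1 | linear_combination (1 / 2) * hs + (1 / 2) * ht

theorem isoclinic_mem (b : Bool) (i : Fin 3) :
    isoclinic b i ∈ Matrix.specialOrthogonalGroup (Fin 4) ℝ := by
  rw [Matrix.mem_specialOrthogonalGroup_iff, Matrix.mem_orthogonalGroup_iff]
  constructor
  · rw [isoclinic_transpose, mul_neg, isoclinic_mul_self, neg_neg]
  · cases b <;> fin_cases i <;>
      simp [isoclinic, Matrix.det_succ_row_zero, Fin.sum_univ_succ, Fin.succAbove] <;> norm_num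

/-- The isoclinic matrices as elements of `SO_4`: half-turns in one factor `SO_3`, trivial in the
other. -/
def isoclinicSO (b : Bool) (i : Fin 3) : SO 4 := ⟨isoclinic b i, isoclinic_mem b i⟩

theorem isoclinic_commute (b : Bool) (i j : Fin 3) :
    isoclinic b i * isoclinic (!b) j = isoclinic (!b) j * isoclinic b i := by
  cases b <;> fin_cases i <;> fin_cases j <;> simp [isoclinic]

theorem isoclinic_anticommute (b : Bool) {i j : Fin 3} (h : i ≠ j) :
    isoclinic b i * isoclinic b j = -(isoclinic b j * isoclinic b i) := by
  cases b <;> fin_cases i <;> fin_cases j <;> first | exact absurd rfl h | skip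
  all_goals simp [isoclinic]

theorem rot_isoclinic_not (b : Bool) (i : Fin 3) : rot (!b) (isoclinicSO b i) = 1 := by
  apply rot_eq_of_conj
  intro j
  simp only [isoclinicSO, isoclinic_commute, isoclinic_transpose, mul_neg, mul_assoc,
    isoclinic_mul_self]
  simp [Matrix.one_apply]

theorem rot_isoclinic (b : Bool) (i : Fin 3) :
    rot b (isoclinicSO b i) = diagonal fun j => if j = i then 1 else -1 := by
  apply rot_eq_of_conj
  intro j
  have : isoclinic b i * isoclinic b j * (isoclinic b i)ᵀ =
      (if j = i then (1 : ℝ) else -1) • isoclinic b j := by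
    split_ifs with h
    · subst h
      rw [isoclinic_transpose, mul_neg, isoclinic_mul_self]; simp
    · rw [isoclinic_transpose, mul_neg, isoclinic_anticommute b (Ne.symm h), neg_mul, mul_assoc,
        isoclinic_mul_self]; simp
  simp only [isoclinicSO, this, Matrix.diagonal_apply]
  simp

/-- A permutation matrix which acts on both isoclinic triples by the same cyclic permutation. -/
def cycleMatrix : Matrix (Fin 4) (Fin 4) ℝ := !![1, 0, 0, 0; 0, 0, 0, 1; 0, 1, 0, 0; 0, 0, 1, 0]

/-- A signed permutation matrix which acts on both isoclinic triples by the negative of the same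
transposition. -/
def swapMatrix : Matrix (Fin 4) (Fin 4) ℝ := !![-1, 0, 0, 0; 0, 0, 1, 0; 0, 1, 0, 0; 0, 0, 0, 1]

theorem cycleMatrix_mem : cycleMatrix ∈ Matrix.specialOrthogonalGroup (Fin 4) ℝ := by
  rw [Matrix.mem_specialOrthogonalGroup_iff, Matrix.mem_orthogonalGroup_iff]
  constructor
  · ext i j
    fin_cases i <;> fin_cases j <;>
      simp [cycleMatrix, Matrix.mul_apply, Fin.sum_univ_four]
  · simp [cycleMatrix, Matrix.det_succ_row_zero, Fin.sum_univ_succ, Fin.succAbove]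

theorem swapMatrix_mem : swapMatrix ∈ Matrix.specialOrthogonalGroup (Fin 4) ℝ := by
  rw [Matrix.mem_specialOrthogonalGroup_iff, Matrix.mem_orthogonalGroup_iff]
  constructor
  · ext i j
    fin_cases i <;> fin_cases j <;>
      simp [swapMatrix, Matrix.mul_apply, Fin.sum_univ_four]
  · simp [swapMatrix, Matrix.det_succ_row_zero, Fin.sum_univ_succ, Fin.succAbove]

/-- `cycleMatrix` as an element of `SO_4`. -/
def cycleSO : SO 4 := ⟨cycleMatrix, cycleMatrix_mem⟩

/-- `swapMatrix` as an element of `SO_4`. -/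
def swapSO : SO 4 := ⟨swapMatrix, swapMatrix_mem⟩

theorem rot_cycle (b : Bool) : rot b cycleSO = !![0, 0, 1; 1, 0, 0; 0, 1, 0] := by
  ext i j
  rw [rot_apply b _ i j rfl]
  simp only [cycleSO, cycleMatrix]
  cases b <;> fin_cases j <;> simp [isoclinic, Matrix.vecMul_transpose] <;> fin_cases i <;>
    simp <;> norm_num

theorem rot_swap (b : Bool) : rot b swapSO = !![0, -1, 0; -1, 0, 0; 0, 0, -1] := by
  ext i j
  rw [rot_apply b _ i j rfl]
  simp only [swapSO, swapMatrix]
  cases b <;> fin_cases j <;> simp [isoclinic, Matrix.vecMul_transpose] <;> fin_cases i <;>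
    simp <;> norm_num

/-! ### Weights -/

section Weights

variable {V : Type*} [AddCommGroup V] [Module ℝ V]

/-- The character of the maximal torus with weight `m`. -/
def torusCharacter (m : ℤ × ℤ) (s t : ℝ) : ℂ :=
  Complex.exp (Complex.I * ((m.1 : ℂ) * (s : ℂ) + (m.2 : ℂ) * (t : ℂ)))

theorem int_eq_zero_of_sqrt_combination {p q k : ℤ} (h : (p : ℝ) * √2 + q * √3 = k) :
    p = 0 ∧ q = 0 := by
  have h2 : √2 ^ 2 = (2 : ℝ) := Real.sq_sqrt (by norm_num)
  have h3 : √3 ^ 2 = (3 : ℝ) := Real.sq_sqrt (by norm_num)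
  have i2 : Irrational √(2 : ℝ) := by
    simpa using Nat.Prime.irrational_sqrt Nat.prime_two
  have i3 : Irrational √(3 : ℝ) := by
    simpa using Nat.Prime.irrational_sqrt Nat.prime_three
  have h0 : p = 0 ∨ k = 0 := by
    by_contra hne
    rw [not_or] at hne
    -- solving `(k - p √2) ^ 2 = 3 q ^ 2` for `√2` would make it rational
    apply i2
    refine ⟨((k : ℚ) ^ 2 + 2 * p ^ 2 - 3 * q ^ 2) / (2 * p * k), ?_⟩
    have hp : (p : ℝ) ≠ 0 := by exact_mod_cast hne.1
    have hk : (k : ℝ) ≠ 0 := by exact_mod_cast hne.2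
    push_cast
    rw [div_eq_iff (by positivity)]
    have e : ((k : ℝ) - p * √2) ^ 2 = (q * √3) ^ 2 := by rw [← h]; ring
    linear_combination e - (p : ℝ) ^ 2 * h2 + (q : ℝ) ^ 2 * h3
  rcases h0 with rfl | rfl
  · refine ⟨rfl, ?_⟩
    by_contra hq
    apply i3
    refine ⟨(k : ℚ) / q, ?_⟩
    have hq : (q : ℝ) ≠ 0 := by exact_mod_cast hq
    push_cast
    rw [div_eq_iff hq, ← h]
    push_cast
    ring
  · have e : 2 * p ^ 2 = 3 * q ^ 2 := by
      have : (p * √2) ^ 2 = (q * √3) ^ 2 := by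
        have h' : (p : ℝ) * √2 = -(q * √3) := by
          push_cast at h; linarith
        rw [h']; ring
      rw [mul_pow, mul_pow, h2, h3] at this
      have : ((2 * p ^ 2 : ℤ) : ℝ) = ((3 * q ^ 2 : ℤ) : ℝ) := by push_cast; linarith
      exact_mod_cast this
    have i6 : Irrational √((6 : ℕ) : ℝ) := irrational_sqrt_natCast_iff.2 (by
      rintro ⟨r, hr⟩
      have : r < 3 := by nlinarith
      interval_cases r <;> omega)
    have hq : q = 0 := by
      by_contra hq
      apply i6
      have hq' : (q : ℝ) ≠ 0 := by exact_mod_cast hq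
      refine ⟨|2 * p / q|, ?_⟩
      have : ((6 : ℕ) : ℝ) = (2 * p / q) ^ 2 := by
        have e' : 2 * (p : ℝ) ^ 2 = 3 * (q : ℝ) ^ 2 := by exact_mod_cast e
        rw [div_pow, eq_div_iff (by positivity)]
        push_cast
        linear_combination -2 * e'
      rw [this, Real.sqrt_sq_eq_abs]
      push_cast
      rfl
    subst hq
    refine ⟨?_, rfl⟩
    have : p ^ 2 = 0 := by linarith
    exact pow_eq_zero_iff (two_ne_zero) |>.1 this

/-- The torus element with angles `2π√2` and `2π√3` separates all weights, since `1, √2, √3` are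
linearly independent over `ℚ`. A weight space is thus an eigenspace of one operator. -/
theorem torusCharacter_injective :
    Function.Injective fun m : ℤ × ℤ =>
      torusCharacter m (2 * Real.pi * √2) (2 * Real.pi * √3) := by
  intro m m' h
  simp only [torusCharacter] at h
  rw [Complex.exp_eq_exp_iff_exists_int] at h
  obtain ⟨k, hk⟩ := h
  have hpi : (2 * (Real.pi : ℂ) * Complex.I) ≠ 0 := by
    simp [Real.pi_ne_zero]
  have e : ((m.1 - m'.1 : ℤ) : ℝ) * √2 + ((m.2 - m'.2 : ℤ) : ℝ) * √3 = (k : ℤ) := by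
    have : (2 * (Real.pi : ℂ) * Complex.I) * (((((m.1 - m'.1 : ℤ) : ℝ) * √2 +
        ((m.2 - m'.2 : ℤ) : ℝ) * √3 : ℝ)) : ℂ) = (2 * (Real.pi : ℂ) * Complex.I) * (k : ℂ) := by
      push_cast at hk ⊢
      linear_combination hk
    exact_mod_cast mul_left_cancel₀ hpi this
  obtain ⟨h1, h2⟩ := int_eq_zero_of_sqrt_combination e
  exact Prod.ext (by omega) (by omega)

/-- The torus acts on `v` through the character of weight `m`; unlike in the definition of a weight,
`v` may be zero. -/
def IsWeightVector (ρ : Representation ℝ (SO 4) V) (m : ℤ × ℤ) (v : ℂ ⊗[ℝ] V) : Prop :=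
  ∀ s t : ℝ, (ρ (torus s t)).baseChange ℂ v = torusCharacter m s t • v

variable {ρ : Representation ℝ (SO 4) V} {κ : Type*} {v : κ → ℂ ⊗[ℝ] V} {m : κ → ℤ × ℤ}

/-- The weights of a spanning family of weight vectors exhaust the weights of the representation. -/
theorem exists_eq_of_isWeight (hv : ∀ k, IsWeightVector ρ (m k) (v k))
    (hspan : ⊤ ≤ Submodule.span ℂ (Set.range v)) {l : ℤ × ℤ} (hl : IsWeight ρ l) :
    ∃ k, m k = l := by
  by_contra hne
  push Not at hne
  obtain ⟨w, hw0, hw⟩ := hl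
  set T : Module.End ℂ (ℂ ⊗[ℝ] V) :=
    (ρ (torus (2 * Real.pi * √2) (2 * Real.pi * √3))).baseChange ℂ with hT
  set χ := fun m : ℤ × ℤ => torusCharacter m (2 * Real.pi * √2) (2 * Real.pi * √3) with hχ
  have hd := T.eigenspaces_iSupIndep (χ l)
  have htop : (⨆ (j : ℂ) (_ : j ≠ χ l), T.eigenspace j) = ⊤ := by
    rw [eq_top_iff]
    refine hspan.trans (Submodule.span_le.2 ?_)
    rintro _ ⟨k, rfl⟩
    have hk : v k ∈ T.eigenspace (χ (m k)) := Module.End.mem_eigenspace_iff.2 (hv k _ _)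
    exact Submodule.mem_iSup_of_mem (χ (m k)) (Submodule.mem_iSup_of_mem
      (fun h => hne k (torusCharacter_injective h)) hk)
  rw [htop, disjoint_top] at hd
  have hwm : w ∈ T.eigenspace (χ l) := Module.End.mem_eigenspace_iff.2 (hw _ _)
  rw [hd] at hwm
  exact hw0 hwm

/-- Nonzero weight vectors of distinct weights are linearly independent, so they bound the dimension
from below. -/
theorem card_le_finrank_of_isWeightVector [Fintype κ] [Module.Finite ℝ V]
    (hv : ∀ k, IsWeightVector ρ (m k) (v k))
    (h0 : ∀ k, v k ≠ 0) (hm : Function.Injective m) : Fintype.card κ ≤ Module.finrank ℝ V := by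
  have hli : LinearIndependent ℂ v := Module.End.eigenvectors_linearIndependent'
    ((ρ (torus (2 * Real.pi * √2) (2 * Real.pi * √3))).baseChange ℂ) _
    (torusCharacter_injective.comp hm) v
    fun k => ⟨Module.End.mem_eigenspace_iff.2 (hv k _ _), h0 k⟩
  have := hli.fintype_card_le_finrank
  rwa [Module.finrank_baseChange] at this

end Weights

/-! ### Modules of coefficient functions of covariant maps -/

section Covariants

variable {ι : Type*} [Fintype ι]

/-- The coefficient functions `A ↦ e ⬝ᵥ F A` of a vector-valued function `F`. -/
def pairing (F : tracelessSymMat 4 → ι → ℝ) : (ι → ℝ) →ₗ[ℝ] (tracelessSymMat 4 → ℝ) where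
  toFun e := fun A => e ⬝ᵥ F A
  map_add' e e' := by ext A; simp [add_dotProduct]
  map_smul' c e := by ext A; simp

/-- `F` intertwines the conjugation action with the continuous orthogonal matrix representation `R`.
Orthogonality is recorded as `R g⁻¹ = (R g)ᵀ`, and multiplicativity of `R` is not needed. -/
structure IsCovariant (F : tracelessSymMat 4 → ι → ℝ) (R : SO 4 → Matrix ι ι ℝ) : Prop where
  map_conj : ∀ g A, F (conjAction 4 g A) = R g *ᵥ F A
  map_inv : ∀ g, R g⁻¹ = (R g)ᵀ
  continuous : Continuous R

variable {F : tracelessSymMat 4 → ι → ℝ} {R : SO 4 → Matrix ι ι ℝ}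

theorem pairing_apply (e : ι → ℝ) (A : tracelessSymMat 4) : pairing F e A = e ⬝ᵥ F A := rfl

theorem IsCovariant.dotProduct_mulVec (h : IsCovariant F R) (g : SO 4) (x y : ι → ℝ) :
    x ⬝ᵥ (R g⁻¹ *ᵥ y) = (R g *ᵥ x) ⬝ᵥ y := by
  rw [h.map_inv, Matrix.dotProduct_mulVec, Matrix.vecMul_transpose]

theorem IsCovariant.funAction_pairing (h : IsCovariant F R) (g : SO 4) (e : ι → ℝ) :
    funAction 4 g (pairing F e) = pairing F (R g *ᵥ e) := by
  ext A
  change e ⬝ᵥ F (conjAction 4 g⁻¹ A) = (R g *ᵥ e) ⬝ᵥ F A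
  rw [h.map_conj, h.dotProduct_mulVec]

/-- The representation on the space of coefficient functions of a covariant map. -/
def IsCovariant.subrep (h : IsCovariant F R) : Subrepresentation (funAction 4) where
  toSubmodule := LinearMap.range (pairing F)
  apply_mem_toSubmodule := by
    rintro g _ ⟨e, rfl⟩
    exact ⟨R g *ᵥ e, (h.funAction_pairing g e).symm⟩

/-- Every coefficient function has a coefficient vector in the span of the values of `F`, its
orthogonal projection to that span. -/
theorem exists_mem_span_pairing_eq (F : tracelessSymMat 4 → ι → ℝ) (e : ι → ℝ) :
    ∃ e' ∈ Submodule.span ℝ (Set.range F), pairing F e' = pairing F e := by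
  let K : Submodule ℝ (EuclideanSpace ℝ ι) :=
    (Submodule.span ℝ (Set.range F)).comap (WithLp.linearEquiv 2 ℝ (ι → ℝ)).toLinearMap
  obtain ⟨y, hy, z, hz, hyz⟩ := K.exists_add_mem_mem_orthogonal (WithLp.toLp 2 e)
  refine ⟨WithLp.ofLp y, hy, ?_⟩
  ext A
  have hA : WithLp.toLp 2 (F A) ∈ K := Submodule.subset_span ⟨A, rfl⟩
  have h0 : WithLp.ofLp z ⬝ᵥ F A = 0 := by
    have := hz _ hA
    rw [EuclideanSpace.inner_eq_star_dotProduct] at this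
    simpa using this
  have he : e = WithLp.ofLp y + WithLp.ofLp z := congrArg WithLp.ofLp hyz
  rw [pairing_apply, pairing_apply, he, add_dotProduct, h0, add_zero]

variable [DecidableEq ι] in
/-- An invariant subspace of coefficient functions is stable under the algebra generated by the
matrices `R g`. -/
theorem mulVec_mem_of_mem_adjoin (h : IsCovariant F R)
    {U : Submodule ℝ (tracelessSymMat 4 → ℝ)} (hU : ∀ g, ∀ v ∈ U, funAction 4 g v ∈ U)
    {Q : Matrix ι ι ℝ} (hQ : Q ∈ Algebra.adjoin ℝ (Set.range R)) :
    ∀ e, pairing F e ∈ U → pairing F (Q *ᵥ e) ∈ U := by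
  induction hQ using Algebra.adjoin_induction with
  | mem x hx =>
    obtain ⟨g, rfl⟩ := hx
    intro e he
    rw [← h.funAction_pairing]
    exact hU g _ he
  | algebraMap r =>
    intro e he
    rw [Algebra.algebraMap_eq_smul_one, smul_mulVec, one_mulVec, map_smul]
    exact U.smul_mem _ he
  | add x y _ _ hx hy =>
    intro e he
    rw [add_mulVec, map_add]
    exact U.add_mem (hx e he) (hy e he)
  | mul x y _ _ hx hy =>
    intro e he
    rw [← mulVec_mulVec]
    exact hx _ (hy e he)

variable [DecidableEq ι] in
/-- Irreducibility criterion. Suppose all values of `F` lie in the scaled orbit of `e₀`, and some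
`Q` in the algebra generated by the `R g` maps them into the line of `e₀`, with `Qᵀ e₀ = e₀`. A
nonzero coefficient function in `U` can be moved by the group so that it does not vanish at `e₀`;
applying `Q` then produces a nonzero multiple of the function with coefficient vector `e₀`, and its
translates span all coefficient functions. -/
theorem IsCovariant.eq_range_of_invariant (h : IsCovariant F R) (e₀ : ι → ℝ)
    (hF : ∀ A, ∃ (g : SO 4) (c : ℝ), F A = c • (R g *ᵥ e₀))
    {Q : Matrix ι ι ℝ} (hQ : Q ∈ Algebra.adjoin ℝ (Set.range R))
    (hQF : ∀ A, ∃ c : ℝ, Q *ᵥ F A = c • e₀) (hQe : Qᵀ *ᵥ e₀ = e₀)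
    {U : Submodule ℝ (tracelessSymMat 4 → ℝ)} (hU : ∀ g, ∀ v ∈ U, funAction 4 g v ∈ U)
    (hle : U ≤ LinearMap.range (pairing F)) (hne : U ≠ ⊥) : U = LinearMap.range (pairing F) := by
  obtain ⟨v, hvU, hv0⟩ := U.ne_bot_iff.1 hne
  obtain ⟨e', rfl⟩ := hle hvU
  obtain ⟨e, he, hee⟩ := exists_mem_span_pairing_eq F e'
  rw [← hee] at hvU hv0
  obtain ⟨A, hA⟩ := Function.ne_iff.1 hv0
  obtain ⟨g, c, hgc⟩ := hF A
  have hspanF : ∀ x ∈ Submodule.span ℝ (Set.range F), R g⁻¹ *ᵥ x ∈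
      Submodule.span ℝ (Set.range F) := by
    intro x hx
    induction hx using Submodule.span_induction with
    | mem x hx =>
      obtain ⟨B, rfl⟩ := hx
      rw [← h.map_conj]
      exact Submodule.subset_span ⟨_, rfl⟩
    | zero => rw [mulVec_zero]; exact Submodule.zero_mem _
    | add x y _ _ hx hy => rw [mulVec_add]; exact Submodule.add_mem _ hx hy
    | smul a x _ hx => rw [mulVec_smul]; exact Submodule.smul_mem _ _ hx
  have hQspan : ∀ x ∈ Submodule.span ℝ (Set.range F), ∃ c : ℝ, Q *ᵥ x = c • e₀ := by
    intro x hx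
    induction hx using Submodule.span_induction with
    | mem x hx => obtain ⟨B, rfl⟩ := hx; exact hQF B
    | zero => exact ⟨0, by simp⟩
    | add x y _ _ hx hy =>
      obtain ⟨a, ha⟩ := hx
      obtain ⟨b, hb⟩ := hy
      exact ⟨a + b, by rw [mulVec_add, ha, hb, add_smul]⟩
    | smul a x _ hx =>
      obtain ⟨b, hb⟩ := hx
      exact ⟨a * b, by rw [mulVec_smul, hb, mul_smul]⟩
  have h1 : (R g⁻¹ *ᵥ e) ⬝ᵥ e₀ ≠ 0 := by
    intro h0
    apply hA
    have := h.dotProduct_mulVec g⁻¹ e e₀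
    rw [inv_inv] at this
    rw [pairing_apply, hgc, dotProduct_smul, this, h0]
    simp
  obtain ⟨b, hb⟩ := hQspan _ (hspanF e he)
  have hb0 : b ≠ 0 := by
    rintro rfl
    apply h1
    rw [← hQe, Matrix.dotProduct_mulVec, Matrix.vecMul_transpose, hb]
    simp
  have h2 : pairing F e₀ ∈ U := by
    have := mulVec_mem_of_mem_adjoin h hU hQ (R g⁻¹ *ᵥ e)
      (by rw [← h.funAction_pairing]; exact hU _ _ hvU)
    rw [hb, map_smul] at this
    exact (U.smul_mem_iff hb0).1 this
  have h3 : ∀ x ∈ Submodule.span ℝ (Set.range F), pairing F x ∈ U := by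
    intro x hx
    have : Submodule.span ℝ (Set.range F) ≤ U.comap (pairing F) := by
      rw [Submodule.span_le]
      rintro _ ⟨B, rfl⟩
      obtain ⟨g', c', hB⟩ := hF B
      change pairing F (F B) ∈ U
      rw [hB, map_smul, ← h.funAction_pairing]
      exact U.smul_mem _ (hU _ _ h2)
    exact this hx
  refine le_antisymm hle ?_
  rintro _ ⟨x, rfl⟩
  obtain ⟨y, hy, hxy⟩ := exists_mem_span_pairing_eq F x
  rw [← hxy]
  exact h3 y hy

/-- If every nonzero invariant subspace of the range of `pairing F` is everything, the
subrepresentation is irreducible in the sense of its lattice of subrepresentations. -/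
theorem IsCovariant.isIrreducible (h : IsCovariant F R) (hne : LinearMap.range (pairing F) ≠ ⊥)
    (hirr : ∀ U : Submodule ℝ (tracelessSymMat 4 → ℝ), (∀ g, ∀ v ∈ U, funAction 4 g v ∈ U) →
      U ≤ LinearMap.range (pairing F) → U ≠ ⊥ → U = LinearMap.range (pairing F)) :
    h.subrep.toRepresentation.IsIrreducible := by
  have hsub : h.subrep.toSubmodule = LinearMap.range (pairing F) := rfl
  have hnt : Nontrivial (Subrepresentation h.subrep.toRepresentation) := by
    refine ⟨⟨⊥, ⊤, fun hbt => hne ?_⟩⟩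
    have hbt' : (⊥ : Submodule ℝ h.subrep.toSubmodule) = ⊤ :=
      congrArg Subrepresentation.toSubmodule hbt
    rw [← hsub, Submodule.eq_bot_iff]
    intro x hx
    have : (⟨x, hx⟩ : h.subrep.toSubmodule) ∈ (⊥ : Submodule ℝ h.subrep.toSubmodule) := by
      rw [hbt']; trivial
    exact congrArg Subtype.val ((Submodule.mem_bot ℝ).1 this)
  refine ⟨fun X => ?_⟩
  by_cases hX : X.toSubmodule = ⊥
  · exact Or.inl (Subrepresentation.toSubmodule_injective hX)
  · right
    have hm := hirr (X.toSubmodule.map h.subrep.toSubmodule.subtype) ?_ ?_ ?_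
    · apply Subrepresentation.toSubmodule_injective
      refine (eq_top_iff (α := Submodule ℝ h.subrep.toSubmodule)).2 ?_
      rintro ⟨x, hx⟩ -
      have hx' := hx
      rw [hsub, ← hm] at hx'
      obtain ⟨y, hy, hyx⟩ := hx'
      have : y = ⟨x, hx⟩ := Subtype.ext hyx
      exact this ▸ hy
    · rintro g _ ⟨y, hy, rfl⟩
      exact ⟨h.subrep.toRepresentation g y, X.apply_mem_toSubmodule g hy, rfl⟩
    · rintro _ ⟨y, _, rfl⟩
      exact y.2
    · intro h0
      exact hX (Submodule.map_injective_of_injective (Submodule.injective_subtype _)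
        (h0.trans (Submodule.map_bot _).symm))

/-- The map `pairing F` onto its range. -/
def IsCovariant.vector (h : IsCovariant F R) : (ι → ℝ) →ₗ[ℝ] h.subrep.toSubmodule :=
  (pairing F).codRestrict _ fun e => ⟨e, rfl⟩

theorem IsCovariant.coe_vector (h : IsCovariant F R) (e : ι → ℝ) :
    (h.vector e : tracelessSymMat 4 → ℝ) = pairing F e := rfl

theorem IsCovariant.vector_surjective (h : IsCovariant F R) : Function.Surjective h.vector := by
  rintro ⟨_, e, rfl⟩
  exact ⟨e, rfl⟩

theorem IsCovariant.toRepresentation_vector (h : IsCovariant F R) (g : SO 4) (e : ι → ℝ) :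
    h.subrep.toRepresentation g (h.vector e) = h.vector (R g *ᵥ e) :=
  Subtype.ext (h.funAction_pairing g e)

variable [DecidableEq ι]

theorem IsCovariant.vector_eq_sum (h : IsCovariant F R) (e : ι → ℝ) :
    h.vector e = ∑ i, e i • h.vector (Pi.single i 1) := by
  conv_lhs => rw [pi_eq_sum_univ' e]
  simp only [map_sum, map_smul]

theorem IsCovariant.continuous_matrixCoeff (h : IsCovariant F R) (v : h.subrep.toSubmodule)
    (f : Module.Dual ℝ h.subrep.toSubmodule) :
    Continuous fun g : SO 4 => f (h.subrep.toRepresentation g v) := by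
  obtain ⟨e, rfl⟩ := h.vector_surjective v
  have key : (fun g : SO 4 => f (h.subrep.toRepresentation g (h.vector e))) =
      fun g => ∑ i, (R g *ᵥ e) i * f (h.vector (Pi.single i 1)) := by
    ext g
    rw [h.toRepresentation_vector, h.vector_eq_sum]
    simp only [map_sum, map_smul, smul_eq_mul]
  rw [key]
  have hc : Continuous fun g => R g *ᵥ e := h.continuous.matrix_mulVec continuous_const
  refine continuous_finsetSum _ fun i _ => Continuous.mul ?_ continuous_const
  exact (_root_.continuous_apply i).comp hc

/-- The complexification of `IsCovariant.vector`. -/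
def IsCovariant.vectorC (h : IsCovariant F R) :
    (ι → ℂ) →ₗ[ℂ] ℂ ⊗[ℝ] h.subrep.toSubmodule where
  toFun e := ∑ i, e i ⊗ₜ[ℝ] h.vector (Pi.single i 1)
  map_add' e e' := by simp [TensorProduct.add_tmul, Finset.sum_add_distrib]
  map_smul' c e := by simp [Finset.smul_sum, TensorProduct.smul_tmul']

theorem IsCovariant.vectorC_apply (h : IsCovariant F R) (e : ι → ℂ) :
    h.vectorC e = ∑ i, e i ⊗ₜ[ℝ] h.vector (Pi.single i 1) := rfl

theorem IsCovariant.tmul_vector (h : IsCovariant F R) (z : ℂ) (x : ι → ℝ) :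
    z ⊗ₜ[ℝ] h.vector x = h.vectorC fun i => z * x i := by
  rw [h.vector_eq_sum, h.vectorC_apply, TensorProduct.tmul_sum]
  refine Finset.sum_congr rfl fun i _ => ?_
  rw [TensorProduct.tmul_smul, TensorProduct.smul_tmul', Complex.real_smul, mul_comm]

theorem IsCovariant.vectorC_surjective (h : IsCovariant F R) :
    Function.Surjective h.vectorC := by
  rw [← LinearMap.range_eq_top, eq_top_iff]
  rintro x -
  induction x with
  | zero => exact Submodule.zero_mem _
  | tmul z y =>
    obtain ⟨x, rfl⟩ := h.vector_surjective y
    exact ⟨_, (h.tmul_vector z x).symm⟩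
  | add x y hx hy => exact Submodule.add_mem _ hx hy

theorem IsCovariant.baseChange_vectorC (h : IsCovariant F R) (g : SO 4) (e : ι → ℂ) :
    (h.subrep.toRepresentation g).baseChange ℂ (h.vectorC e) =
      h.vectorC ((R g).map Complex.ofReal *ᵥ e) := by
  rw [h.vectorC_apply, map_sum]
  have : ∀ i, (h.subrep.toRepresentation g).baseChange ℂ
      (e i ⊗ₜ[ℝ] h.vector (Pi.single i 1)) = h.vectorC fun j => e i * R g j i := by
    intro i
    rw [LinearMap.baseChange_tmul, h.toRepresentation_vector, Matrix.mulVec_single_one,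
      h.tmul_vector]
    rfl
  rw [Finset.sum_congr rfl fun i _ => this i, ← map_sum]
  congr 1
  ext j
  simp [Matrix.mulVec, dotProduct, mul_comm]

/-- Evaluation at `A`, extended to complexified coefficient functions. -/
def IsCovariant.evalC (h : IsCovariant F R) (A : tracelessSymMat 4) :
    ℂ ⊗[ℝ] h.subrep.toSubmodule →ₗ[ℝ] ℂ :=
  TensorProduct.lift ((LinearMap.mul ℝ ℂ).compl₂
    (Algebra.linearMap ℝ ℂ ∘ₗ LinearMap.proj A ∘ₗ h.subrep.toSubmodule.subtype))

theorem IsCovariant.evalC_vectorC (h : IsCovariant F R) (A : tracelessSymMat 4) (e : ι → ℂ) :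
    h.evalC A (h.vectorC e) = ∑ i, e i * F A i := by
  rw [h.vectorC_apply, map_sum]
  refine Finset.sum_congr rfl fun i _ => ?_
  simp [evalC, h.coe_vector, pairing_apply]

theorem IsCovariant.vectorC_ne_zero (h : IsCovariant F R) (A : tracelessSymMat 4) {e : ι → ℂ}
    (hA : ∑ i, e i * F A i ≠ 0) : h.vectorC e ≠ 0 :=
  fun h0 => hA (by rw [← h.evalC_vectorC, h0, map_zero])

theorem IsCovariant.isWeightVector_vectorC (h : IsCovariant F R) {m : ℤ × ℤ} {e : ι → ℂ}
    (he : ∀ s t, (R (torus s t)).map Complex.ofReal *ᵥ e = torusCharacter m s t • e) :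
    IsWeightVector h.subrep.toRepresentation m (h.vectorC e) := by
  intro s t
  rw [h.baseChange_vectorC, he, map_smul]

end Covariants

/-! ### Kronecker products -/

section Kronecker

/-- The tensor product of two vectors, indexed by pairs. -/
def outer {𝕜 m p : Type*} [Mul 𝕜] (x : m → 𝕜) (y : p → 𝕜) (r : m × p) : 𝕜 := x r.1 * y r.2

theorem kronecker_mulVec_outer {𝕜 l m n p : Type*} [CommSemiring 𝕜] [Fintype m] [Fintype p]
    (A : Matrix l m 𝕜) (B : Matrix n p 𝕜) (x : m → 𝕜) (y : p → 𝕜) :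
    (A ⊗ₖ B) *ᵥ outer x y = outer (A *ᵥ x) (B *ᵥ y) := by
  ext r
  simp only [outer, Matrix.mulVec, dotProduct, Matrix.kroneckerMap_apply, Fintype.sum_prod_type,
    Finset.sum_mul_sum]
  refine Finset.sum_congr rfl fun i _ => Finset.sum_congr rfl fun j _ => ?_
  ring

theorem kronecker_mulVec_uncurry {𝕜 l m n p : Type*} [CommSemiring 𝕜] [Fintype m] [Fintype p]
    (A : Matrix l m 𝕜) (B : Matrix n p 𝕜) (X : Matrix m p 𝕜) :
    (A ⊗ₖ B) *ᵥ Function.uncurry X = Function.uncurry (A * X * Bᵀ) := by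
  ext r
  simp only [Function.uncurry, Matrix.mulVec, dotProduct, Matrix.kroneckerMap_apply,
    Fintype.sum_prod_type, Matrix.mul_apply, Matrix.transpose_apply, Finset.sum_mul]
  rw [Finset.sum_comm]
  refine Finset.sum_congr rfl fun i _ => Finset.sum_congr rfl fun j _ => ?_
  ring

theorem span_outer_eq_top {κ κ' ι ι' : Type*} [Fintype ι] [Fintype ι'] [DecidableEq ι]
    [DecidableEq ι'] {x : κ → ι → ℂ} {y : κ' → ι' → ℂ}
    (hx : Submodule.span ℂ (Set.range x) = ⊤) (hy : Submodule.span ℂ (Set.range y) = ⊤) :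
    Submodule.span ℂ (Set.range fun k : κ × κ' => outer (x k.1) (y k.2)) = ⊤ := by
  set T := Submodule.span ℂ (Set.range fun k : κ × κ' => outer (x k.1) (y k.2))
  have h : ∀ (a : ι → ℂ) (b : ι' → ℂ), outer a b ∈ T := by
    intro a b
    have ha : a ∈ Submodule.span ℂ (Set.range x) := hx ▸ Submodule.mem_top
    induction ha using Submodule.span_induction with
    | mem a ha =>
      obtain ⟨k, rfl⟩ := ha
      have hb : b ∈ Submodule.span ℂ (Set.range y) := hy ▸ Submodule.mem_top
      induction hb using Submodule.span_induction with
      | mem b hb =>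
        obtain ⟨k', rfl⟩ := hb
        exact Submodule.subset_span ⟨(k, k'), rfl⟩
      | zero => convert T.zero_mem using 1; ext; simp [outer]
      | add b b' _ _ h h' => convert T.add_mem h h' using 1; ext; simp [outer, mul_add]
      | smul c b _ h => convert T.smul_mem c h using 1; ext; simp [outer, mul_left_comm]
    | zero => convert T.zero_mem using 1; ext; simp [outer]
    | add a a' _ _ h h' => convert T.add_mem h h' using 1; ext; simp [outer, add_mul]
    | smul c a _ h => convert T.smul_mem c h using 1; ext; simp [outer, mul_assoc]
  rw [eq_top_iff]
  rintro f -
  rw [pi_eq_sum_univ' f]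
  refine Submodule.sum_mem _ fun r _ => T.smul_mem _ ?_
  have := h (Pi.single r.1 1) (Pi.single r.2 1)
  convert this using 1
  ext r'
  by_cases h1 : r'.1 = r.1 <;> by_cases h2 : r'.2 = r.2 <;>
    simp [outer, Pi.single_apply, h1, h2, Prod.ext_iff]

end Kronecker

/-! ### The cubic tensor of a symmetric matrix -/

section Cubic

/-- The determinant of the matrix with rows `u`, `v`, `w`. -/
def tripleProduct (u v w : Fin 3 → ℝ) : ℝ := (Matrix.of ![u, v, w]).det

theorem tripleProduct_eq (u v w : Fin 3 → ℝ) :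
    tripleProduct u v w = u 0 * v 1 * w 2 - u 0 * v 2 * w 1 - u 1 * v 0 * w 2 + u 1 * v 2 * w 0 +
      u 2 * v 0 * w 1 - u 2 * v 1 * w 0 := by
  simp [tripleProduct, det_fin_three]

theorem tripleProduct_mulVec (P : Matrix (Fin 3) (Fin 3) ℝ) (u v w : Fin 3 → ℝ) :
    tripleProduct (P *ᵥ u) (P *ᵥ v) (P *ᵥ w) = P.det * tripleProduct u v w := by
  simp only [tripleProduct_eq, det_fin_three, Matrix.mulVec, dotProduct, Fin.sum_univ_three]
  ring

/-- The symmetrization over `u, v, w` of `det (u, S v, S² w)`, a harmonic cubic form covariant under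
rotations of `S`. -/
def cubicForm (S : Matrix (Fin 3) (Fin 3) ℝ) (u v w : Fin 3 → ℝ) : ℝ :=
  tripleProduct u (S *ᵥ v) ((S * S) *ᵥ w) + tripleProduct u (S *ᵥ w) ((S * S) *ᵥ v) +
  tripleProduct v (S *ᵥ u) ((S * S) *ᵥ w) + tripleProduct v (S *ᵥ w) ((S * S) *ᵥ u) +
  tripleProduct w (S *ᵥ u) ((S * S) *ᵥ v) + tripleProduct w (S *ᵥ v) ((S * S) *ᵥ u)

/-- The coefficients of the trilinear form `cubicForm S`. -/
def cubicTensor (S : Matrix (Fin 3) (Fin 3) ℝ) (r : Fin 3 × Fin 3 × Fin 3) : ℝ :=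
  cubicForm S (Pi.single r.1 1) (Pi.single r.2.1 1) (Pi.single r.2.2 1)

theorem cubicForm_swap (S : Matrix (Fin 3) (Fin 3) ℝ) (u v w : Fin 3 → ℝ) :
    cubicForm S u v w = cubicForm S v u w := by
  simp only [cubicForm]; ring

theorem cubicForm_rotate (S : Matrix (Fin 3) (Fin 3) ℝ) (u v w : Fin 3 → ℝ) :
    cubicForm S u v w = cubicForm S v w u := by
  simp only [cubicForm]; ring

theorem cubicForm_add (S : Matrix (Fin 3) (Fin 3) ℝ) (u u' v w : Fin 3 → ℝ) :
    cubicForm S (u + u') v w = cubicForm S u v w + cubicForm S u' v w := by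
  simp only [cubicForm, mulVec_add, tripleProduct_eq, Pi.add_apply]
  ring

theorem cubicForm_smul (S : Matrix (Fin 3) (Fin 3) ℝ) (c : ℝ) (u v w : Fin 3 → ℝ) :
    cubicForm S (c • u) v w = c * cubicForm S u v w := by
  simp only [cubicForm, mulVec_smul, tripleProduct_eq, Pi.smul_apply, smul_eq_mul]
  ring

theorem cubicForm_eq_sum_left (S : Matrix (Fin 3) (Fin 3) ℝ) (u v w : Fin 3 → ℝ) :
    cubicForm S u v w = ∑ i, u i * cubicForm S (Pi.single i 1) v w := by
  conv_lhs => rw [pi_eq_sum_univ' u]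
  simp only [Fin.sum_univ_three, cubicForm_add, cubicForm_smul]

theorem cubicForm_eq_sum (S : Matrix (Fin 3) (Fin 3) ℝ) (u v w : Fin 3 → ℝ) :
    cubicForm S u v w = ∑ r : Fin 3 × Fin 3 × Fin 3, u r.1 * (v r.2.1 * w r.2.2) *
      cubicTensor S r := by
  simp only [Fintype.sum_prod_type, cubicTensor]
  rw [cubicForm_eq_sum_left]
  refine Finset.sum_congr rfl fun i _ => ?_
  rw [cubicForm_rotate, cubicForm_eq_sum_left, Finset.mul_sum]
  refine Finset.sum_congr rfl fun j _ => ?_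
  rw [cubicForm_rotate, cubicForm_eq_sum_left, Finset.mul_sum, Finset.mul_sum]
  refine Finset.sum_congr rfl fun k _ => ?_
  rw [cubicForm_rotate]
  ring

theorem cubicForm_conj {P : Matrix (Fin 3) (Fin 3) ℝ} (hP : Pᵀ * P = 1) (hP' : P * Pᵀ = 1)
    (hd : P.det = 1)
    (S : Matrix (Fin 3) (Fin 3) ℝ) (u v w : Fin 3 → ℝ) :
    cubicForm (P * S * Pᵀ) u v w = cubicForm S (Pᵀ *ᵥ u) (Pᵀ *ᵥ v) (Pᵀ *ᵥ w) := by
  have h2 : P * S * Pᵀ * (P * S * Pᵀ) = P * (S * S) * Pᵀ := by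
    calc _ = P * S * (Pᵀ * P) * S * Pᵀ := by simp only [mul_assoc]
      _ = _ := by rw [hP, mul_one]; simp only [mul_assoc]
  have key : ∀ x y z : Fin 3 → ℝ,
      tripleProduct x ((P * S * Pᵀ) *ᵥ y) ((P * (S * S) * Pᵀ) *ᵥ z) =
        tripleProduct (Pᵀ *ᵥ x) (S *ᵥ (Pᵀ *ᵥ y)) ((S * S) *ᵥ (Pᵀ *ᵥ z)) := by
    intro x y z
    rw [← one_mul (tripleProduct (Pᵀ *ᵥ x) _ _), ← hd, ← tripleProduct_mulVec]
    simp only [mulVec_mulVec, ← mul_assoc, hP', one_mulVec]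
  simp only [cubicForm, h2, key]

theorem cubicTensor_conj {P : Matrix (Fin 3) (Fin 3) ℝ} (hP : Pᵀ * P = 1) (hP' : P * Pᵀ = 1)
    (hd : P.det = 1) (S : Matrix (Fin 3) (Fin 3) ℝ) :
    cubicTensor (P * S * Pᵀ) = (P ⊗ₖ (P ⊗ₖ P)) *ᵥ cubicTensor S := by
  ext r
  rw [cubicTensor, cubicForm_conj hP hP' hd, cubicForm_eq_sum]
  simp only [Matrix.mulVec_single_one]
  rfl

/-- The product of the differences of three numbers. -/
def vandermonde3 (s : Fin 3 → ℝ) : ℝ := (s 1 - s 0) * (s 2 - s 0) * (s 2 - s 1)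

/-- The permanent of the matrix with rows `u`, `v`, `w`. -/
def permanent3 (u v w : Fin 3 → ℝ) : ℝ :=
  u 0 * v 1 * w 2 + u 0 * v 2 * w 1 + u 1 * v 0 * w 2 + u 1 * v 2 * w 0 + u 2 * v 0 * w 1 +
    u 2 * v 1 * w 0

theorem cubicForm_diagonal (s : Fin 3 → ℝ) (u v w : Fin 3 → ℝ) :
    cubicForm (diagonal s) u v w = vandermonde3 s * permanent3 u v w := by
  simp only [cubicForm, diagonal_mul_diagonal, mulVec_diagonal, tripleProduct_eq,
    vandermonde3, permanent3]
  ring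

/-- The cubic tensor of a symmetric matrix is harmonic: its contraction vanishes. -/
theorem cubicTensor_trace {S : Matrix (Fin 3) (Fin 3) ℝ} (hS : Sᵀ = S) (k : Fin 3) :
    cubicTensor S (0, 0, k) + cubicTensor S (1, 1, k) + cubicTensor S (2, 2, k) = 0 := by
  have h : ∀ i j, S j i = S i j := fun i j => congrFun (congrFun hS i) j
  fin_cases k <;>
  · simp [cubicTensor, cubicForm, tripleProduct_eq, Matrix.mul_apply, Fin.sum_univ_three,
      h 0 1, h 0 2, h 1 2]
    ring

end Cubic

/-! ### The biquadratic tensor of two symmetric matrices -/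

section Biquadratic

/-- The trace-free part of a `3 × 3` matrix. -/
def traceFree (S : Matrix (Fin 3) (Fin 3) ℝ) : Matrix (Fin 3) (Fin 3) ℝ :=
  S - (S.trace / 3) • 1

theorem traceFree_conj {P : Matrix (Fin 3) (Fin 3) ℝ} (hP : Pᵀ * P = 1) (hP' : P * Pᵀ = 1)
    (S : Matrix (Fin 3) (Fin 3) ℝ) : traceFree (P * S * Pᵀ) = P * traceFree S * Pᵀ := by
  have : (P * S * Pᵀ).trace = S.trace := by
    rw [Matrix.trace_mul_comm, ← mul_assoc, hP, one_mul]
  simp only [traceFree, this, mul_sub, sub_mul, Matrix.mul_smul, Matrix.smul_mul, mul_one, hP']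

theorem traceFree_transpose {S : Matrix (Fin 3) (Fin 3) ℝ} (hS : Sᵀ = S) :
    (traceFree S)ᵀ = traceFree S := by
  simp [traceFree, hS]

theorem trace_traceFree (S : Matrix (Fin 3) (Fin 3) ℝ) : (traceFree S).trace = 0 := by
  simp [traceFree]

/-- The tensor `S₀ ⊗ (S'²)₀ - (S²)₀ ⊗ S'₀`, where `₀` denotes the trace-free part. -/
def biquadraticTensor (S S' : Matrix (Fin 3) (Fin 3) ℝ)
    (r : (Fin 3 × Fin 3) × (Fin 3 × Fin 3)) : ℝ :=
  traceFree S r.1.1 r.1.2 * traceFree (S' * S') r.2.1 r.2.2 -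
    traceFree (S * S) r.1.1 r.1.2 * traceFree S' r.2.1 r.2.2

theorem biquadraticTensor_conj {P P' : Matrix (Fin 3) (Fin 3) ℝ} (hP : Pᵀ * P = 1)
    (hP₂ : P * Pᵀ = 1) (hP' : P'ᵀ * P' = 1) (hP₂' : P' * P'ᵀ = 1)
    (S S' : Matrix (Fin 3) (Fin 3) ℝ) :
    biquadraticTensor (P * S * Pᵀ) (P' * S' * P'ᵀ) =
      ((P ⊗ₖ P) ⊗ₖ (P' ⊗ₖ P')) *ᵥ biquadraticTensor S S' := by
  have h2 : ∀ {P : Matrix (Fin 3) (Fin 3) ℝ} (_ : Pᵀ * P = 1) (S : Matrix (Fin 3) (Fin 3) ℝ),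
      P * S * Pᵀ * (P * S * Pᵀ) = P * (S * S) * Pᵀ := by
    intro P hP S
    calc _ = P * S * (Pᵀ * P) * S * Pᵀ := by simp only [mul_assoc]
      _ = _ := by rw [hP, mul_one]; simp only [mul_assoc]
  have e : ∀ S S' : Matrix (Fin 3) (Fin 3) ℝ, biquadraticTensor S S' =
      outer (Function.uncurry (traceFree S)) (Function.uncurry (traceFree (S' * S'))) -
      outer (Function.uncurry (traceFree (S * S))) (Function.uncurry (traceFree S')) :=
    fun _ _ => rfl
  simp only [e, mulVec_sub, kronecker_mulVec_outer, kronecker_mulVec_uncurry, h2 hP, h2 hP',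
    traceFree_conj hP hP₂, traceFree_conj hP' hP₂']

end Biquadratic

/-! ### The cubic and biquadratic covariants -/

section CovariantMaps

theorem continuous_rot (b : Bool) : Continuous (rot b) := by
  refine continuous_matrix fun i j => ?_
  have hc : Continuous fun g : SO 4 => (g : Matrix (Fin 4) (Fin 4) ℝ) := continuous_subtype_val
  exact continuous_const.mul (Continuous.matrix_trace
    (continuous_const.mul ((hc.mul continuous_const).mul hc.matrix_transpose)))

theorem coe_conjAction (g : SO 4) (A : tracelessSymMat 4) :
    ((conjAction 4 g A : tracelessSymMat 4) : Matrix (Fin 4) (Fin 4) ℝ) =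
      (g : Matrix (Fin 4) (Fin 4) ℝ) * A * (g : Matrix (Fin 4) (Fin 4) ℝ)ᵀ := rfl

/-- The cubic tensor of the Gram matrix `b`. The associated module is `W_(3,3)` for `true` and
`W_(3,-3)` for `false`. -/
def cubicCovariant (b : Bool) (A : tracelessSymMat 4) : Fin 3 × Fin 3 × Fin 3 → ℝ :=
  cubicTensor (gram b A)

/-- The action on cubic tensors of the rotation `b`. -/
def cubicRot (b : Bool) (g : SO 4) :
    Matrix (Fin 3 × Fin 3 × Fin 3) (Fin 3 × Fin 3 × Fin 3) ℝ :=
  rot b g ⊗ₖ (rot b g ⊗ₖ rot b g)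

/-- The biquadratic tensor of the two Gram matrices. The associated module is `W_(4)`. -/
def biquadraticCovariant (A : tracelessSymMat 4) : (Fin 3 × Fin 3) × (Fin 3 × Fin 3) → ℝ :=
  biquadraticTensor (gram true A) (gram false A)

/-- The action of the two rotations on biquadratic tensors. -/
def biquadraticRot (g : SO 4) :
    Matrix ((Fin 3 × Fin 3) × (Fin 3 × Fin 3)) ((Fin 3 × Fin 3) × (Fin 3 × Fin 3)) ℝ :=
  (rot true g ⊗ₖ rot true g) ⊗ₖ (rot false g ⊗ₖ rot false g)

theorem continuous_kronecker {X l m n p : Type*} [TopologicalSpace X]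
    {A : X → Matrix l m ℝ} {B : X → Matrix n p ℝ} (hA : Continuous A) (hB : Continuous B) :
    Continuous fun x => A x ⊗ₖ B x :=
  continuous_matrix fun _ _ => (hA.matrix_elem _ _).mul (hB.matrix_elem _ _)

theorem isCovariant_cubic (b : Bool) : IsCovariant (cubicCovariant b) (cubicRot b) where
  map_conj g A := by
    rw [cubicCovariant, coe_conjAction, gram_conj]
    exact cubicTensor_conj (rot_transpose_mul b g) (rot_mul_transpose b g) (det_rot b g) _
  map_inv g := by simp only [cubicRot, rot_inv, kroneckerMap_transpose]
  continuous := continuous_kronecker (continuous_rot b)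
    (continuous_kronecker (continuous_rot b) (continuous_rot b))

theorem isCovariant_biquadratic : IsCovariant biquadraticCovariant biquadraticRot where
  map_conj g A := by
    rw [biquadraticCovariant, coe_conjAction, gram_conj, gram_conj]
    exact biquadraticTensor_conj (rot_transpose_mul true g) (rot_mul_transpose true g)
      (rot_transpose_mul false g) (rot_mul_transpose false g) _ _
  map_inv g := by simp only [biquadraticRot, rot_inv, kroneckerMap_transpose]
  continuous := continuous_kronecker (continuous_kronecker (continuous_rot true)
    (continuous_rot true)) (continuous_kronecker (continuous_rot false) (continuous_rot false))

end CovariantMaps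

/-! ### Upper bounds for the dimensions -/

section Dimension

/-- If `F` factors linearly through a function with values in `κ → ℝ`, its coefficient functions
span a space of dimension at most the cardinality of `κ`. -/
theorem finrank_range_pairing_le {ι κ : Type*} [Fintype ι] [Fintype κ]
    {F : tracelessSymMat 4 → ι → ℝ} (E : Matrix ι κ ℝ) (f : tracelessSymMat 4 → κ → ℝ)
    (hF : ∀ A, F A = E *ᵥ f A) :
    Module.finrank ℝ (LinearMap.range (pairing F)) ≤ Fintype.card κ := by
  have hle : LinearMap.range (pairing F) ≤ LinearMap.range (pairing f) := by
    rintro _ ⟨e, rfl⟩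
    refine ⟨Eᵀ *ᵥ e, ?_⟩
    ext A
    rw [pairing_apply, pairing_apply, hF, Matrix.dotProduct_mulVec, Matrix.mulVec_transpose]
  calc _ ≤ Module.finrank ℝ (LinearMap.range (pairing f)) := Submodule.finrank_mono hle
    _ ≤ Module.finrank ℝ (κ → ℝ) := LinearMap.finrank_range_le _
    _ = _ := Module.finrank_fintype_fun_eq_card ℝ

theorem cubicTensor_swap (S : Matrix (Fin 3) (Fin 3) ℝ) (i j k : Fin 3) :
    cubicTensor S (i, j, k) = cubicTensor S (j, i, k) := cubicForm_swap _ _ _ _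

theorem cubicTensor_rotate (S : Matrix (Fin 3) (Fin 3) ℝ) (i j k : Fin 3) :
    cubicTensor S (i, j, k) = cubicTensor S (j, k, i) := cubicForm_rotate _ _ _ _

/-- Seven coordinates that determine the cubic tensor of a symmetric matrix. -/
def cubicCoords (S : Matrix (Fin 3) (Fin 3) ℝ) : Fin 7 → ℝ :=
  ![cubicTensor S (0, 1, 2), cubicTensor S (0, 1, 1), cubicTensor S (0, 2, 2),
    cubicTensor S (0, 0, 1), cubicTensor S (1, 2, 2), cubicTensor S (0, 0, 2),
    cubicTensor S (1, 1, 2)]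

/-- The symmetric harmonic tensor with the given seven coordinates. -/
def cubicOfCoords (x : Fin 7 → ℝ) : Fin 3 → Fin 3 → Fin 3 → ℝ :=
  ![![![-x 1 - x 2, x 3, x 5], ![x 3, x 1, x 0], ![x 5, x 0, x 2]],
    ![![x 3, x 1, x 0], ![x 1, -x 3 - x 4, x 6], ![x 0, x 6, x 4]],
    ![![x 5, x 0, x 2], ![x 0, x 6, x 4], ![x 2, x 4, -x 5 - x 6]]]

theorem cubicTensor_eq_ofCoords {S : Matrix (Fin 3) (Fin 3) ℝ} (hS : Sᵀ = S) (i j k : Fin 3) :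
    cubicTensor S (i, j, k) = cubicOfCoords (cubicCoords S) i j k := by
  have h0 := cubicTensor_trace hS 0
  have h1 := cubicTensor_trace hS 1
  have h2 := cubicTensor_trace hS 2
  have e : ∀ i j, cubicTensor S (j, i, i) = cubicTensor S (i, i, j) := fun i j =>
    cubicTensor_rotate S j i i
  have e' : ∀ i j, cubicTensor S (i, j, i) = cubicTensor S (i, i, j) := fun i j => by
    rw [cubicTensor_swap, e]
  have a1 := cubicTensor_swap S 1 0 2
  have a2 := cubicTensor_rotate S 0 1 2
  have a3 := cubicTensor_rotate S 2 0 1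
  have a4 := cubicTensor_rotate S 1 0 2
  have a5 := cubicTensor_rotate S 2 1 0
  fin_cases i <;> fin_cases j <;> fin_cases k <;>
    simp [cubicOfCoords, cubicCoords] <;>
    linarith [e 0 1, e 0 2, e 1 0, e 1 2, e 2 0, e 2 1, e' 0 1, e' 0 2, e' 1 0, e' 1 2, e' 2 0,
      e' 2 1]

theorem finrank_cubic_le (b : Bool) :
    Module.finrank ℝ (isCovariant_cubic b).subrep.toSubmodule ≤ 7 := by
  let E : Matrix (Fin 3 × Fin 3 × Fin 3) (Fin 7) ℝ :=
    Matrix.of fun r l => cubicOfCoords (Pi.single l 1) r.1 r.2.1 r.2.2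
  refine finrank_range_pairing_le E (fun A => cubicCoords (gram b A)) fun A => ?_
  ext ⟨i, j, k⟩
  rw [cubicCovariant, cubicTensor_eq_ofCoords (gram_transpose b _)]
  generalize cubicCoords (gram b (A : Matrix (Fin 4) (Fin 4) ℝ)) = x
  simp only [E, Matrix.mulVec, dotProduct, Matrix.of_apply, Fin.sum_univ_seven]
  fin_cases i <;> fin_cases j <;> fin_cases k <;> simp [cubicOfCoords] <;> ring

/-- Five coordinates that determine the trace-free part of a symmetric matrix. -/
def traceFreeCoords (S : Matrix (Fin 3) (Fin 3) ℝ) : Fin 5 → ℝ :=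
  ![traceFree S 0 1, traceFree S 0 2, traceFree S 1 2, traceFree S 0 0, traceFree S 1 1]

/-- The trace-free symmetric matrix with the given five coordinates. -/
def traceFreeOfCoords (x : Fin 5 → ℝ) : Matrix (Fin 3) (Fin 3) ℝ :=
  !![x 3, x 0, x 1; x 0, x 4, x 2; x 1, x 2, -x 3 - x 4]

theorem traceFree_eq_ofCoords {S : Matrix (Fin 3) (Fin 3) ℝ} (hS : Sᵀ = S) :
    traceFree S = traceFreeOfCoords (traceFreeCoords S) := by
  have h : ∀ i j, traceFree S j i = traceFree S i j := fun i j =>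
    congrFun (congrFun (traceFree_transpose hS) i) j
  have h0 := trace_traceFree S
  simp only [Matrix.trace, Matrix.diag_apply, Fin.sum_univ_three] at h0
  ext i j
  fin_cases i <;> fin_cases j <;> simp [traceFreeOfCoords, traceFreeCoords, h 0 1, h 0 2, h 1 2]
  linarith

theorem finrank_biquadratic_le :
    Module.finrank ℝ isCovariant_biquadratic.subrep.toSubmodule ≤ 25 := by
  let E : Matrix (Fin 3 × Fin 3) (Fin 5) ℝ :=
    Matrix.of fun r l => traceFreeOfCoords (Pi.single l 1) r.1 r.2
  have hE : ∀ {S : Matrix (Fin 3) (Fin 3) ℝ} (_ : Sᵀ = S),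
      Function.uncurry (traceFree S) = E *ᵥ traceFreeCoords S := by
    intro S hS
    rw [traceFree_eq_ofCoords hS]
    generalize traceFreeCoords S = x
    ext ⟨i, j⟩
    simp only [E, Matrix.mulVec, dotProduct, Matrix.of_apply, Fin.sum_univ_five, Function.uncurry]
    fin_cases i <;> fin_cases j <;> simp [traceFreeOfCoords] <;> ring
  have h1 : ∀ A b, (gram b A)ᵀ = gram b A := fun A b => gram_transpose b A
  have h2 : ∀ A b, (gram b A * gram b A)ᵀ = gram b A * gram b A := fun A b => by
    rw [transpose_mul, h1]
  refine (finrank_range_pairing_le (E ⊗ₖ E) (fun A =>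
    outer (traceFreeCoords (gram true A)) (traceFreeCoords (gram false A * gram false A)) -
    outer (traceFreeCoords (gram true A * gram true A)) (traceFreeCoords (gram false A)))
    fun A => ?_).trans (by simp)
  rw [mulVec_sub, kronecker_mulVec_outer, kronecker_mulVec_outer, ← hE (h1 _ _), ← hE (h2 _ _),
    ← hE (h1 _ _), ← hE (h2 _ _)]
  rfl

end Dimension

/-! ### Weight vectors of the cubic and biquadratic modules -/

section WeightVectors

/-- The eigenvectors in `ℂ³` of the rotations about the first axis. -/
def weightBasis : Fin 3 → Fin 3 → ℂ :=
  ![![1, 0, 0], ![0, 1, -Complex.I], ![0, 1, Complex.I]]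

/-- The weights of `weightBasis` as characters of the rotation angle. -/
def weightOf : Fin 3 → ℤ := ![0, 1, -1]

/-- The character of weight `n` of the circle. -/
def angleCharacter (n : ℤ) (θ : ℝ) : ℂ := Complex.exp (Complex.I * ((n : ℂ) * (θ : ℂ)))

theorem angleCharacter_add (m n : ℤ) (θ : ℝ) :
    angleCharacter (m + n) θ = angleCharacter m θ * angleCharacter n θ := by
  simp only [angleCharacter, ← Complex.exp_add]
  congr 1
  push_cast
  ring

theorem rot_torus_mulVec_weightBasis (b : Bool) (s t : ℝ) (a : Fin 3) :
    (rot b (torus s t)).map Complex.ofReal *ᵥ weightBasis a =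
      angleCharacter (weightOf a) (torusAngle b s t) • weightBasis a := by
  rw [rot_torus]
  generalize torusAngle b s t = θ
  have h1 : Complex.exp (Complex.I * θ) = Complex.cos θ + Complex.sin θ * Complex.I := by
    rw [mul_comm, Complex.exp_mul_I]
  have h2 : Complex.exp (-(Complex.I * θ)) = Complex.cos θ - Complex.sin θ * Complex.I := by
    rw [show -(Complex.I * (θ : ℂ)) = (-(θ : ℂ)) * Complex.I by ring, Complex.exp_mul_I,
      Complex.cos_neg, Complex.sin_neg]
    ring
  have hI := Complex.I_mul_I
  ext i
  fin_cases a <;> fin_cases i <;>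
    simp [weightBasis, weightOf, angleCharacter, h1, h2, Matrix.mulVec, dotProduct,
      Fin.sum_univ_three] <;> first | ring1 | linear_combination (Complex.sin θ) * hI

theorem span_weightBasis : Submodule.span ℂ (Set.range weightBasis) = ⊤ := by
  have hI := Complex.I_mul_I
  set T := Submodule.span ℂ (Set.range weightBasis)
  have hm : ∀ a, weightBasis a ∈ T := fun a => Submodule.subset_span ⟨a, rfl⟩
  rw [eq_top_iff]
  rintro x -
  have : x = x 0 • weightBasis 0 + ((x 1 + Complex.I * x 2) / 2) • weightBasis 1 +
      ((x 1 - Complex.I * x 2) / 2) • weightBasis 2 := by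
    ext i
    fin_cases i <;> simp [weightBasis]
    · ring
    · linear_combination (x 2) * hI
  rw [this]
  exact T.add_mem (T.add_mem (T.smul_mem _ (hm 0)) (T.smul_mem _ (hm 1))) (T.smul_mem _ (hm 2))

theorem map_kronecker {l m n p : Type*} (A : Matrix l m ℝ) (B : Matrix n p ℝ) :
    (A ⊗ₖ B).map Complex.ofReal = A.map Complex.ofReal ⊗ₖ B.map Complex.ofReal := by
  ext
  simp

theorem outer_smul_smul {m p : Type*} (c d : ℂ) (x : m → ℂ) (y : p → ℂ) :
    outer (c • x) (d • y) = (c * d) • outer x y := by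
  ext r
  simp only [outer, Pi.smul_apply, smul_eq_mul]
  ring

/-- The highest weight can be read off from a family `w` of weight vectors spanning the coefficient
space; only the vector of the highest weight has to give a nonzero element of the module. -/
theorem IsCovariant.hasHighestWeight {ι κ : Type*} [Fintype ι] [DecidableEq ι]
    {F : tracelessSymMat 4 → ι → ℝ} {R : SO 4 → Matrix ι ι ℝ} (h : IsCovariant F R)
    {w : κ → ι → ℂ} (hspan : Submodule.span ℂ (Set.range w) = ⊤) {m : κ → ℤ × ℤ}
    (hw : ∀ k s t, (R (torus s t)).map Complex.ofReal *ᵥ w k = torusCharacter (m k) s t • w k)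
    {k₀ : κ} (h0 : h.vectorC (w k₀) ≠ 0)
    (hm : ∀ k, ∃ a b : ℕ, m k₀ - m k = a • ((1, -1) : ℤ × ℤ) + b • ((1, 1) : ℤ × ℤ)) :
    HasHighestWeight h.subrep.toRepresentation (m k₀) := by
  refine ⟨⟨_, h0, h.isWeightVector_vectorC (hw k₀)⟩, fun l hl => ?_⟩
  have hs : ⊤ ≤ Submodule.span ℂ (Set.range fun k => h.vectorC (w k)) := by
    have : Set.range (fun k => h.vectorC (w k)) = h.vectorC '' Set.range w := by
      rw [← Set.range_comp]; rfl
    rw [this, ← Submodule.map_span, hspan, Submodule.map_top,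
      LinearMap.range_eq_top.2 h.vectorC_surjective]
  obtain ⟨k, rfl⟩ := exists_eq_of_isWeight (fun k => h.isWeightVector_vectorC (hw k)) hs hl
  exact hm k

/-- The tensor products of three vectors of `weightBasis`. -/
def cubicWeightVector (r : Fin 3 × Fin 3 × Fin 3) : Fin 3 × Fin 3 × Fin 3 → ℂ :=
  outer (weightBasis r.1) (outer (weightBasis r.2.1) (weightBasis r.2.2))

/-- The weight of `cubicWeightVector r`: the total angular weight `k` times `(1, 1)` for `true` and
`(-1, 1)` for `false`. -/
def cubicWeight (b : Bool) (r : Fin 3 × Fin 3 × Fin 3) : ℤ × ℤ :=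
  (bif b then weightOf r.1 + (weightOf r.2.1 + weightOf r.2.2)
    else -(weightOf r.1 + (weightOf r.2.1 + weightOf r.2.2)),
    weightOf r.1 + (weightOf r.2.1 + weightOf r.2.2))

theorem cubicRot_mulVec_weightVector (b : Bool) (r : Fin 3 × Fin 3 × Fin 3) (s t : ℝ) :
    (cubicRot b (torus s t)).map Complex.ofReal *ᵥ cubicWeightVector r =
      torusCharacter (cubicWeight b r) s t • cubicWeightVector r := by
  rw [cubicRot, map_kronecker, map_kronecker, cubicWeightVector, kronecker_mulVec_outer,
    kronecker_mulVec_outer, rot_torus_mulVec_weightBasis, rot_torus_mulVec_weightBasis,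
    rot_torus_mulVec_weightBasis, outer_smul_smul, outer_smul_smul, ← angleCharacter_add,
    ← angleCharacter_add]
  congr 1
  simp only [angleCharacter, torusCharacter, cubicWeight, torusAngle]
  congr 1
  cases b <;> simp <;> ring

theorem span_cubicWeightVector : Submodule.span ℂ (Set.range cubicWeightVector) = ⊤ :=
  span_outer_eq_top (y := fun r : Fin 3 × Fin 3 => outer (weightBasis r.1) (weightBasis r.2))
    span_weightBasis (span_outer_eq_top span_weightBasis span_weightBasis)

/-- The tensor products of four vectors of `weightBasis`, two in each factor. -/
def biquadraticWeightVector (r : (Fin 3 × Fin 3) × (Fin 3 × Fin 3)) :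
    (Fin 3 × Fin 3) × (Fin 3 × Fin 3) → ℂ :=
  outer (outer (weightBasis r.1.1) (weightBasis r.1.2))
    (outer (weightBasis r.2.1) (weightBasis r.2.2))

/-- The weight of `biquadraticWeightVector r`: `k (1, 1) + l (-1, 1)` for angular weights `k` and
`l` in the two factors. -/
def biquadraticWeight (r : (Fin 3 × Fin 3) × (Fin 3 × Fin 3)) : ℤ × ℤ :=
  (weightOf r.1.1 + weightOf r.1.2 - (weightOf r.2.1 + weightOf r.2.2),
    weightOf r.1.1 + weightOf r.1.2 + (weightOf r.2.1 + weightOf r.2.2))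

theorem biquadraticRot_mulVec_weightVector (r : (Fin 3 × Fin 3) × (Fin 3 × Fin 3)) (s t : ℝ) :
    (biquadraticRot (torus s t)).map Complex.ofReal *ᵥ biquadraticWeightVector r =
      torusCharacter (biquadraticWeight r) s t • biquadraticWeightVector r := by
  simp only [biquadraticRot, map_kronecker, biquadraticWeightVector, kronecker_mulVec_outer,
    rot_torus_mulVec_weightBasis, outer_smul_smul, ← angleCharacter_add]
  congr 1
  simp only [angleCharacter, torusCharacter, biquadraticWeight, torusAngle, ← Complex.exp_add]
  congr 1
  simp
  ring

theorem span_biquadraticWeightVector :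
    Submodule.span ℂ (Set.range biquadraticWeightVector) = ⊤ :=
  span_outer_eq_top (x := fun r : Fin 3 × Fin 3 => outer (weightBasis r.1) (weightBasis r.2))
    (y := fun r : Fin 3 × Fin 3 => outer (weightBasis r.1) (weightBasis r.2))
    (span_outer_eq_top span_weightBasis span_weightBasis)
    (span_outer_eq_top span_weightBasis span_weightBasis)

/-- A matrix at which every weight component of the cubic and biquadratic tensors is nonzero. -/
def sampleMatrix : tracelessSymMat 4 :=
  ⟨!![-1, 0, -1, 0; 0, 1, 1, 1; -1, 1, 0, 0; 0, 1, 0, 0], by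
    refine mem_tracelessSymMat.2 ⟨?_, ?_⟩
    · ext i j
      fin_cases i <;> fin_cases j <;> simp
    · simp [Matrix.trace, Fin.sum_univ_four]⟩

theorem moment_sampleMatrix :
    moment (sampleMatrix : Matrix (Fin 4) (Fin 4) ℝ) = !![0, -2, 0; -2, 2, 0; -4, 0, 2] := by
  rw [moment_of_isSymm (mem_tracelessSymMat.1 sampleMatrix.2).1]
  simp [sampleMatrix]
  norm_num

theorem gram_sampleMatrix (b : Bool) : gram b (sampleMatrix : Matrix (Fin 4) (Fin 4) ℝ) =
    bif b then !![4, -4, 0; -4, 8, 8; 0, 8, 20] else !![20, -4, -8; -4, 8, 0; -8, 0, 4] := by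
  cases b <;> simp only [gram, moment_sampleMatrix] <;> ext i j <;> fin_cases i <;>
    fin_cases j <;> simp [Matrix.mul_apply, Fin.sum_univ_three] <;> norm_num

theorem cubicCoords_sampleMatrix (b : Bool) :
    cubicCoords (gram b (sampleMatrix : Matrix (Fin 4) (Fin 4) ℝ)) =
      bif b then ![-64, -256, -512, -1280, -1792, -2432, 896]
        else ![-1600, -512, 1280, -2048, 1280, 128, 1408] := by
  rw [gram_sampleMatrix]
  cases b <;> simp [cubicCoords, cubicTensor, cubicForm, tripleProduct_eq] <;> norm_num

/-- Indices of cubic weight vectors with the seven angular weights `3, 2, …, -3`. -/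
def cubicWeightIndex : Fin 7 → Fin 3 × Fin 3 × Fin 3 :=
  ![(1, 1, 1), (1, 1, 0), (1, 0, 0), (0, 0, 0), (2, 0, 0), (2, 2, 0), (2, 2, 2)]

theorem cubic_vectorC_ne_zero (b : Bool) (k : Fin 7) :
    (isCovariant_cubic b).vectorC (cubicWeightVector (cubicWeightIndex k)) ≠ 0 := by
  apply (isCovariant_cubic b).vectorC_ne_zero sampleMatrix
  have hF : ∀ i j k, cubicCovariant b sampleMatrix (i, j, k) = cubicOfCoords
      (bif b then ![-64, -256, -512, -1280, -1792, -2432, 896]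
        else ![-1600, -512, 1280, -2048, 1280, 128, 1408]) i j k := by
    intro i j k
    rw [cubicCovariant, cubicTensor_eq_ofCoords (gram_transpose b _), cubicCoords_sampleMatrix]
  simp only [Fintype.sum_prod_type, Fin.sum_univ_three, hF, cubicWeightVector, outer]
  fin_cases k <;> cases b <;>
    simp [cubicWeightIndex, weightBasis, cubicOfCoords, Complex.ext_iff] <;> norm_num

end WeightVectors

/-! ### Dimensions and highest weights -/

section Multiplicity

/-- Indices of products of two vectors of `weightBasis` with the five angular weights `2, 1, …, -2`.
-/
def quadraticWeightIndex : Fin 5 → Fin 3 × Fin 3 := ![(1, 1), (1, 0), (0, 0), (2, 0), (2, 2)]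

/-- The value of a quadratic tensor on the pair `p` of vectors of `weightBasis`. -/
def quadraticEval (X : Matrix (Fin 3) (Fin 3) ℝ) (p : Fin 3 × Fin 3) : ℂ :=
  ∑ i, ∑ j, weightBasis p.1 i * weightBasis p.2 j * X i j

theorem sum_biquadraticWeightVector (S S' : Matrix (Fin 3) (Fin 3) ℝ)
    (p : (Fin 3 × Fin 3) × (Fin 3 × Fin 3)) :
    ∑ r, biquadraticWeightVector p r * biquadraticTensor S S' r =
      quadraticEval (traceFree S) p.1 * quadraticEval (traceFree (S' * S')) p.2 -
        quadraticEval (traceFree (S * S)) p.1 * quadraticEval (traceFree S') p.2 := by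
  have h : ∀ X Y : Matrix (Fin 3) (Fin 3) ℝ, quadraticEval X p.1 * quadraticEval Y p.2 =
      ∑ r, biquadraticWeightVector p r * ((X r.1.1 r.1.2 * Y r.2.1 r.2.2 : ℝ) : ℂ) := by
    intro X Y
    rw [Fintype.sum_prod_type, quadraticEval, quadraticEval, ← Fintype.sum_prod_type',
      ← Fintype.sum_prod_type', Finset.sum_mul_sum]
    refine Finset.sum_congr rfl fun i _ => Finset.sum_congr rfl fun j _ => ?_
    simp only [biquadraticWeightVector, outer, Complex.ofReal_mul]
    ring
  rw [h, h, ← Finset.sum_sub_distrib]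
  refine Finset.sum_congr rfl fun r _ => ?_
  rw [biquadraticTensor, Complex.ofReal_sub, mul_sub]

theorem quadraticEval_gram_sampleMatrix (k : Fin 5) :
    quadraticEval (traceFree (gram true sampleMatrix)) (quadraticWeightIndex k) =
      ![-12 - 16 * Complex.I, -4, -20 / 3, -4, -12 + 16 * Complex.I] k ∧
    quadraticEval (traceFree (gram true sampleMatrix * gram true sampleMatrix))
        (quadraticWeightIndex k) =
      ![-320 - 448 * Complex.I, -48 + 32 * Complex.I, -544 / 3, -48 - 32 * Complex.I,
        -320 + 448 * Complex.I] k ∧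
    quadraticEval (traceFree (gram false sampleMatrix)) (quadraticWeightIndex k) =
      ![4, -4 + 8 * Complex.I, 28 / 3, -4 - 8 * Complex.I, 4] k ∧
    quadraticEval (traceFree (gram false sampleMatrix * gram false sampleMatrix))
        (quadraticWeightIndex k) =
      ![-64 * Complex.I, -112 + 192 * Complex.I, 800 / 3, -112 - 192 * Complex.I,
        64 * Complex.I] k := by
  simp only [gram_sampleMatrix, cond_true, cond_false, quadraticEval, Fin.sum_univ_three]
  fin_cases k <;>
    simp [quadraticWeightIndex, weightBasis, traceFree, Matrix.trace, Fin.sum_univ_three,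
      Complex.ext_iff] <;> norm_num

theorem biquadratic_vectorC_ne_zero (k : Fin 5 × Fin 5) :
    isCovariant_biquadratic.vectorC (biquadraticWeightVector
      (quadraticWeightIndex k.1, quadraticWeightIndex k.2)) ≠ 0 := by
  apply isCovariant_biquadratic.vectorC_ne_zero sampleMatrix
  obtain ⟨k, l⟩ := k
  obtain ⟨h1, h2, -, -⟩ := quadraticEval_gram_sampleMatrix k
  obtain ⟨-, -, h3, h4⟩ := quadraticEval_gram_sampleMatrix l
  simp only [biquadraticCovariant]
  rw [sum_biquadraticWeightVector, h1, h2, h3, h4]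
  clear h1 h2 h3 h4
  fin_cases k <;> fin_cases l <;> simp [Complex.ext_iff] <;> norm_num

theorem finite_cubic (b : Bool) : Module.Finite ℝ (isCovariant_cubic b).subrep.toSubmodule :=
  inferInstanceAs (Module.Finite ℝ (LinearMap.range _))

theorem finite_biquadratic : Module.Finite ℝ isCovariant_biquadratic.subrep.toSubmodule :=
  inferInstanceAs (Module.Finite ℝ (LinearMap.range _))

theorem finrank_cubic (b : Bool) :
    Module.finrank ℝ (isCovariant_cubic b).subrep.toSubmodule = 7 := by
  have := finite_cubic b
  refine le_antisymm (finrank_cubic_le b) ?_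
  exact card_le_finrank_of_isWeightVector
    (fun k => (isCovariant_cubic b).isWeightVector_vectorC
      (cubicRot_mulVec_weightVector b (cubicWeightIndex k)))
    (cubic_vectorC_ne_zero b) (by cases b <;> decide)

theorem finrank_biquadratic :
    Module.finrank ℝ isCovariant_biquadratic.subrep.toSubmodule = 25 := by
  have := finite_biquadratic
  refine le_antisymm finrank_biquadratic_le ?_
  exact card_le_finrank_of_isWeightVector
    (fun k : Fin 5 × Fin 5 => isCovariant_biquadratic.isWeightVector_vectorC
      (biquadraticRot_mulVec_weightVector (quadraticWeightIndex k.1, quadraticWeightIndex k.2)))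
    biquadratic_vectorC_ne_zero (by decide)

theorem weightOf_mem (a : Fin 3) : -1 ≤ weightOf a ∧ weightOf a ≤ 1 := by
  fin_cases a <;> simp [weightOf]

theorem hasHighestWeight_cubic (b : Bool) :
    HasHighestWeight (isCovariant_cubic b).subrep.toRepresentation
      (3, bif b then 3 else -3) := by
  have h := (isCovariant_cubic b).hasHighestWeight span_cubicWeightVector
    (cubicRot_mulVec_weightVector b)
    (k₀ := cubicWeightIndex (bif b then 0 else 6)) (cubic_vectorC_ne_zero b _) ?_
  · cases b
    · exact h
    · exact h
  · rintro ⟨i, j, k⟩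
    obtain ⟨hi, hi'⟩ := weightOf_mem i
    obtain ⟨hj, hj'⟩ := weightOf_mem j
    obtain ⟨hk, hk'⟩ := weightOf_mem k
    cases b
    · refine ⟨(3 + (weightOf i + (weightOf j + weightOf k))).toNat, 0, ?_⟩
      have e : cubicWeight false (cubicWeightIndex (bif false then 0 else 6)) = (3, -3) := by decide
      rw [e]
      simp only [cubicWeight, cond_false, Prod.smul_mk, Prod.mk_add_mk, Prod.mk_sub_mk,
        Prod.mk.injEq]
      simp only [nsmul_eq_mul]
      omega
    · refine ⟨0, (3 - (weightOf i + (weightOf j + weightOf k))).toNat, ?_⟩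
      have e : cubicWeight true (cubicWeightIndex (bif true then 0 else 6)) = (3, 3) := by decide
      rw [e]
      simp only [cubicWeight, cond_true, Prod.smul_mk, Prod.mk_add_mk, Prod.mk_sub_mk,
        Prod.mk.injEq]
      simp only [nsmul_eq_mul]
      omega

theorem hasHighestWeight_biquadratic :
    HasHighestWeight isCovariant_biquadratic.subrep.toRepresentation (4, 0) := by
  have h := isCovariant_biquadratic.hasHighestWeight span_biquadraticWeightVector
    biquadraticRot_mulVec_weightVector
    (k₀ := (quadraticWeightIndex 0, quadraticWeightIndex 4))
    (biquadratic_vectorC_ne_zero (0, 4)) ?_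
  · exact h
  · rintro ⟨⟨i, j⟩, ⟨k, l⟩⟩
    obtain ⟨hi, hi'⟩ := weightOf_mem i
    obtain ⟨hj, hj'⟩ := weightOf_mem j
    obtain ⟨hk, hk'⟩ := weightOf_mem k
    obtain ⟨hl, hl'⟩ := weightOf_mem l
    refine ⟨(2 + (weightOf k + weightOf l)).toNat, (2 - (weightOf i + weightOf j)).toNat, ?_⟩
    have e : biquadraticWeight (quadraticWeightIndex 0, quadraticWeightIndex 4) = (4, 0) := by
      decide
    rw [e]
    simp only [biquadraticWeight, Prod.smul_mk, Prod.mk_add_mk, Prod.mk_sub_mk,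
      Prod.mk.injEq]
    simp only [nsmul_eq_mul]
    omega

end Multiplicity

/-! ### Irreducibility -/

section Irreducibility

/-- The matrix of the map `x ↦ (a i * x (p i))`. -/
def monomialMatrix {ι : Type*} [DecidableEq ι] (a : ι → ℝ) (p : ι → ι) : Matrix ι ι ℝ :=
  Matrix.of fun i j => if j = p i then a i else 0

theorem monomialMatrix_mulVec {ι : Type*} [Fintype ι] [DecidableEq ι] (a : ι → ℝ) (p : ι → ι)
    (x : ι → ℝ) : monomialMatrix a p *ᵥ x = fun i => a i * x (p i) := by
  ext i
  simp [monomialMatrix, Matrix.mulVec, dotProduct]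

theorem monomialMatrix_kronecker {ι κ : Type*} [DecidableEq ι] [DecidableEq κ]
    (a : ι → ℝ) (p : ι → ι) (b : κ → ℝ) (q : κ → κ) :
    monomialMatrix a p ⊗ₖ monomialMatrix b q =
      monomialMatrix (fun r => a r.1 * b r.2) (Prod.map p q) := by
  ext r r'
  by_cases h1 : r'.1 = p r.1 <;> by_cases h2 : r'.2 = q r.2 <;>
    simp [monomialMatrix, Prod.ext_iff, h1, h2]

/-- The eigenvalues of the half-turn about the axis `i` of `ℝ³`. -/
def halfTurnSign (i j : Fin 3) : ℝ := if j = i then 1 else -1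

theorem rot_isoclinic_eq_monomial (b : Bool) (i : Fin 3) :
    rot b (isoclinicSO b i) = monomialMatrix (halfTurnSign i) id := by
  rw [rot_isoclinic]
  ext j k
  simp only [diagonal_apply, monomialMatrix, halfTurnSign, Matrix.of_apply, id, eq_comm]

theorem rot_isoclinic_not_eq_monomial (b : Bool) (i : Fin 3) :
    rot (!b) (isoclinicSO b i) = monomialMatrix (fun _ => 1) id := by
  rw [rot_isoclinic_not]
  ext j k
  simp only [one_apply, monomialMatrix, Matrix.of_apply, id, eq_comm]

theorem rot_cycle_eq_monomial (b : Bool) :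
    rot b cycleSO = monomialMatrix (fun _ => 1) ![2, 0, 1] := by
  rw [rot_cycle]
  ext j k
  fin_cases j <;> fin_cases k <;> simp [monomialMatrix]

theorem rot_swap_eq_monomial (b : Bool) :
    rot b swapSO = monomialMatrix (fun _ => -1) ![1, 0, 2] := by
  rw [rot_swap]
  ext j k
  fin_cases j <;> fin_cases k <;> simp [monomialMatrix]

/-- `Q` is in the algebra generated by the matrices `R g`, and its transpose fixes `e₀`. Affine
combinations and products of such matrices are again of this kind. -/
def IsFixingAverage {ι : Type*} [Fintype ι] [DecidableEq ι] (R : SO 4 → Matrix ι ι ℝ)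
    (e₀ : ι → ℝ) (Q : Matrix ι ι ℝ) : Prop :=
  Q ∈ Algebra.adjoin ℝ (Set.range R) ∧ Qᵀ *ᵥ e₀ = e₀

section

variable {ι : Type*} [Fintype ι] [DecidableEq ι] {R : SO 4 → Matrix ι ι ℝ} {e₀ : ι → ℝ}

theorem IsFixingAverage.mul {Q Q' : Matrix ι ι ℝ} (h : IsFixingAverage R e₀ Q)
    (h' : IsFixingAverage R e₀ Q') : IsFixingAverage R e₀ (Q * Q') :=
  ⟨mul_mem h.1 h'.1, by rw [transpose_mul, ← mulVec_mulVec, h.2, h'.2]⟩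

theorem IsFixingAverage.average {Q Q' : Matrix ι ι ℝ} (h : IsFixingAverage R e₀ Q)
    (h' : IsFixingAverage R e₀ Q') {s t : ℝ} (hst : s + t = 1) :
    IsFixingAverage R e₀ (s • Q + t • Q') :=
  ⟨add_mem (Subalgebra.smul_mem _ h.1 s) (Subalgebra.smul_mem _ h'.1 t), by
    rw [transpose_add, transpose_smul, transpose_smul, add_mulVec, smul_mulVec, smul_mulVec, h.2,
      h'.2, ← add_smul, hst, one_smul]⟩

theorem IsFixingAverage.one : IsFixingAverage R e₀ 1 :=
  ⟨one_mem _, by rw [transpose_one, one_mulVec]⟩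

/-- A group element that has `e₀` as an eigenvector becomes fixing after scaling by the eigenvalue.
-/
theorem IsFixingAverage.of_mulVec {g : SO 4} (hR : (R g)ᵀ * R g = 1) {c : ℝ}
    (h : R g *ᵥ e₀ = c • e₀) : IsFixingAverage R e₀ (c • R g) := by
  refine ⟨Subalgebra.smul_mem _ (Algebra.subset_adjoin (Set.mem_range_self g)) c, ?_⟩
  rw [transpose_smul, smul_mulVec, ← mulVec_smul, ← h, mulVec_mulVec, hR, one_mulVec]

end

theorem cubicRot_transpose_mul (b : Bool) (g : SO 4) : (cubicRot b g)ᵀ * cubicRot b g = 1 := by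
  simp only [cubicRot, ← kroneckerMap_transpose, ← mul_kronecker_mul, rot_transpose_mul,
    one_kronecker_one]

theorem biquadraticRot_transpose_mul (g : SO 4) :
    (biquadraticRot g)ᵀ * biquadraticRot g = 1 := by
  simp only [biquadraticRot, ← kroneckerMap_transpose, ← mul_kronecker_mul, rot_transpose_mul,
    one_kronecker_one]

/-- The cubic tensor of a diagonal matrix up to its factor `vandermonde3`: the coefficients of the
cubic form `x y z`. -/
def cubicBase (r : Fin 3 × Fin 3 × Fin 3) : ℝ :=
  permanent3 (Pi.single r.1 1) (Pi.single r.2.1 1) (Pi.single r.2.2 1)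

theorem cubicTensor_diagonal (s : Fin 3 → ℝ) :
    cubicTensor (diagonal s) = vandermonde3 s • cubicBase := by
  ext r
  exact cubicForm_diagonal _ _ _ _

theorem exists_cubicCovariant_eq (b : Bool) (A : tracelessSymMat 4) :
    ∃ (g : SO 4) (c : ℝ), cubicCovariant b A = c • (cubicRot b g *ᵥ cubicBase) := by
  obtain ⟨g, d, h⟩ := exists_SO_diagonal (mem_tracelessSymMat.1 A.2).1
  refine ⟨g, vandermonde3 fun i => momentEntries d i ^ 2, ?_⟩
  rw [cubicCovariant, h, gram_conj, gram_diagonal,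
    cubicTensor_conj (rot_transpose_mul b g) (rot_mul_transpose b g) (det_rot b g),
    cubicTensor_diagonal, mulVec_smul]
  rfl

theorem cubicRot_isoclinic_mulVec (b : Bool) (i : Fin 3) (x : Fin 3 × Fin 3 × Fin 3 → ℝ) :
    cubicRot b (isoclinicSO b i) *ᵥ x = fun r =>
      halfTurnSign i r.1 * (halfTurnSign i r.2.1 * halfTurnSign i r.2.2) * x r := by
  rw [cubicRot, rot_isoclinic_eq_monomial, monomialMatrix_kronecker, monomialMatrix_kronecker,
    monomialMatrix_mulVec]
  rfl

/-- The cubic module is irreducible: averaging over two half-turns projects symmetric harmonic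
tensors to the line of `cubicBase`. -/
theorem cubic_invariant_eq (b : Bool) {U : Submodule ℝ (tracelessSymMat 4 → ℝ)}
    (hU : ∀ g, ∀ v ∈ U, funAction 4 g v ∈ U)
    (hle : U ≤ LinearMap.range (pairing (cubicCovariant b))) (hne : U ≠ ⊥) :
    U = LinearMap.range (pairing (cubicCovariant b)) := by
  have hfix : ∀ i, IsFixingAverage (cubicRot b) cubicBase (cubicRot b (isoclinicSO b i)) := by
    intro i
    rw [← one_smul ℝ (cubicRot b (isoclinicSO b i))]
    refine IsFixingAverage.of_mulVec (cubicRot_transpose_mul _ _) ?_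
    rw [cubicRot_isoclinic_mulVec, one_smul]
    ext ⟨j, k, l⟩
    fin_cases i <;> fin_cases j <;> fin_cases k <;> fin_cases l <;>
      simp [halfTurnSign, cubicBase, permanent3]
  set Q : Matrix (Fin 3 × Fin 3 × Fin 3) (Fin 3 × Fin 3 × Fin 3) ℝ :=
    ((1 / 2 : ℝ) • 1 + (1 / 2 : ℝ) • cubicRot b (isoclinicSO b 0)) *
    ((1 / 2 : ℝ) • 1 + (1 / 2 : ℝ) • cubicRot b (isoclinicSO b 1)) with hQ
  have hQf : IsFixingAverage (cubicRot b) cubicBase Q :=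
    (IsFixingAverage.one.average (hfix 0) (by norm_num)).mul
      (IsFixingAverage.one.average (hfix 1) (by norm_num))
  refine (isCovariant_cubic b).eq_range_of_invariant cubicBase (exists_cubicCovariant_eq b)
    hQf.1 (fun A => ⟨cubicCovariant b A (0, 1, 2), ?_⟩) hQf.2 hU hle hne
  rw [hQ, ← mulVec_mulVec]
  simp only [add_mulVec, smul_mulVec, one_mulVec, cubicRot_isoclinic_mulVec]
  ext ⟨j, k, l⟩
  simp only [cubicCovariant, Pi.add_apply, Pi.smul_apply, smul_eq_mul,
    cubicTensor_eq_ofCoords (gram_transpose b _)]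
  generalize cubicCoords (gram b (A : Matrix (Fin 4) (Fin 4) ℝ)) = x
  fin_cases j <;> fin_cases k <;> fin_cases l <;>
    simp [halfTurnSign, cubicBase, permanent3, cubicOfCoords] <;> ring

/-- The sign `1` for the cyclic successor, `-1` for the cyclic predecessor. -/
def cyclicSign : Fin 3 → Fin 3 → ℝ := ![![0, 1, -1], ![-1, 0, 1], ![1, -1, 0]]

/-- The biquadratic tensor of a pair of equal diagonal matrices up to a scalar factor. -/
def biquadraticBase (r : (Fin 3 × Fin 3) × (Fin 3 × Fin 3)) : ℝ :=
  if r.1.1 = r.1.2 ∧ r.2.1 = r.2.2 then cyclicSign r.1.1 r.2.1 else 0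

theorem biquadraticTensor_diagonal (s : Fin 3 → ℝ) :
    biquadraticTensor (diagonal s) (diagonal s) = (vandermonde3 s / 3) • biquadraticBase := by
  ext ⟨⟨i, j⟩, ⟨k, l⟩⟩
  simp only [biquadraticTensor, diagonal_mul_diagonal, biquadraticBase, Pi.smul_apply, smul_eq_mul]
  rcases eq_or_ne i j with rfl | hij
  · rcases eq_or_ne k l with rfl | hkl
    · simp only [traceFree, Matrix.trace_diagonal, Fin.sum_univ_three, vandermonde3]
      fin_cases i <;> fin_cases k <;> simp [cyclicSign] <;> ring
    · simp [traceFree, hkl]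
  · simp [traceFree, hij]

theorem exists_biquadraticCovariant_eq (A : tracelessSymMat 4) :
    ∃ (g : SO 4) (c : ℝ), biquadraticCovariant A = c • (biquadraticRot g *ᵥ biquadraticBase) := by
  obtain ⟨g, d, h⟩ := exists_SO_diagonal (mem_tracelessSymMat.1 A.2).1
  refine ⟨g, vandermonde3 (fun i => momentEntries d i ^ 2) / 3, ?_⟩
  rw [biquadraticCovariant, h, gram_conj, gram_diagonal, gram_conj, gram_diagonal,
    biquadraticTensor_conj (rot_transpose_mul true g) (rot_mul_transpose true g)
      (rot_transpose_mul false g) (rot_mul_transpose false g),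
    biquadraticTensor_diagonal, mulVec_smul]
  rfl

theorem biquadraticRot_isoclinic_mulVec (b : Bool) (i : Fin 3)
    (x : (Fin 3 × Fin 3) × (Fin 3 × Fin 3) → ℝ) :
    biquadraticRot (isoclinicSO b i) *ᵥ x = fun r =>
      (bif b then halfTurnSign i r.1.1 * halfTurnSign i r.1.2
        else halfTurnSign i r.2.1 * halfTurnSign i r.2.2) * x r := by
  have h := rot_isoclinic_not_eq_monomial b i
  cases b
  · rw [Bool.not_false] at h
    rw [biquadraticRot, rot_isoclinic_eq_monomial, h, monomialMatrix_kronecker,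
      monomialMatrix_kronecker, monomialMatrix_kronecker, monomialMatrix_mulVec]
    simp
  · rw [Bool.not_true] at h
    rw [biquadraticRot, rot_isoclinic_eq_monomial, h, monomialMatrix_kronecker,
      monomialMatrix_kronecker, monomialMatrix_kronecker, monomialMatrix_mulVec]
    simp

theorem biquadraticRot_cycle_mulVec (x : (Fin 3 × Fin 3) × (Fin 3 × Fin 3) → ℝ) :
    biquadraticRot cycleSO *ᵥ x = fun r => x ((![2, 0, 1] r.1.1, ![2, 0, 1] r.1.2),
      (![2, 0, 1] r.2.1, ![2, 0, 1] r.2.2)) := by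
  rw [biquadraticRot, rot_cycle_eq_monomial, rot_cycle_eq_monomial, monomialMatrix_kronecker,
    monomialMatrix_kronecker, monomialMatrix_mulVec]
  simp [Prod.map]

theorem biquadraticRot_swap_mulVec (x : (Fin 3 × Fin 3) × (Fin 3 × Fin 3) → ℝ) :
    biquadraticRot swapSO *ᵥ x = fun r => x ((![1, 0, 2] r.1.1, ![1, 0, 2] r.1.2),
      (![1, 0, 2] r.2.1, ![1, 0, 2] r.2.2)) := by
  rw [biquadraticRot, rot_swap_eq_monomial, rot_swap_eq_monomial, monomialMatrix_kronecker,
    monomialMatrix_kronecker, monomialMatrix_mulVec]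
  simp [Prod.map]

/-- Averaging a quadratic tensor over the half-turns keeps its diagonal entries. -/
theorem halfTurn_average (i j : Fin 3) :
    (1 / 2 + 1 / 2 * (halfTurnSign 0 i * halfTurnSign 0 j)) *
      (1 / 2 + 1 / 2 * (halfTurnSign 1 i * halfTurnSign 1 j)) = if i = j then 1 else 0 := by
  fin_cases i <;> fin_cases j <;> norm_num [halfTurnSign]

/-- The biquadratic module is irreducible: averaging over the half-turns of both factors leaves the
entries that are diagonal in each factor, and averaging these over the cyclic permutations and the
transposition, with its sign, leaves the line of `biquadraticBase`. -/
theorem biquadratic_invariant_eq {U : Submodule ℝ (tracelessSymMat 4 → ℝ)}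
    (hU : ∀ g, ∀ v ∈ U, funAction 4 g v ∈ U)
    (hle : U ≤ LinearMap.range (pairing biquadraticCovariant)) (hne : U ≠ ⊥) :
    U = LinearMap.range (pairing biquadraticCovariant) := by
  have hfix : ∀ b i, IsFixingAverage biquadraticRot biquadraticBase
      (biquadraticRot (isoclinicSO b i)) := by
    intro b i
    rw [← one_smul ℝ (biquadraticRot (isoclinicSO b i))]
    refine IsFixingAverage.of_mulVec (biquadraticRot_transpose_mul _) ?_
    rw [biquadraticRot_isoclinic_mulVec, one_smul]
    ext ⟨⟨j, k⟩, ⟨l, m⟩⟩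
    have hs : ∀ i j, halfTurnSign i j * halfTurnSign i j = 1 := by
      intro i j
      rw [halfTurnSign]
      split_ifs <;> norm_num
    simp only [biquadraticBase]
    split_ifs with h
    · obtain ⟨rfl, rfl⟩ := h
      cases b <;> simp [hs]
    · simp
  have hcyc : IsFixingAverage biquadraticRot biquadraticBase (biquadraticRot cycleSO) := by
    rw [← one_smul ℝ (biquadraticRot cycleSO)]
    refine IsFixingAverage.of_mulVec (biquadraticRot_transpose_mul _) ?_
    rw [biquadraticRot_cycle_mulVec, one_smul]
    ext ⟨⟨j, k⟩, ⟨l, m⟩⟩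
    fin_cases j <;> fin_cases k <;> fin_cases l <;> fin_cases m <;>
      simp [biquadraticBase, cyclicSign]
  have hswap : IsFixingAverage biquadraticRot biquadraticBase
      ((-1 : ℝ) • biquadraticRot swapSO) := by
    refine IsFixingAverage.of_mulVec (biquadraticRot_transpose_mul _) ?_
    rw [biquadraticRot_swap_mulVec]
    ext ⟨⟨j, k⟩, ⟨l, m⟩⟩
    fin_cases j <;> fin_cases k <;> fin_cases l <;> fin_cases m <;>
      simp [biquadraticBase, cyclicSign]
  -- `M` averages over the half-turns of each factor
  set M : Matrix ((Fin 3 × Fin 3) × (Fin 3 × Fin 3)) ((Fin 3 × Fin 3) × (Fin 3 × Fin 3)) ℝ :=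
    (((1 / 2 : ℝ) • 1 + (1 / 2 : ℝ) • biquadraticRot (isoclinicSO true 0)) *
    ((1 / 2 : ℝ) • 1 + (1 / 2 : ℝ) • biquadraticRot (isoclinicSO true 1))) *
    (((1 / 2 : ℝ) • 1 + (1 / 2 : ℝ) • biquadraticRot (isoclinicSO false 0)) *
    ((1 / 2 : ℝ) • 1 + (1 / 2 : ℝ) • biquadraticRot (isoclinicSO false 1))) with hM
  -- `N` averages over the cyclic group of order three, then over the signed transposition
  set N : Matrix ((Fin 3 × Fin 3) × (Fin 3 × Fin 3)) ((Fin 3 × Fin 3) × (Fin 3 × Fin 3)) ℝ :=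
    ((1 / 2 : ℝ) • 1 + (1 / 2 : ℝ) • ((-1 : ℝ) • biquadraticRot swapSO)) *
    ((1 / 3 : ℝ) • 1 + (2 / 3 : ℝ) • ((1 / 2 : ℝ) • biquadraticRot cycleSO +
      (1 / 2 : ℝ) • (biquadraticRot cycleSO * biquadraticRot cycleSO))) with hN
  have hMf : IsFixingAverage biquadraticRot biquadraticBase M := by
    refine ((IsFixingAverage.one.average (hfix _ _) ?_).mul
      (IsFixingAverage.one.average (hfix _ _) ?_)).mul
      ((IsFixingAverage.one.average (hfix _ _) ?_).mul
      (IsFixingAverage.one.average (hfix _ _) ?_)) <;> norm_num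
  have hNf : IsFixingAverage biquadraticRot biquadraticBase N := by
    refine (IsFixingAverage.one.average hswap ?_).mul (IsFixingAverage.one.average
      (hcyc.average (hcyc.mul hcyc) ?_) ?_) <;> norm_num
  have hMx : ∀ x r, (M *ᵥ x) r = if r.1.1 = r.1.2 ∧ r.2.1 = r.2.2 then x r else 0 := by
    intro x r
    have h1 := halfTurn_average r.1.1 r.1.2
    have h2 := halfTurn_average r.2.1 r.2.2
    have : (M *ᵥ x) r = (if r.1.1 = r.1.2 then 1 else 0) * (if r.2.1 = r.2.2 then 1 else 0) *
        x r := by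
      rw [← h1, ← h2, hM]
      simp only [← mulVec_mulVec, add_mulVec, smul_mulVec, one_mulVec,
        biquadraticRot_isoclinic_mulVec, Pi.add_apply, Pi.smul_apply, smul_eq_mul, cond_true,
        cond_false]
      ring
    rw [this]
    split_ifs <;> simp_all
  have hQf := hNf.mul hMf
  refine isCovariant_biquadratic.eq_range_of_invariant biquadraticBase
    exists_biquadraticCovariant_eq hQf.1 (fun A => ?_) hQf.2 hU hle hne
  generalize biquadraticCovariant A = x
  refine ⟨(x ((0, 0), (1, 1)) + x ((1, 1), (2, 2)) + x ((2, 2), (0, 0)) - x ((1, 1), (0, 0)) -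
    x ((2, 2), (1, 1)) - x ((0, 0), (2, 2))) / 6, ?_⟩
  rw [← mulVec_mulVec, hN]
  simp only [← mulVec_mulVec, add_mulVec, smul_mulVec, one_mulVec, biquadraticRot_swap_mulVec,
    biquadraticRot_cycle_mulVec]
  ext ⟨⟨j, k⟩, ⟨l, m⟩⟩
  simp only [Pi.add_apply, Pi.smul_apply, smul_eq_mul, hMx]
  fin_cases j <;> fin_cases k <;> fin_cases l <;> fin_cases m <;>
    simp [biquadraticBase, cyclicSign] <;> ring

theorem range_ne_bot_of_finrank_pos {V : Submodule ℝ (tracelessSymMat 4 → ℝ)}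
    (h : 0 < Module.finrank ℝ V) : V ≠ ⊥ := by
  rintro rfl
  simp at h

theorem isIrrep_cubic (b : Bool) :
    IsIrrepOfHighestWeight (isCovariant_cubic b).subrep.toRepresentation
      (3, bif b then 3 else -3) where
  finite := finite_cubic b
  continuous := (isCovariant_cubic b).continuous_matrixCoeff
  irreducible := (isCovariant_cubic b).isIrreducible
    (range_ne_bot_of_finrank_pos (by rw [show Module.finrank ℝ
      (LinearMap.range (pairing (cubicCovariant b))) = 7 from finrank_cubic b]; norm_num))
    fun _ => cubic_invariant_eq b
  highestWeight := hasHighestWeight_cubic b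

theorem isIrrep_biquadratic :
    IsIrrepOfHighestWeight isCovariant_biquadratic.subrep.toRepresentation (4, 0) where
  finite := finite_biquadratic
  continuous := isCovariant_biquadratic.continuous_matrixCoeff
  irreducible := isCovariant_biquadratic.isIrreducible
    (range_ne_bot_of_finrank_pos (by rw [show Module.finrank ℝ
      (LinearMap.range (pairing biquadraticCovariant)) = 25 from finrank_biquadratic]; norm_num))
    fun _ => biquadratic_invariant_eq
  highestWeight := hasHighestWeight_biquadratic

end Irreducibility

/-! ### The minors spanning the image of `𝓣⋆` -/

/-- The determinant of the values of the linear forms `B ↦ u_j · moment B v_j` on the first three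
powers of `A`. -/
def wedgeMinor (u v : Fin 3 → Fin 3 → ℝ) (A : Matrix (Fin 4) (Fin 4) ℝ) : ℝ :=
  det (Matrix.of fun i j : Fin 3 => u j ⬝ᵥ (moment (A ^ ((i : ℕ) + 1)) *ᵥ v j))

theorem moment_one : moment 1 = 0 := by
  rw [← diagonal_one, moment_diagonal]
  ext i j
  fin_cases i <;> fin_cases j <;> simp [momentEntries]

theorem moment_powMap (k : ℕ) (A : tracelessSymMat 4) :
    moment (powMap 4 k A : Matrix (Fin 4) (Fin 4) ℝ) =
      moment ((A : Matrix (Fin 4) (Fin 4) ℝ) ^ k) := by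
  simp only [powMap, map_sub, map_smul, moment_one, smul_zero, sub_zero]

/-- The basis of the trace zero symmetric matrices dual to the entries of `moment`. -/
def momentFrame (r : Fin 3 × Fin 3) : tracelessSymMat 4 :=
  ⟨(1 / 4 : ℝ) • (isoclinic true r.1 * isoclinic false r.2), by
    refine mem_tracelessSymMat.2 ⟨?_, ?_⟩
    · have h := isoclinic_commute true r.1 r.2
      rw [Bool.not_true] at h
      rw [Matrix.IsSymm, transpose_smul, transpose_mul, isoclinic_transpose, isoclinic_transpose,
        neg_mul_neg, h]
    · have h := congrFun (congrFun moment_one r.1) r.2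
      rw [moment_apply, one_mul] at h
      rw [trace_smul, h]
      simp⟩

theorem eq_sum_momentFrame (A : tracelessSymMat 4) :
    A = ∑ r : Fin 3 × Fin 3,
      moment (A : Matrix (Fin 4) (Fin 4) ℝ) r.1 r.2 • momentFrame r := by
  apply Subtype.ext
  have h := mem_tracelessSymMat.1 A.2
  rw [Submodule.coe_sum]
  exact eq_sum_moment h.1 h.2

/-- Expansion of an alternating form in the minors of the coordinate matrix. Summing over all index
families rather than increasing ones counts every minor `n!` times. -/
theorem alternating_eq_sum_det {V ι : Type*} [AddCommGroup V] [Module ℝ V] [Fintype ι]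
    {n : ℕ} (φ : V [⋀^Fin n]→ₗ[ℝ] ℝ) (e : ι → V) (c : Fin n → ι → ℝ) :
    (n.factorial : ℝ) * φ (fun i => ∑ a, c i a • e a) =
      ∑ r : Fin n → ι, det (Matrix.of fun i j => c i (r j)) * φ (e ∘ r) := by
  classical
  have h1 : φ (fun i => ∑ a, c i a • e a) = ∑ r : Fin n → ι, (∏ i, c i (r i)) * φ (e ∘ r) := by
    have := φ.toMultilinearMap.map_sum (fun i a => c i a • e a)
    refine this.trans (Finset.sum_congr rfl fun r _ => ?_)
    exact φ.toMultilinearMap.map_smul_univ (fun i => c i (r i)) (fun i => e (r i))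
  have h2 : ∀ σ : Equiv.Perm (Fin n), ∑ r : Fin n → ι,
      ((Equiv.Perm.sign σ : ℤ) : ℝ) * (∏ i, c (σ i) (r i)) * φ (e ∘ r) =
      φ (fun i => ∑ a, c i a • e a) := by
    intro σ
    rw [h1]
    refine Fintype.sum_equiv (Equiv.arrowCongr σ (Equiv.refl ι)) _ _ fun r => ?_
    have hr : e ∘ r = (e ∘ (Equiv.arrowCongr σ (Equiv.refl ι)) r) ∘ σ := by
      ext i; simp [Equiv.arrowCongr]
    have hp : ∏ i, c i ((Equiv.arrowCongr σ (Equiv.refl ι)) r i) = ∏ i, c (σ i) (r i) := by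
      rw [← Equiv.prod_comp σ]
      simp [Equiv.arrowCongr]
    rw [hp, hr, φ.map_perm, Units.smul_def, zsmul_eq_mul]
    have : (((Equiv.Perm.sign σ : ℤˣ) : ℤ) : ℝ) * ((Equiv.Perm.sign σ : ℤ) : ℝ) = 1 := by
      rw [← Int.cast_mul, ← Units.val_mul, Int.units_mul_self]; simp
    linear_combination ((∏ i, c (σ i) (r i)) *
      φ (e ∘ (Equiv.arrowCongr σ (Equiv.refl ι)) r)) * this
  simp only [det_apply, Finset.sum_mul]
  rw [Finset.sum_comm]
  simp only [Units.smul_def, zsmul_eq_mul, Matrix.of_apply, h2]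
  simp [Fintype.card_perm]

theorem dualWedgeMap_eq_sum (ξ : Module.Dual ℝ (⋀[ℝ]^(4 - 1) (tracelessSymMat 4)))
    (A : tracelessSymMat 4) :
    dualWedgeMap 4 ξ A = (1 / 6) * ∑ r : Fin 3 → Fin 3 × Fin 3,
      wedgeMinor (fun i => Pi.single (r i).1 1) (fun i => Pi.single (r i).2 1) A *
        ξ (exteriorPower.ιMulti ℝ 3 (momentFrame ∘ r)) := by
  have h := alternating_eq_sum_det (n := 3) (ξ.compAlternatingMap (exteriorPower.ιMulti ℝ 3))
    momentFrame
    (fun i a => moment (powMap 4 ((i : ℕ) + 1) A : Matrix (Fin 4) (Fin 4) ℝ) a.1 a.2)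
  simp only [← eq_sum_momentFrame, LinearMap.compAlternatingMap_apply] at h
  have h' : dualWedgeMap 4 ξ A =
    ξ (exteriorPower.ιMulti ℝ 3 fun i : Fin 3 => powMap 4 ((i : ℕ) + 1) A) := rfl
  rw [h']
  have e : ∀ r : Fin 3 → Fin 3 × Fin 3,
      wedgeMinor (fun i => Pi.single (r i).1 1) (fun i => Pi.single (r i).2 1) A =
      det (Matrix.of fun i j : Fin 3 =>
        moment (powMap 4 ((i : ℕ) + 1) A : Matrix (Fin 4) (Fin 4) ℝ) (r j).1 (r j).2) := by
    intro r
    simp [wedgeMinor, moment_powMap]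
  simp only [e, ← h, Nat.factorial]
  generalize ξ (exteriorPower.ιMulti ℝ 3 fun i : Fin 3 => powMap 4 ((i : ℕ) + 1) A) = y
  push_cast
  ring

theorem wedgeMinor_mem_range (u v : Fin 3 → Fin 3 → ℝ) :
    (fun A : tracelessSymMat 4 => wedgeMinor u v A) ∈ LinearMap.range (dualWedgeMap 4) := by
  let L : tracelessSymMat 4 →ₗ[ℝ] (Fin 3 → ℝ) :=
    { toFun := fun A j => u j ⬝ᵥ (moment (A : Matrix (Fin 4) (Fin 4) ℝ) *ᵥ v j)
      map_add' := fun A B => by ext j; simp [add_mulVec]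
      map_smul' := fun c A => by ext j; simp [smul_mulVec] }
  refine ⟨exteriorPower.alternatingMapLinearEquiv
    ((Matrix.detRowAlternating (n := Fin 3) (R := ℝ)).compLinearMap L), ?_⟩
  ext A
  have : dualWedgeMap 4 (exteriorPower.alternatingMapLinearEquiv
      ((Matrix.detRowAlternating (n := Fin 3) (R := ℝ)).compLinearMap L)) A =
      exteriorPower.alternatingMapLinearEquiv
      ((Matrix.detRowAlternating (n := Fin 3) (R := ℝ)).compLinearMap L)
      (exteriorPower.ιMulti ℝ 3 fun i : Fin 3 => powMap 4 ((i : ℕ) + 1) A) := rfl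
  rw [this, exteriorPower.alternatingMapLinearEquiv_apply_ιMulti]
  simp only [wedgeMinor, ← moment_powMap]
  rfl

/-- The minors `wedgeMinor u v` span the image of `𝓣⋆`. -/
theorem range_dualWedgeMap_le {P : Submodule ℝ (tracelessSymMat 4 → ℝ)}
    (h : ∀ u v : Fin 3 → Fin 3 → ℝ, (fun A : tracelessSymMat 4 => wedgeMinor u v A) ∈ P) :
    LinearMap.range (dualWedgeMap 4) ≤ P := by
  rintro _ ⟨ξ, rfl⟩
  have : dualWedgeMap 4 ξ = ∑ r : Fin 3 → Fin 3 × Fin 3,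
      (1 / 6 * ξ (exteriorPower.ιMulti ℝ 3 (momentFrame ∘ r))) • fun A : tracelessSymMat 4 =>
        wedgeMinor (fun i => Pi.single (r i).1 1) (fun i => Pi.single (r i).2 1) A := by
    ext A
    rw [dualWedgeMap_eq_sum, Finset.sum_apply, Finset.mul_sum]
    refine Finset.sum_congr rfl fun r _ => ?_
    rw [Pi.smul_apply, smul_eq_mul]
    generalize ξ (exteriorPower.ιMulti ℝ 3 (momentFrame ∘ r)) = y
    ring
  rw [this]
  exact Submodule.sum_mem _ fun r _ => Submodule.smul_mem _ _ (h _ _)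

theorem conj_pow (g : SO 4) (A : Matrix (Fin 4) (Fin 4) ℝ) (k : ℕ) :
    ((g : Matrix (Fin 4) (Fin 4) ℝ) * A * (g : Matrix (Fin 4) (Fin 4) ℝ)ᵀ) ^ k =
      (g : Matrix (Fin 4) (Fin 4) ℝ) * A ^ k * (g : Matrix (Fin 4) (Fin 4) ℝ)ᵀ := by
  induction k with
  | zero => simp [SO_mul_transpose]
  | succ k ih =>
    rw [pow_succ, ih, pow_succ]
    calc _ = (g : Matrix (Fin 4) (Fin 4) ℝ) * A ^ k * ((g : Matrix (Fin 4) (Fin 4) ℝ)ᵀ *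
          (g : Matrix (Fin 4) (Fin 4) ℝ)) * A * (g : Matrix (Fin 4) (Fin 4) ℝ)ᵀ := by
            simp only [mul_assoc]
      _ = _ := by rw [SO_transpose_mul, mul_one]; simp only [mul_assoc]

theorem wedgeMinor_conj (u v : Fin 3 → Fin 3 → ℝ) (g : SO 4) (A : Matrix (Fin 4) (Fin 4) ℝ) :
    wedgeMinor u v ((g : Matrix (Fin 4) (Fin 4) ℝ) * A * (g : Matrix (Fin 4) (Fin 4) ℝ)ᵀ) =
      wedgeMinor (fun i => (rot true g)ᵀ *ᵥ u i) (fun i => (rot false g)ᵀ *ᵥ v i) A := by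
  simp only [wedgeMinor, conj_pow, moment_conj]
  congr 1
  ext i j
  simp only [Matrix.of_apply, ← mulVec_mulVec, Matrix.mulVec_transpose (rot true g),
    Matrix.dotProduct_mulVec]

theorem funAction_wedgeMinor (u v : Fin 3 → Fin 3 → ℝ) (g : SO 4) :
    funAction 4 g (fun A : tracelessSymMat 4 => wedgeMinor u v A) =
      fun A : tracelessSymMat 4 =>
        wedgeMinor (fun i => rot true g *ᵥ u i) (fun i => rot false g *ᵥ v i) A := by
  ext A
  change wedgeMinor u v (conjAction 4 g⁻¹ A : tracelessSymMat 4) = _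
  rw [coe_conjAction, wedgeMinor_conj]
  simp only [rot_inv, transpose_transpose]

theorem funAction_mem_range {g : SO 4} {f : tracelessSymMat 4 → ℝ}
    (hf : f ∈ LinearMap.range (dualWedgeMap 4)) :
    funAction 4 g f ∈ LinearMap.range (dualWedgeMap 4) := by
  have h : LinearMap.range (dualWedgeMap 4) ≤
      (LinearMap.range (dualWedgeMap 4)).comap (funAction 4 g) := by
    refine range_dualWedgeMap_le fun u v => ?_
    rw [Submodule.mem_comap, funAction_wedgeMinor]
    exact wedgeMinor_mem_range _ _
  exact Submodule.mem_comap.1 (h hf)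

/-- For diagonal `A` the matrix of `wedgeMinor` is a product of the matrix with rows `momentEntries
(d ^ (i + 1))`, whose determinant is a Vandermonde product, and the matrix of the entrywise products
`u_j * v_j`. -/
theorem wedgeMinor_diagonal (u v : Fin 3 → Fin 3 → ℝ) (d : Fin 4 → ℝ) :
    wedgeMinor u v (diagonal d) = -(1 / 16) * vandermonde3 (fun i => momentEntries d i ^ 2) *
      tripleProduct (u 0 * v 0) (u 1 * v 1) (u 2 * v 2) := by
  have h : (Matrix.of fun i j : Fin 3 =>
      u j ⬝ᵥ (moment (diagonal d ^ ((i : ℕ) + 1)) *ᵥ v j)) =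
      (Matrix.of fun i k : Fin 3 => momentEntries (fun l => d l ^ ((i : ℕ) + 1)) k) *
        (Matrix.of ![u 0 * v 0, u 1 * v 1, u 2 * v 2])ᵀ := by
    ext i j
    simp only [diagonal_pow, moment_diagonal, mulVec_diagonal, Matrix.mul_apply, dotProduct,
      Matrix.of_apply, transpose_apply]
    refine Finset.sum_congr rfl fun k _ => ?_
    have : (![u 0 * v 0, u 1 * v 1, u 2 * v 2] j) k = u j k * v j k := by
      fin_cases j <;> rfl
    rw [this]
    simp only [Pi.pow_def]
    ring
  rw [wedgeMinor, h, det_mul, det_transpose, tripleProduct]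
  congr 1
  simp [det_fin_three, momentEntries, vandermonde3]
  ring

/-! ### Decomposition of the minors -/

/-- The triple product of `u` with `X` applied to its entry `c`, as a linear form in `X`. -/
def insertion (u : Fin 3 → Fin 3 → ℝ) (c : Fin 3) : Matrix (Fin 3) (Fin 3) ℝ →ₗ[ℝ] ℝ where
  toFun X := ![tripleProduct (X *ᵥ u 0) (u 1) (u 2), tripleProduct (u 0) (X *ᵥ u 1) (u 2),
    tripleProduct (u 0) (u 1) (X *ᵥ u 2)] c
  map_add' X Y := by
    fin_cases c <;> simp [add_mulVec, tripleProduct_eq] <;> ring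
  map_smul' a X := by
    fin_cases c <;> simp [smul_mulVec, tripleProduct_eq] <;> ring

theorem insertion_apply (u : Fin 3 → Fin 3 → ℝ) (c : Fin 3) (X : Matrix (Fin 3) (Fin 3) ℝ) :
    insertion u c X = ![tripleProduct (X *ᵥ u 0) (u 1) (u 2),
      tripleProduct (u 0) (X *ᵥ u 1) (u 2), tripleProduct (u 0) (u 1) (X *ᵥ u 2)] c := rfl

theorem insertion_conj {P : Matrix (Fin 3) (Fin 3) ℝ} (hP' : P * Pᵀ = 1) (hd : P.det = 1)
    (u : Fin 3 → Fin 3 → ℝ) (c : Fin 3) (X : Matrix (Fin 3) (Fin 3) ℝ) :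
    insertion u c (P * X * Pᵀ) = insertion (fun i => Pᵀ *ᵥ u i) c X := by
  have h : ∀ x y z : Fin 3 → ℝ, tripleProduct (Pᵀ *ᵥ x) (Pᵀ *ᵥ y) (Pᵀ *ᵥ z) =
      tripleProduct x y z := fun x y z => by
    rw [tripleProduct_mulVec, det_transpose, hd, one_mul]
  have h' : ∀ x, X *ᵥ (Pᵀ *ᵥ x) = Pᵀ *ᵥ ((P * X * Pᵀ) *ᵥ x) := fun x => by
    have hP : Pᵀ * P = 1 := mul_eq_one_comm.1 hP'
    rw [mulVec_mulVec, mulVec_mulVec, ← mul_assoc, ← mul_assoc, hP, one_mul]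
  simp only [insertion_apply, h', h]

/-- A coefficient of `biquadraticTensor S S'`, with `insertion u c` applied to the first factor and
`insertion v c'` to the second. -/
def insertionCommutator (u v : Fin 3 → Fin 3 → ℝ) (S S' : Matrix (Fin 3) (Fin 3) ℝ)
    (c c' : Fin 3) : ℝ :=
  insertion u c (traceFree S) * insertion v c' (traceFree (S' * S')) -
    insertion u c (traceFree (S * S)) * insertion v c' (traceFree S')

/-- The sum of `insertionCommutator` over the pairs of distinct positions, with the sign of the
cyclic order. -/
def cyclicInsertion (u v : Fin 3 → Fin 3 → ℝ) (S S' : Matrix (Fin 3) (Fin 3) ℝ) : ℝ :=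
  (insertionCommutator u v S S' 0 1 - insertionCommutator u v S S' 1 0) +
  (insertionCommutator u v S S' 1 2 - insertionCommutator u v S S' 2 1) +
  (insertionCommutator u v S S' 2 0 - insertionCommutator u v S S' 0 2)

/-- Every permutation contributes its signed product of entries of `u`, weighted by the entry of `s`
in the column that it assigns to row `c`. -/
theorem insertion_diagonal (u : Fin 3 → Fin 3 → ℝ) (c : Fin 3) (s : Fin 3 → ℝ) :
    insertion u c (diagonal s) =
      s (![0, 1, 2] c) * (u 0 0 * u 1 1 * u 2 2) - s (![0, 2, 1] c) * (u 0 0 * u 1 2 * u 2 1)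
      - s (![1, 0, 2] c) * (u 0 1 * u 1 0 * u 2 2) + s (![1, 2, 0] c) * (u 0 1 * u 1 2 * u 2 0)
      + s (![2, 0, 1] c) * (u 0 2 * u 1 0 * u 2 1)
      - s (![2, 1, 0] c) * (u 0 2 * u 1 1 * u 2 0) := by
  simp only [insertion_apply, mulVec_diagonal, tripleProduct_eq]
  fin_cases c <;> simp <;> ring

theorem traceFree_diagonal (s : Fin 3 → ℝ) :
    traceFree (diagonal s) = diagonal fun i => s i - (s 0 + s 1 + s 2) / 3 := by
  ext i j
  rcases eq_or_ne i j with rfl | h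
  · simp [traceFree, Fin.sum_univ_three]
  · simp [traceFree, h]

/-- The determinant of the entrywise product of two `3 × 3` matrices is expressed by `det · perm`,
`perm · det` and a correction that, after multiplication by the Vandermonde product of `s`, is a
biquadratic coefficient. Both sides are bilinear in the six products over permutations of entries of
`u` and of `v`, with coefficients depending on `s`. -/
theorem hadamard_identity (u v : Fin 3 → Fin 3 → ℝ) (s : Fin 3 → ℝ) :
    3 * (vandermonde3 s * tripleProduct (u 0 * v 0) (u 1 * v 1) (u 2 * v 2)) =
      1 / 2 * (cubicForm (diagonal s) (u 0) (u 1) (u 2) * tripleProduct (v 0) (v 1) (v 2) +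
        tripleProduct (u 0) (u 1) (u 2) * cubicForm (diagonal s) (v 0) (v 1) (v 2)) +
      cyclicInsertion u v (diagonal s) (diagonal s) := by
  simp only [cubicForm_diagonal, cyclicInsertion, insertionCommutator, diagonal_mul_diagonal,
    traceFree_diagonal, insertion_diagonal, permanent3, tripleProduct_eq, Pi.mul_apply,
    vandermonde3]
  simp
  have e : ∀ a b c x y z : ℝ, a * x * (b * y) * (c * z) = a * b * c * (x * y * z) := by
    intros; ring
  simp only [e]
  generalize u 0 0 * u 1 1 * u 2 2 = a1
  generalize u 0 0 * u 1 2 * u 2 1 = a2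
  generalize u 0 1 * u 1 0 * u 2 2 = a3
  generalize u 0 1 * u 1 2 * u 2 0 = a4
  generalize u 0 2 * u 1 0 * u 2 1 = a5
  generalize u 0 2 * u 1 1 * u 2 0 = a6
  generalize v 0 0 * v 1 1 * v 2 2 = b1
  generalize v 0 0 * v 1 2 * v 2 1 = b2
  generalize v 0 1 * v 1 0 * v 2 2 = b3
  generalize v 0 1 * v 1 2 * v 2 0 = b4
  generalize v 0 2 * v 1 0 * v 2 1 = b5
  generalize v 0 2 * v 1 1 * v 2 0 = b6
  ring

theorem insertionCommutator_conj {P P' : Matrix (Fin 3) (Fin 3) ℝ} (hP : P * Pᵀ = 1)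
    (hd : P.det = 1) (hP' : P' * P'ᵀ = 1) (hd' : P'.det = 1) (u v : Fin 3 → Fin 3 → ℝ)
    (S S' : Matrix (Fin 3) (Fin 3) ℝ) (c c' : Fin 3) :
    insertionCommutator u v (P * S * Pᵀ) (P' * S' * P'ᵀ) c c' =
      insertionCommutator (fun i => Pᵀ *ᵥ u i) (fun i => P'ᵀ *ᵥ v i) S S' c c' := by
  have h2 : ∀ {P : Matrix (Fin 3) (Fin 3) ℝ} (_ : P * Pᵀ = 1) (S : Matrix (Fin 3) (Fin 3) ℝ),
      P * S * Pᵀ * (P * S * Pᵀ) = P * (S * S) * Pᵀ := by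
    intro P hP S
    calc _ = P * S * (Pᵀ * P) * S * Pᵀ := by simp only [mul_assoc]
      _ = _ := by rw [mul_eq_one_comm.1 hP, mul_one]; simp only [mul_assoc]
  simp only [insertionCommutator, h2 hP, h2 hP', traceFree_conj (mul_eq_one_comm.1 hP) hP,
    traceFree_conj (mul_eq_one_comm.1 hP') hP', insertion_conj hP hd, insertion_conj hP' hd']

/-- `insertionCommutator u v` is a coefficient of the biquadratic tensor. -/
theorem insertionCommutator_eq_sum (u v : Fin 3 → Fin 3 → ℝ) (S S' : Matrix (Fin 3) (Fin 3) ℝ)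
    (c c' : Fin 3) : insertionCommutator u v S S' c c' =
      (fun r : (Fin 3 × Fin 3) × (Fin 3 × Fin 3) =>
        insertion u c (Matrix.single r.1.1 r.1.2 1) *
          insertion v c' (Matrix.single r.2.1 r.2.2 1)) ⬝ᵥ biquadraticTensor S S' := by
  have h : ∀ (u : Fin 3 → Fin 3 → ℝ) (c : Fin 3) (X : Matrix (Fin 3) (Fin 3) ℝ),
      insertion u c X = ∑ r : Fin 3 × Fin 3, insertion u c (Matrix.single r.1 r.2 1) *
        X r.1 r.2 := by
    intro u c X
    conv_lhs => rw [matrix_eq_sum_single X]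
    simp only [map_sum, Fintype.sum_prod_type]
    refine Finset.sum_congr rfl fun i _ => Finset.sum_congr rfl fun j _ => ?_
    rw [← mul_one (X i j), ← smul_eq_mul (X i j), ← Matrix.smul_single, map_smul, smul_eq_mul,
      smul_eq_mul]
    ring
  rw [insertionCommutator, h u c, h v c', h u c (traceFree (S * S)), h v c' (traceFree S'),
    Finset.sum_mul_sum, Finset.sum_mul_sum]
  simp only [dotProduct, biquadraticTensor, Fintype.sum_prod_type (f := fun r :
    (Fin 3 × Fin 3) × (Fin 3 × Fin 3) => _), mul_sub, Finset.sum_sub_distrib]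
  congr 1 <;>
  · refine Finset.sum_congr rfl fun i _ => Finset.sum_congr rfl fun j _ => ?_
    ring

/-- The decomposition of the minors into two cubic coefficients and a biquadratic one. Both sides
transform alike under rotations, so it is enough to check it for diagonal matrices. -/
theorem wedgeMinor_eq (u v : Fin 3 → Fin 3 → ℝ) (A : tracelessSymMat 4) :
    3 * wedgeMinor u v A = -(1 / 16) * (1 / 2 *
      (cubicForm (gram true A) (u 0) (u 1) (u 2) * tripleProduct (v 0) (v 1) (v 2) +
        tripleProduct (u 0) (u 1) (u 2) * cubicForm (gram false A) (v 0) (v 1) (v 2)) +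
      cyclicInsertion u v (gram true A) (gram false A)) := by
  obtain ⟨g, d, h⟩ := exists_SO_diagonal (mem_tracelessSymMat.1 A.2).1
  have ht : ∀ b x y z, tripleProduct x y z =
      tripleProduct ((rot b g)ᵀ *ᵥ x) ((rot b g)ᵀ *ᵥ y) ((rot b g)ᵀ *ᵥ z) := fun b x y z => by
    rw [tripleProduct_mulVec, det_transpose, det_rot, one_mul]
  rw [h, wedgeMinor_conj, gram_conj, gram_conj, gram_diagonal, gram_diagonal,
    cubicForm_conj (rot_transpose_mul true g) (rot_mul_transpose true g) (det_rot true g),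
    cubicForm_conj (rot_transpose_mul false g) (rot_mul_transpose false g) (det_rot false g),
    ht true (u 0), ht false (v 0), wedgeMinor_diagonal]
  simp only [cyclicInsertion, insertionCommutator_conj (rot_mul_transpose true g) (det_rot true g)
    (rot_mul_transpose false g) (det_rot false g)]
  have := hadamard_identity (fun i => (rot true g)ᵀ *ᵥ u i) (fun i => (rot false g)ᵀ *ᵥ v i)
    (fun i => momentEntries d i ^ 2)
  simp only [cyclicInsertion] at this
  linear_combination (-(1 / 16)) * this

theorem cubicForm_mem_range (b : Bool) (u v w : Fin 3 → ℝ) :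
    (fun A : tracelessSymMat 4 => cubicForm (gram b A) u v w) ∈
      LinearMap.range (pairing (cubicCovariant b)) :=
  ⟨fun r => u r.1 * (v r.2.1 * w r.2.2), funext fun _ => (cubicForm_eq_sum _ _ _ _).symm⟩

theorem cyclicInsertion_mem_range (u v : Fin 3 → Fin 3 → ℝ) :
    (fun A : tracelessSymMat 4 => cyclicInsertion u v (gram true A) (gram false A)) ∈
      LinearMap.range (pairing biquadraticCovariant) := by
  have h : ∀ c c', (fun A : tracelessSymMat 4 =>
      insertionCommutator u v (gram true A) (gram false A) c c') ∈
      LinearMap.range (pairing biquadraticCovariant) := fun c c' =>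
    ⟨fun r => insertion u c (Matrix.single r.1.1 r.1.2 1) *
      insertion v c' (Matrix.single r.2.1 r.2.2 1),
      funext fun _ => (insertionCommutator_eq_sum u v _ _ c c').symm⟩
  exact add_mem (add_mem (sub_mem (h 0 1) (h 1 0)) (sub_mem (h 1 2) (h 2 1)))
    (sub_mem (h 2 0) (h 0 2))

/-! ### The image of `𝓣⋆` as a sum of the three modules -/

/-- The space of coefficient functions of `cubicCovariant b`. -/
def cubicRange (b : Bool) : Submodule ℝ (tracelessSymMat 4 → ℝ) :=
  LinearMap.range (pairing (cubicCovariant b))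

/-- The space of coefficient functions of `biquadraticCovariant`. -/
def biquadraticRange : Submodule ℝ (tracelessSymMat 4 → ℝ) :=
  LinearMap.range (pairing biquadraticCovariant)

theorem range_dualWedgeMap_le_sup :
    LinearMap.range (dualWedgeMap 4) ≤ cubicRange true ⊔ cubicRange false ⊔ biquadraticRange := by
  refine range_dualWedgeMap_le fun u v => ?_
  have h : (fun A : tracelessSymMat 4 => wedgeMinor u v A) =
      (-(1 / 96) * tripleProduct (v 0) (v 1) (v 2)) • (fun A : tracelessSymMat 4 =>
        cubicForm (gram true A) (u 0) (u 1) (u 2)) +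
      (-(1 / 96) * tripleProduct (u 0) (u 1) (u 2)) • (fun A : tracelessSymMat 4 =>
        cubicForm (gram false A) (v 0) (v 1) (v 2)) +
      (-(1 / 48 : ℝ)) • (fun A : tracelessSymMat 4 =>
        cyclicInsertion u v (gram true A) (gram false A)) := by
    ext A
    simp only [Pi.add_apply, Pi.smul_apply, smul_eq_mul]
    linear_combination (1 / 3) * wedgeMinor_eq u v A
  rw [h]
  exact Submodule.add_mem_sup (Submodule.add_mem_sup
    (Submodule.smul_mem _ _ (cubicForm_mem_range true _ _ _))
    (Submodule.smul_mem _ _ (cubicForm_mem_range false _ _ _)))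
    (Submodule.smul_mem _ _ (cyclicInsertion_mem_range u v))

/-- A diagonal trace zero matrix with distinct eigenvalues. -/
def regularDiagonal : tracelessSymMat 4 :=
  ⟨diagonal ![0, 1, 2, -3], mem_tracelessSymMat.2 ⟨isSymm_diagonal _, by
    simp [Matrix.trace, Fin.sum_univ_four]; norm_num⟩⟩

theorem coe_regularDiagonal :
    (regularDiagonal : Matrix (Fin 4) (Fin 4) ℝ) = diagonal ![0, 1, 2, -3] := rfl

/-- For a choice of `u` and `v` with vanishing triple products the minor is purely biquadratic and
nonzero, so irreducibility applies. -/
theorem biquadraticRange_le : biquadraticRange ≤ LinearMap.range (dualWedgeMap 4) := by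
  set u : Fin 3 → Fin 3 → ℝ := ![![1, 1, 1], ![1, 0, 0], ![1, 1, 1]] with hu
  set v : Fin 3 → Fin 3 → ℝ := ![![1, 1, 1], ![1, 1, 1], ![0, 1, 0]] with hv
  -- both triples are linearly dependent, while their entrywise products are independent
  have hu0 : tripleProduct (u 0) (u 1) (u 2) = 0 := by simp [tripleProduct_eq, hu]
  have hv0 : tripleProduct (v 0) (v 1) (v 2) = 0 := by simp [tripleProduct_eq, hv]
  have hmem : (fun A : tracelessSymMat 4 => wedgeMinor u v A) ∈ biquadraticRange := by
    have h : (fun A : tracelessSymMat 4 => wedgeMinor u v A) = (-(1 / 48 : ℝ)) •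
        (fun A : tracelessSymMat 4 => cyclicInsertion u v (gram true A) (gram false A)) := by
      ext A
      have := wedgeMinor_eq u v A
      rw [hu0, hv0] at this
      simp only [Pi.smul_apply, smul_eq_mul]
      linear_combination (1 / 3) * this
    rw [h]
    exact Submodule.smul_mem _ _ (cyclicInsertion_mem_range u v)
  have hinv : ∀ g, ∀ f ∈ LinearMap.range (dualWedgeMap 4) ⊓ biquadraticRange,
      funAction 4 g f ∈ LinearMap.range (dualWedgeMap 4) ⊓ biquadraticRange := fun g f hf =>
    ⟨funAction_mem_range hf.1, isCovariant_biquadratic.subrep.apply_mem_toSubmodule g hf.2⟩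
  have h := biquadratic_invariant_eq hinv inf_le_right
    ((Submodule.ne_bot_iff _).2 ⟨_, ⟨wedgeMinor_mem_range u v, hmem⟩, fun h0 => by
      have := congrFun h0 regularDiagonal
      rw [coe_regularDiagonal, wedgeMinor_diagonal] at this
      simp [hu, hv, tripleProduct_eq, vandermonde3, momentEntries] at this
      norm_num at this⟩)
  exact inf_eq_right.1 h

/-- With all entries of one triple equal to `(1, 1, 1)` and the other triple the standard basis, the
minor is a cubic coefficient modulo biquadratic ones. -/
theorem cubicRange_le (b : Bool) : cubicRange b ≤ LinearMap.range (dualWedgeMap 4) := by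
  set x : Fin 3 → ℝ := 1 with hx
  have hinv : ∀ g, ∀ f ∈ LinearMap.range (dualWedgeMap 4) ⊓ cubicRange b,
      funAction 4 g f ∈ LinearMap.range (dualWedgeMap 4) ⊓ cubicRange b := fun g f hf =>
    ⟨funAction_mem_range hf.1, (isCovariant_cubic b).subrep.apply_mem_toSubmodule g hf.2⟩
  have hmem : (fun A : tracelessSymMat 4 => cubicForm (gram b A) x x x) ∈
      LinearMap.range (dualWedgeMap 4) := by
    let w : Fin 3 → Fin 3 → ℝ := fun _ => x
    let e : Fin 3 → Fin 3 → ℝ := fun i => Pi.single i 1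
    have he : tripleProduct (e 0) (e 1) (e 2) = 1 := by simp [tripleProduct_eq, e]
    have hw : tripleProduct (w 0) (w 1) (w 2) = 0 := by simp [tripleProduct_eq, w, hx]
    cases b
    · have h : (fun A : tracelessSymMat 4 => cubicForm (gram false A) x x x) =
          (-96 : ℝ) • (fun A : tracelessSymMat 4 => wedgeMinor e w A) +
          (-2 : ℝ) • (fun A : tracelessSymMat 4 =>
            cyclicInsertion e w (gram true A) (gram false A)) := by
        ext A
        have := wedgeMinor_eq e w A
        rw [he, hw] at this
        simp only [Pi.add_apply, Pi.smul_apply, smul_eq_mul]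
        linear_combination 32 * this
      rw [h]
      exact add_mem (Submodule.smul_mem _ _ (wedgeMinor_mem_range e w))
        (Submodule.smul_mem _ _ (biquadraticRange_le (cyclicInsertion_mem_range e w)))
    · have h : (fun A : tracelessSymMat 4 => cubicForm (gram true A) x x x) =
          (-96 : ℝ) • (fun A : tracelessSymMat 4 => wedgeMinor w e A) +
          (-2 : ℝ) • (fun A : tracelessSymMat 4 =>
            cyclicInsertion w e (gram true A) (gram false A)) := by
        ext A
        have := wedgeMinor_eq w e A
        rw [he, hw] at this
        simp only [Pi.add_apply, Pi.smul_apply, smul_eq_mul]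
        linear_combination 32 * this
      rw [h]
      exact add_mem (Submodule.smul_mem _ _ (wedgeMinor_mem_range w e))
        (Submodule.smul_mem _ _ (biquadraticRange_le (cyclicInsertion_mem_range w e)))
  have h := cubic_invariant_eq b hinv inf_le_right
    ((Submodule.ne_bot_iff _).2 ⟨_, ⟨hmem, cubicForm_mem_range b x x x⟩, fun h0 => by
      have := congrFun h0 regularDiagonal
      simp only [coe_regularDiagonal, gram_diagonal, cubicForm_diagonal] at this
      simp [hx, permanent3, vandermonde3, momentEntries] at this
      norm_num at this⟩)
  exact inf_eq_right.1 h

theorem range_dualWedgeMap_eq_sup :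
    LinearMap.range (dualWedgeMap 4) = cubicRange true ⊔ cubicRange false ⊔ biquadraticRange :=
  le_antisymm range_dualWedgeMap_le_sup
    (sup_le (sup_le (cubicRange_le true) (cubicRange_le false)) biquadraticRange_le)

/-! ### Directness of the sum -/

theorem finrank_cubicRange (b : Bool) : Module.finrank ℝ (cubicRange b) = 7 := finrank_cubic b

theorem finrank_biquadraticRange : Module.finrank ℝ biquadraticRange = 25 := finrank_biquadratic

theorem finite_cubicRange (b : Bool) : Module.Finite ℝ (cubicRange b) := finite_cubic b

theorem cubicRot_isoclinic_not (b : Bool) (i : Fin 3) : cubicRot b (isoclinicSO (!b) i) = 1 := by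
  have h := rot_isoclinic_not (!b) i
  rw [Bool.not_not] at h
  rw [cubicRot, h, one_kronecker_one, one_kronecker_one]

theorem cubicRange_ne_biquadraticRange (b : Bool) : cubicRange b ≠ biquadraticRange := fun h => by
  have := finrank_cubicRange b
  rw [h, finrank_biquadraticRange] at this
  norm_num at this

theorem cubicRange_inf_biquadraticRange (b : Bool) : cubicRange b ⊓ biquadraticRange = ⊥ := by
  by_contra hne
  have hinv : ∀ g, ∀ f ∈ cubicRange b ⊓ biquadraticRange,
      funAction 4 g f ∈ cubicRange b ⊓ biquadraticRange := fun g f hf =>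
    ⟨(isCovariant_cubic b).subrep.apply_mem_toSubmodule g hf.1,
      isCovariant_biquadratic.subrep.apply_mem_toSubmodule g hf.2⟩
  exact cubicRange_ne_biquadraticRange b
    ((cubic_invariant_eq b hinv inf_le_left hne).symm.trans
      (biquadratic_invariant_eq hinv inf_le_right hne))

/-- The half-turn `isoclinicSO b 0` acts trivially on the coefficient functions of `!b` but as `-1`
on some element `p` of `cubicRange b`. If `p` were in the sum of the other two modules, `2 p` would
be a difference of biquadratic coefficients. -/
theorem disjoint_cubicRange (b : Bool) :
    Disjoint (cubicRange b) (cubicRange (!b) ⊔ biquadraticRange) := by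
  rw [disjoint_iff]
  by_contra hne
  have hinv : ∀ g, ∀ f ∈ cubicRange b ⊓ (cubicRange (!b) ⊔ biquadraticRange),
      funAction 4 g f ∈ cubicRange b ⊓ (cubicRange (!b) ⊔ biquadraticRange) := by
    intro g f hf
    refine ⟨(isCovariant_cubic b).subrep.apply_mem_toSubmodule g hf.1, ?_⟩
    obtain ⟨y, hy, z, hz, rfl⟩ := Submodule.mem_sup.1 hf.2
    rw [map_add]
    exact Submodule.add_mem_sup
      ((isCovariant_cubic (!b)).subrep.apply_mem_toSubmodule g hy)
      (isCovariant_biquadratic.subrep.apply_mem_toSubmodule g hz)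
  have hle : cubicRange b ≤ cubicRange (!b) ⊔ biquadraticRange :=
    inf_eq_left.1 (cubic_invariant_eq b hinv inf_le_left hne)
  set p : tracelessSymMat 4 → ℝ := pairing (cubicCovariant b) (Pi.single (1, 0, 0) 1) with hp
  have hpA : ∀ A : tracelessSymMat 4, p A = cubicTensor (gram b A) (1, 0, 0) := fun A => by
    rw [hp, pairing_apply, single_one_dotProduct, cubicCovariant]
  have hpb : p ∈ cubicRange b := ⟨_, rfl⟩
  have hp0 : p ≠ 0 := fun h0 => by
    have h1 := congrFun h0 sampleMatrix
    have h2 := congrFun (cubicCoords_sampleMatrix b) 3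
    rw [hpA, cubicTensor_rotate] at h1
    simp only [cubicCoords, Matrix.cons_val] at h2
    rw [h1] at h2
    cases b <;> simp at h2
  have hneg : funAction 4 (isoclinicSO b 0) p = -p := by
    rw [hp, (isCovariant_cubic b).funAction_pairing, cubicRot_isoclinic_mulVec, ← map_neg]
    congr 1
    ext r
    by_cases hr : r = (1, 0, 0)
    · subst hr; simp [halfTurnSign]
    · simp [hr]
  obtain ⟨y, hy, z, hz, hyz⟩ := Submodule.mem_sup.1 (hle hpb)
  have hfix : funAction 4 (isoclinicSO b 0) y = y := by
    obtain ⟨e, rfl⟩ := hy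
    have h := cubicRot_isoclinic_not (!b) 0
    rw [Bool.not_not] at h
    rw [(isCovariant_cubic (!b)).funAction_pairing, h, one_mulVec]
  have hmem : p ∈ cubicRange b ⊓ biquadraticRange := by
    refine ⟨hpb, ?_⟩
    have h : p = (1 / 2 : ℝ) • (z - funAction 4 (isoclinicSO b 0) z) := by
      have h2 : funAction 4 (isoclinicSO b 0) z = -p - y := by
        rw [← hneg, ← hfix, ← map_sub, ← hyz, add_sub_cancel_left]
      have h3 : z - (-p - y) = (2 : ℝ) • p := by rw [← hyz, two_smul]; abel
      rw [h2, h3, smul_smul]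
      norm_num
    rw [h]
    exact Submodule.smul_mem _ _ (sub_mem hz
      (isCovariant_biquadratic.subrep.apply_mem_toSubmodule _ hz))
  rw [cubicRange_inf_biquadraticRange] at hmem
  exact hp0 ((Submodule.mem_bot ℝ).1 hmem)

/-- The biquadratic module is irreducible of dimension `25 > 7 + 7`. -/
theorem disjoint_biquadraticRange :
    Disjoint biquadraticRange (cubicRange true ⊔ cubicRange false) := by
  have := finite_cubicRange true
  have := finite_cubicRange false
  rw [disjoint_iff]
  by_contra hne
  have hinv : ∀ g, ∀ f ∈ biquadraticRange ⊓ (cubicRange true ⊔ cubicRange false),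
      funAction 4 g f ∈ biquadraticRange ⊓ (cubicRange true ⊔ cubicRange false) := by
    intro g f hf
    refine ⟨isCovariant_biquadratic.subrep.apply_mem_toSubmodule g hf.1, ?_⟩
    obtain ⟨y, hy, z, hz, rfl⟩ := Submodule.mem_sup.1 hf.2
    rw [map_add]
    exact Submodule.add_mem_sup ((isCovariant_cubic true).subrep.apply_mem_toSubmodule g hy)
      ((isCovariant_cubic false).subrep.apply_mem_toSubmodule g hz)
  have hle : biquadraticRange ≤ cubicRange true ⊔ cubicRange false :=
    inf_eq_left.1 (biquadratic_invariant_eq hinv inf_le_left hne)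
  have h1 := Submodule.finrank_mono hle
  have h2 := Submodule.finrank_add_le_finrank_add_finrank (cubicRange true) (cubicRange false)
  rw [finrank_cubicRange, finrank_cubicRange] at h2
  rw [finrank_biquadraticRange] at h1
  omega

/-- The three irreducible summands of the image of `𝓣⋆`. -/
def isotypicSummand : Fin 3 → Subrepresentation (funAction 4) :=
  ![(isCovariant_cubic true).subrep, (isCovariant_cubic false).subrep,
    isCovariant_biquadratic.subrep]

theorem range_dualWedgeMap_eq_iSup :
    LinearMap.range (dualWedgeMap 4) = ⨆ i, (isotypicSummand i).toSubmodule := by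
  rw [range_dualWedgeMap_eq_sup]
  refine le_antisymm (sup_le (sup_le ?_ ?_) ?_) (iSup_le fun i => ?_)
  · exact le_iSup (fun i => (isotypicSummand i).toSubmodule) 0
  · exact le_iSup (fun i => (isotypicSummand i).toSubmodule) 1
  · exact le_iSup (fun i => (isotypicSummand i).toSubmodule) 2
  · fin_cases i
    · exact le_sup_left.trans le_sup_left
    · exact le_sup_right.trans le_sup_left
    · exact le_sup_right

theorem iSupIndep_isotypicSummand : iSupIndep fun i => (isotypicSummand i).toSubmodule := by
  intro i
  fin_cases i
  · refine (disjoint_cubicRange true).mono_right (iSup₂_le fun j hj => ?_)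
    fin_cases j
    · exact absurd rfl hj
    · exact le_sup_left
    · exact le_sup_right
  · refine (disjoint_cubicRange false).mono_right (iSup₂_le fun j hj => ?_)
    fin_cases j
    · exact le_sup_left
    · exact absurd rfl hj
    · exact le_sup_right
  · refine disjoint_biquadraticRange.mono_right (iSup₂_le fun j hj => ?_)
    fin_cases j
    · exact le_sup_left
    · exact le_sup_right
    · exact absurd rfl hj

/-! ### Polynomial entries and vanishing on degenerate matrices -/

section PolynomialEntries

variable {V : Type*} [AddCommGroup V] [Module ℝ V] {m n p : Type*}

/-- The entries of the matrix-valued function `M` are polynomial functions. -/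
def HasPolyEntries (M : V → Matrix m n ℝ) : Prop := ∀ i j, (fun v => M v i j) ∈ polyFun V

theorem hasPolyEntries_linearMap (L : V →ₗ[ℝ] Matrix m n ℝ) : HasPolyEntries fun v => L v :=
  fun i j => Algebra.subset_adjoin ⟨LinearMap.proj j ∘ₗ LinearMap.proj i ∘ₗ L, rfl⟩

theorem const_mem_polyFun (c : ℝ) : (fun _ : V => c) ∈ polyFun V :=
  (polyFun V).algebraMap_mem c

theorem sum_mem_polyFun {ι : Type*} {s : Finset ι} {f : ι → V → ℝ}
    (h : ∀ i ∈ s, f i ∈ polyFun V) : (fun v => ∑ i ∈ s, f i v) ∈ polyFun V := by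
  have := sum_mem h
  rwa [Finset.sum_fn] at this

theorem prod_mem_polyFun {ι : Type*} {s : Finset ι} {f : ι → V → ℝ}
    (h : ∀ i ∈ s, f i ∈ polyFun V) : (fun v => ∏ i ∈ s, f i v) ∈ polyFun V := by
  have := prod_mem h
  rwa [Finset.prod_fn] at this

theorem HasPolyEntries.mul [Fintype n] {M : V → Matrix m n ℝ} {N : V → Matrix n p ℝ}
    (hM : HasPolyEntries M) (hN : HasPolyEntries N) : HasPolyEntries fun v => M v * N v :=
  fun i j => sum_mem_polyFun fun k _ => mul_mem (hM i k) (hN k j)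

theorem HasPolyEntries.transpose {M : V → Matrix m n ℝ} (hM : HasPolyEntries M) :
    HasPolyEntries fun v => (M v)ᵀ := fun i j => hM j i

theorem HasPolyEntries.const (M : Matrix m n ℝ) : HasPolyEntries fun _ : V => M :=
  fun i j => const_mem_polyFun (M i j)

theorem HasPolyEntries.pow [Fintype n] [DecidableEq n] {M : V → Matrix n n ℝ}
    (hM : HasPolyEntries M) (k : ℕ) : HasPolyEntries fun v => M v ^ k := by
  induction k with
  | zero => simpa only [pow_zero] using HasPolyEntries.const 1
  | succ k ih => simpa only [pow_succ] using ih.mul hM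

theorem HasPolyEntries.det_mem [Fintype n] [DecidableEq n] {M : V → Matrix n n ℝ}
    (hM : HasPolyEntries M) : (fun v => (M v).det) ∈ polyFun V := by
  simp only [det_apply]
  exact sum_mem_polyFun fun σ _ => zsmul_mem (prod_mem_polyFun fun i _ => hM _ _) _

theorem HasPolyEntries.moment {M : V → Matrix (Fin 4) (Fin 4) ℝ} (hM : HasPolyEntries M) :
    HasPolyEntries fun v => moment (M v) := by
  intro i j
  simp only [moment_apply, Matrix.trace, Matrix.diag_apply]
  exact sum_mem_polyFun fun k _ =>
    (hM.mul (HasPolyEntries.const (isoclinic true i * isoclinic false j))) k k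

theorem HasPolyEntries.gram {M : V → Matrix (Fin 4) (Fin 4) ℝ} (hM : HasPolyEntries M)
    (b : Bool) : HasPolyEntries fun v => gram b (M v) := by
  cases b
  · exact hM.moment.transpose.mul hM.moment
  · exact hM.moment.mul hM.moment.transpose

theorem HasPolyEntries.cubicTensor_mem {S : V → Matrix (Fin 3) (Fin 3) ℝ}
    (hS : HasPolyEntries S) (r : Fin 3 × Fin 3 × Fin 3) :
    (fun v => cubicTensor (S v) r) ∈ polyFun V := by
  have h : ∀ i j k, (fun v => tripleProduct (Pi.single i 1) (S v *ᵥ Pi.single j 1)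
      ((S v * S v) *ᵥ Pi.single k 1)) ∈ polyFun V := by
    intro i j k
    refine HasPolyEntries.det_mem fun a l => ?_
    fin_cases a
    · exact const_mem_polyFun (Pi.single (M := fun _ => ℝ) i 1 l)
    · simpa using hS l j
    · simpa using hS.mul hS l k
  exact add_mem (add_mem (add_mem (add_mem (add_mem (h _ _ _) (h _ _ _)) (h _ _ _)) (h _ _ _))
    (h _ _ _)) (h _ _ _)

end PolynomialEntries

theorem wedgeMinor_mem_polyFun (u v : Fin 3 → Fin 3 → ℝ) :
    (fun A : tracelessSymMat 4 => wedgeMinor u v A) ∈ polyFun (tracelessSymMat 4) := by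
  refine HasPolyEntries.det_mem fun i j => ?_
  have h := ((hasPolyEntries_linearMap (tracelessSymMat 4).subtype).pow ((i : ℕ) + 1)).moment
  simp only [of_apply, dotProduct, mulVec]
  exact sum_mem_polyFun fun k _ => mul_mem (const_mem_polyFun (u j k))
    (sum_mem_polyFun fun l _ => mul_mem (h k l) (const_mem_polyFun (v j l)))

/-- The row `i` of the minor is homogeneous of degree `i + 1`, and `1 + 2 + 3 = 6`. -/
theorem wedgeMinor_smul (u v : Fin 3 → Fin 3 → ℝ) (c : ℝ) (A : Matrix (Fin 4) (Fin 4) ℝ) :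
    wedgeMinor u v (c • A) = c ^ 6 * wedgeMinor u v A := by
  simp only [wedgeMinor, smul_pow, map_smul, smul_mulVec, dotProduct_smul, smul_eq_mul]
  have h := det_mul_column (fun i : Fin 3 => c ^ ((i : ℕ) + 1)) (of fun i j : Fin 3 =>
    u j ⬝ᵥ (moment (A ^ ((i : ℕ) + 1)) *ᵥ v j))
  simp only [of_apply] at h
  rw [h, Fin.prod_univ_three]
  congr 1
  simp
  ring

theorem charpoly_conj (g : SO 4) (d : Fin 4 → ℝ) :
    ((g : Matrix (Fin 4) (Fin 4) ℝ) * diagonal d * (g : Matrix (Fin 4) (Fin 4) ℝ)ᵀ).charpoly =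
      ∏ i, (Polynomial.X - Polynomial.C (d i)) := by
  rw [charpoly_mul_comm, ← mul_assoc, SO_transpose_mul, one_mul, charpoly_diagonal]

theorem roots_prod_X_sub_C_fin (d : Fin 4 → ℝ) :
    (∏ i, (Polynomial.X - Polynomial.C (d i))).roots = Finset.univ.val.map d := by
  rw [Polynomial.roots_prod _ _ (Finset.prod_ne_zero_iff.2 fun i _ => Polynomial.X_sub_C_ne_zero _)]
  simp [Multiset.bind_singleton]

theorem vandermonde3_momentEntries (d : Fin 4 → ℝ) :
    vandermonde3 (fun i => momentEntries d i ^ 2) = -64 * ((d 1 - d 0) * (d 2 - d 0) *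
      (d 3 - d 0) * (d 2 - d 1) * (d 3 - d 1) * (d 3 - d 2)) := by
  simp [vandermonde3, momentEntries]
  ring

theorem not_injective_of_isDegenerate {g : SO 4} {d : Fin 4 → ℝ}
    (h : IsDegenerate ((g : Matrix (Fin 4) (Fin 4) ℝ) * diagonal d *
      (g : Matrix (Fin 4) (Fin 4) ℝ)ᵀ)) : ¬ Function.Injective d := by
  intro hd
  obtain ⟨μ, hμ⟩ := h
  rw [charpoly_conj, ← Polynomial.count_roots, roots_prod_X_sub_C_fin] at hμ
  exact absurd (Multiset.nodup_iff_count_le_one.1 (Finset.univ.nodup.map hd) μ) (not_le.2 hμ)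

/-- A multiple eigenvalue makes the Vandermonde product of a diagonalization vanish. -/
theorem wedgeMinor_eq_zero_of_isDegenerate (u v : Fin 3 → Fin 3 → ℝ)
    {A : Matrix (Fin 4) (Fin 4) ℝ} (hA : A.IsSymm) (h : IsDegenerate A) :
    wedgeMinor u v A = 0 := by
  obtain ⟨g, d, rfl⟩ := exists_SO_diagonal hA
  obtain ⟨i, j, hij, hne⟩ := Function.not_injective_iff.1 (not_injective_of_isDegenerate h)
  rw [wedgeMinor_conj, wedgeMinor_diagonal, vandermonde3_momentEntries]
  have : (d 1 - d 0) * (d 2 - d 0) * (d 3 - d 0) * (d 2 - d 1) * (d 3 - d 1) * (d 3 - d 2) = 0 := by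
    fin_cases i <;> fin_cases j <;> first | exact absurd rfl hne | (simp at hij; simp [hij])
  rw [this]
  ring

theorem range_dualWedgeMap_le_idealComponent :
    LinearMap.range (dualWedgeMap 4) ≤ idealComponent (vanishingIdeal (degenerateSet 4)) 6 :=
  range_dualWedgeMap_le fun u v =>
    ⟨⟨⟨_, wedgeMinor_mem_polyFun u v⟩, fun A hA =>
      wedgeMinor_eq_zero_of_isDegenerate u v (mem_tracelessSymMat.1 A.2).1 hA, rfl⟩,
      fun c A => wedgeMinor_smul u v c A⟩

/-! ### The discriminant as a sum of squares -/

section Discriminant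

theorem discr_prod_X_sub_C_fin (d : Fin 4 → ℝ) :
    (∏ i, (Polynomial.X - Polynomial.C (d i))).discr = ((d 1 - d 0) * (d 2 - d 0) *
      (d 3 - d 0) * (d 2 - d 1) * (d 3 - d 1) * (d 3 - d 2)) ^ 2 := by
  set f : Polynomial ℝ := ∏ i, (Polynomial.X - Polynomial.C (d i)) with hf
  have hm : f.Monic := Polynomial.monic_prod_of_monic _ _ fun i _ => Polynomial.monic_X_sub_C _
  have hn : f.natDegree = 4 := by
    rw [hf, Polynomial.natDegree_prod_of_monic _ _ fun i _ => Polynomial.monic_X_sub_C _]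
    simp
  have hs : f.Splits := Polynomial.Splits.prod fun i _ => Polynomial.Splits.X_sub_C _
  have h1 := Polynomial.resultant_deriv (f := f)
    (Polynomial.natDegree_pos_iff_degree_pos.1 (by rw [hn]; norm_num))
  have h2 := Polynomial.resultant_eq_prod_eval f (Polynomial.derivative f) (f.natDegree - 1)
    (Polynomial.natDegree_derivative_le f) hs
  rw [h2, hm.leadingCoeff, hn] at h1
  norm_num at h1
  rw [← h1, hf, roots_prod_X_sub_C_fin]
  simp [Fin.prod_univ_four, Fin.univ_val_map, List.ofFn_succ]
  ring

/-- The squared norm of a symmetric harmonic cubic tensor as a positive combination of seven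
squares. The coordinates pair up as `4 a² + 4 b² + 2 a b = 5/2 (a + b)² + 3/2 (a - b)²`. -/
theorem sum_cubicTensor_sq (S : Matrix (Fin 3) (Fin 3) ℝ) (hS : Sᵀ = S) :
    cubicTensor S ⬝ᵥ cubicTensor S = 6 * cubicCoords S 0 ^ 2 +
      (5 / 2 * (cubicCoords S 1 + cubicCoords S 2) ^ 2 +
        3 / 2 * (cubicCoords S 1 - cubicCoords S 2) ^ 2) +
      (5 / 2 * (cubicCoords S 3 + cubicCoords S 4) ^ 2 +
        3 / 2 * (cubicCoords S 3 - cubicCoords S 4) ^ 2) +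
      (5 / 2 * (cubicCoords S 5 + cubicCoords S 6) ^ 2 +
        3 / 2 * (cubicCoords S 5 - cubicCoords S 6) ^ 2) := by
  simp only [dotProduct, Fintype.sum_prod_type, cubicTensor_eq_ofCoords hS, Fin.sum_univ_three]
  generalize cubicCoords S = x
  simp [cubicOfCoords]
  ring

/-- The squared norm of the cubic tensor is `6 · 64²` times the discriminant: it is invariant under
rotations, and for diagonal matrices the tensor is `-64` times the Vandermonde product of the
eigenvalues times `cubicBase`, whose squared norm is `6`. -/
theorem discr_charpoly_eq {A : Matrix (Fin 4) (Fin 4) ℝ} (hA : A.IsSymm) :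
    24576 * A.charpoly.discr = cubicTensor (gram true A) ⬝ᵥ cubicTensor (gram true A) := by
  obtain ⟨g, d, rfl⟩ := exists_SO_diagonal hA
  have hinv : ∀ x, (cubicRot true g *ᵥ x) ⬝ᵥ (cubicRot true g *ᵥ x) = x ⬝ᵥ x := fun x => by
    rw [dotProduct_mulVec, ← mulVec_transpose, mulVec_mulVec, cubicRot_transpose_mul, one_mulVec]
  have hbase : cubicBase ⬝ᵥ cubicBase = 6 := by
    simp [dotProduct, Fintype.sum_prod_type, Fin.sum_univ_three, cubicBase, permanent3]
    norm_num
  rw [gram_conj, cubicTensor_conj (rot_transpose_mul true g) (rot_mul_transpose true g)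
    (det_rot true g)]
  change _ = (cubicRot true g *ᵥ _) ⬝ᵥ (cubicRot true g *ᵥ _)
  rw [hinv, gram_diagonal, cubicTensor_diagonal, smul_dotProduct, dotProduct_smul, hbase,
    vandermonde3_momentEntries, charpoly_conj, discr_prod_X_sub_C_fin]
  simp only [smul_eq_mul]
  ring

theorem exists_discr_eq_sum_sq : ∃ f : Fin 7 → polyFun (symMat 4), ∀ A : symMat 4,
    (A : Matrix (Fin 4) (Fin 4) ℝ).charpoly.discr = ∑ i, ((f i : symMat 4 → ℝ) A) ^ 2 := by
  have hx : ∀ i, (fun A : symMat 4 => cubicCoords (gram true A) i) ∈ polyFun (symMat 4) := by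
    have h := fun r => ((hasPolyEntries_linearMap (symMat 4).subtype).gram true).cubicTensor_mem r
    intro i
    fin_cases i <;> exact h _
  let x : Fin 7 → polyFun (symMat 4) := fun i => ⟨_, hx i⟩
  -- the weights `6`, `5 / 2`, `3 / 2` of the squared norm, divided by `6 * 64 ^ 2`, are the squares
  -- of `1 / 64`, `√(5 / 12) / 64` and `1 / 128`
  refine ⟨![(1 / 64 : ℝ) • x 0, (√(5 / 12) / 64) • (x 1 + x 2), (1 / 128 : ℝ) • (x 1 - x 2),
    (√(5 / 12) / 64) • (x 3 + x 4), (1 / 128 : ℝ) • (x 3 - x 4),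
    (√(5 / 12) / 64) • (x 5 + x 6), (1 / 128 : ℝ) • (x 5 - x 6)], fun A => ?_⟩
  have h := (discr_charpoly_eq A.2).trans (sum_cubicTensor_sq _ (gram_transpose true _))
  have hs : √(5 / 12) ^ 2 = (5 / 12 : ℝ) := Real.sq_sqrt (by norm_num)
  simp only [Fin.sum_univ_seven]
  change _ = (1 / 64 * cubicCoords (gram true A) 0) ^ 2 +
    (√(5 / 12) / 64 * (cubicCoords (gram true A) 1 + cubicCoords (gram true A) 2)) ^ 2 +
    (1 / 128 * (cubicCoords (gram true A) 1 - cubicCoords (gram true A) 2)) ^ 2 +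
    (√(5 / 12) / 64 * (cubicCoords (gram true A) 3 + cubicCoords (gram true A) 4)) ^ 2 +
    (1 / 128 * (cubicCoords (gram true A) 3 - cubicCoords (gram true A) 4)) ^ 2 +
    (√(5 / 12) / 64 * (cubicCoords (gram true A) 5 + cubicCoords (gram true A) 6)) ^ 2 +
    (1 / 128 * (cubicCoords (gram true A) 5 - cubicCoords (gram true A) 6)) ^ 2
  simp only [mul_pow, div_pow, hs]
  linear_combination (1 / 24576) * h

end Discriminant

end

end SymDisc


theorem theorem3 :
    (LinearMap.range (dualWedgeMap 4) ≤ idealComponent (vanishingIdeal (degenerateSet 4)) 6 ∧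
      ∃ W : Fin 3 → Subrepresentation (funAction 4),
        (LinearMap.range (dualWedgeMap 4) = ⨆ i, (W i).toSubmodule) ∧
        iSupIndep (fun i => (W i).toSubmodule) ∧
        IsIrrepOfHighestWeight (W 0).toRepresentation (3, 3) ∧
        IsIrrepOfHighestWeight (W 1).toRepresentation (3, -3) ∧
        IsIrrepOfHighestWeight (W 2).toRepresentation (4, 0) ∧
        Module.finrank ℝ (W 0).toSubmodule = 7 ∧
        Module.finrank ℝ (W 1).toSubmodule = 7 ∧
        Module.finrank ℝ (W 2).toSubmodule = 25) ∧
    ∃ f : Fin 7 → polyFun (symMat 4), ∀ A : symMat 4,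
      (A : Matrix (Fin 4) (Fin 4) ℝ).charpoly.discr =
        ∑ i, ((f i : symMat 4 → ℝ) A) ^ 2 :=
  ⟨⟨range_dualWedgeMap_le_idealComponent, isotypicSummand, range_dualWedgeMap_eq_iSup,
    iSupIndep_isotypicSummand, isIrrep_cubic true, isIrrep_cubic false, isIrrep_biquadratic,
    finrank_cubic true, finrank_cubic false, finrank_biquadratic⟩, exists_discr_eq_sum_sq⟩
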